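/- Let $q$ be a power of an odd prime, $m\ge 1$, $n=2m$, and $S_m=\mathbb{F}_q[y_1,\dots,y_m,x_m,\dots,x_1]$, with variables in this order. A matrix $g\in \mathrm{GL}_n(\mathbb{F}_q)$ acts on $S_m$ from the right by algebra automorphisms, the $i$-th variable being sent to the linear form whose coefficients are the $i$-th row of $g$. Put $\xi_0=\sum_{i=1}^m y_ix_i$ and $\xi_j=\sum_{i=1}^m\big(y_i^{q^j}x_i+y_ix_i^{q^j}\big)$ for $j>0$, and let $O^+_{2m}(\mathbb{F}_q)=\{g\in \mathrm{GL}_n(\mathbb{F}_q) : \xi_0\cdot g=\xi_0\}$. Let $P_m$ be the subgroup of upper triangular unipotent elements of $O^+_{2m}(\mathbb{F}_q)$, and let the Hook subgroup $H$ be the subgroup of the unipotent elements of $O^+_{2m}(\mathbb{F}_q)$ that differ from the identity matrix only in the first row and the last column. Let $N(y_1)$ be the product of the distinct elements of the $P_m$-orbit of $y_1$. Let $Q=\mathbb{F}_q[y_2,\dots,y_m,x_m,\dots,x_1]$, let $Q^H=Q\cap S_m^H$, and for $2\le i\le m$ let $Y_i=y_i^q-y_ix_1^{q-1}$ and $X_i=x_i^q-x_ix_1^{q-1}$.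 Let $A=Q^H[N(y_1),\xi_0,\dots,\xi_{n-3}]$, the $\mathbb{F}_q$-subalgebra of $S_m$ generated by $Q^H$ and these elements (for $m=1$ there are no $\xi_j$). Then: 1. $Q^H=\mathbb{F}_q[x_1,Y_2,X_2,\dots,Y_m,X_m]$. 2. $S_m^H=A$. 3. $A$ is a complete intersection, that is, a quotient of a polynomial ring over $\mathbb{F}_q$ in finitely many variables by an ideal generated by a regular sequence. More precisely, $A$ is generated by $x_1$, $Y_i,X_i$ ($2\le i\le m$), $N(y_1)$, $\xi_0,\dots,\xi_{n-3}$, and the ideal of relations between these generators is generated by a regular sequence of $n-2$ elements that are homogeneous when each variable is given the degree of the corresponding generator. 4. $A$ is a free module over $Q^H[N(y_1)]$ with basis the monomial factors $\xi_0^{e_0}\cdots\xi_{n-3}^{e_{n-3}}$, $0\le e_j\le q-1$, of $(\xi_0\cdots\xi_{n-3})^{q-1}$. 5. $x_1$ is a prime element of $A$. -/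

import Mathlib

namespace OrthHook

open MvPolynomial

noncomputable section

/-! Variables are indexed by `Fin (2 * m)` in the order `y₁, …, yₘ, xₘ, …, x₁`.  The indices `i` of
`yᵢ` and `xᵢ` are zero-based: `i : Fin m` stands for the `(i + 1)`-st hyperbolic pair. -/

/-- The polynomial ring `S_m = F[y₁, …, yₘ, xₘ, …, x₁]`. -/
abbrev S (F : Type*) [Field F] (m : ℕ) : Type _ := MvPolynomial (Fin (2 * m)) F

/-- The position of `yᵢ` in the list of variables. -/
def yIdx {m : ℕ} (i : Fin m) : Fin (2 * m) := ⟨i, by omega⟩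

/-- The position of `xᵢ` in the list of variables. -/
def xIdx {m : ℕ} (i : Fin m) : Fin (2 * m) := (yIdx i).rev

/-- The variable `yᵢ`. -/
def y (F : Type*) [Field F] {m : ℕ} (i : Fin m) : S F m := X (yIdx i)

/-- The variable `xᵢ`. -/
def x (F : Type*) [Field F] {m : ℕ} (i : Fin m) : S F m := X (xIdx i)

section Action

variable {F : Type*} [Field F] {m : ℕ}

/-- The right action `f ↦ f · g` of a matrix: the `i`-th variable goes to the linear form whose
coefficients are the `i`-th row of `g`. -/
def act (g : Matrix (Fin (2 * m)) (Fin (2 * m)) F) : S F m →ₐ[F] S F m :=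
  aeval fun i => ∑ j, C (g i j) * X j

theorem act_one : act (1 : Matrix (Fin (2 * m)) (Fin (2 * m)) F) = AlgHom.id F (S F m) := by
  ext i : 1
  simp only [act, aeval_X, AlgHom.id_apply]
  rw [Finset.sum_eq_single i]
  · simp
  · intro j _ hj
    simp [Matrix.one_apply_ne hj.symm]
  · simp

theorem act_mul (g h : Matrix (Fin (2 * m)) (Fin (2 * m)) F) (f : S F m) :
    act (g * h) f = act h (act g f) := by
  have : act (g * h) = (act h).comp (act g) := by
    ext i : 1
    simp only [act, aeval_X, AlgHom.comp_apply, map_sum, map_mul, Matrix.mul_apply,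
      Finset.sum_mul, Finset.mul_sum, algHom_C, algebraMap_eq, mul_assoc]
    rw [Finset.sum_comm]
  rw [this, AlgHom.comp_apply]

/-- The matrix `g` differs from the identity only in the first row and the last column. -/
def IsHookShaped (g : Matrix (Fin (2 * m)) (Fin (2 * m)) F) : Prop :=
  ∀ i j : Fin (2 * m), (i : ℕ) ≠ 0 → (j : ℕ) + 1 ≠ 2 * m →
    g i j = (1 : Matrix (Fin (2 * m)) (Fin (2 * m)) F) i j

theorem IsHookShaped.mul {g h : Matrix (Fin (2 * m)) (Fin (2 * m)) F}
    (hg : IsHookShaped g) (hh : IsHookShaped h) : IsHookShaped (g * h) := by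
  intro i j hi hj
  rw [← hh i j hi hj, Matrix.mul_apply, Finset.sum_eq_single i]
  · by_cases hl : (i : ℕ) + 1 = 2 * m
    · have hij : i ≠ j := by rintro rfl; exact hj hl
      rw [hh i j hi hj, Matrix.one_apply_ne hij, mul_zero]
    · rw [hg i i hi hl, Matrix.one_apply_eq, one_mul]
  · intro k _ hk
    by_cases hl : (k : ℕ) + 1 = 2 * m
    · have hkj : k ≠ j := by rintro rfl; exact hj hl
      rw [hh k j (by omega) hj, Matrix.one_apply_ne hkj, mul_zero]
    · rw [hg i k hi hl, Matrix.one_apply_ne hk.symm, zero_mul]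
  · simp

theorem IsHookShaped.isUpperTriangular {g : Matrix (Fin (2 * m)) (Fin (2 * m)) F}
    (hg : IsHookShaped g) : g.IsUpperTriangular := by
  intro i j hij
  have hij : j < i := hij
  rw [hg i j (by omega) (by omega), Matrix.one_apply_ne hij.ne']

/-- A hook shaped matrix is unipotent if and only if its diagonal entries are equal to `1`. -/
theorem IsHookShaped.unipotent_iff {g : Matrix (Fin (2 * m)) (Fin (2 * m)) F}
    (hg : IsHookShaped g) : IsNilpotent (g - 1) ↔ ∀ i, g i i = 1 := by
  have ht : (g - 1).IsUpperTriangular := by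
    intro i j hij
    have hij' : j < i := hij
    rw [Matrix.sub_apply, hg.isUpperTriangular hij, Matrix.one_apply_ne hij'.ne', sub_zero]
  have hc := Matrix.charpoly_of_isUpperTriangular (g - 1) ht
  constructor
  · intro hn i
    have h1 := (Matrix.isNilpotent_charpoly_sub_pow_of_isNilpotent hn).eq_zero
    rw [sub_eq_zero, hc] at h1
    have h2 := congrArg (Polynomial.eval ((g - 1) i i)) h1
    rw [Polynomial.eval_prod, Finset.prod_eq_zero (Finset.mem_univ i) (by simp)] at h2
    have h3 : (g - 1) i i = 0 := by
      simp only [Polynomial.eval_pow, Polynomial.eval_X] at h2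
      exact eq_zero_of_pow_eq_zero h2.symm
    rwa [Matrix.sub_apply, Matrix.one_apply_eq, sub_eq_zero] at h3
  · intro hd
    have h1 : (g - 1).charpoly = Polynomial.X ^ (2 * m) := by
      rw [hc]
      simp [hd]
    have h2 := Matrix.aeval_self_charpoly (g - 1)
    rw [h1, map_pow, Polynomial.aeval_X] at h2
    exact ⟨_, h2⟩

end Action

/-- A multiplicatively closed subset of a finite group that contains `1` is closed under inverses. -/
theorem inv_mem_of_finite {G : Type*} [Group G] [Finite G] (M : Submonoid G) {g : G} (hg : g ∈ M) :
    g⁻¹ ∈ M := by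
  have h : g⁻¹ = g ^ (orderOf g - 1) := by
    rw [inv_eq_iff_mul_eq_one, ← pow_succ', Nat.sub_add_cancel (orderOf_pos g), pow_orderOf_eq_one]
  rw [h]
  exact pow_mem hg _

/-- The subgroup of a finite group carried by a submonoid. -/
def subgroupOfSubmonoid {G : Type*} [Group G] [Finite G] (M : Submonoid G) : Subgroup G :=
  { M with inv_mem' := fun hg => inv_mem_of_finite M hg }

section Forms

variable (F : Type*) [Field F] [Fintype F] (m : ℕ)

/-- `ξ₀ = ∑ yᵢ xᵢ`, and `ξⱼ = ∑ (yᵢ^(q^j) xᵢ + yᵢ xᵢ^(q^j))` for `j > 0`, where `q = |F|`. -/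
def xi (j : ℕ) : S F m :=
  if j = 0 then ∑ i : Fin m, y F i * x F i
  else ∑ i : Fin m,
    (y F i ^ Fintype.card F ^ j * x F i + y F i * x F i ^ Fintype.card F ^ j)

/-- The orthogonal group of plus type: the matrices that fix the quadratic form `ξ₀`. -/
def orthogonalPlus : Subgroup (GL (Fin (2 * m)) F) where
  carrier := {g | act (g : Matrix _ _ F) (xi F m 0) = xi F m 0}
  one_mem' := by simp [act_one]
  mul_mem' := by
    intro g h hg hh
    simp only [Set.mem_ofPred_eq, Units.val_mul] at *
    rw [act_mul, hg, hh]
  inv_mem' := by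
    intro g hg
    simp only [Set.mem_ofPred_eq] at *
    calc act (↑g⁻¹ : Matrix _ _ F) (xi F m 0)
        = act (↑g⁻¹ : Matrix _ _ F) (act (g : Matrix _ _ F) (xi F m 0)) := by rw [hg]
      _ = xi F m 0 := by
        rw [← act_mul, ← Units.val_mul, mul_inv_cancel, Units.val_one, act_one, AlgHom.id_apply]

/-- The group of upper triangular unipotent matrices. -/
def unitriangular : Subgroup (GL (Fin (2 * m)) F) :=
  subgroupOfSubmonoid
    { carrier := {g | (∀ i j : Fin (2 * m), j < i →
          (g : Matrix (Fin (2 * m)) (Fin (2 * m)) F) i j = 0) ∧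
        ∀ i, (g : Matrix (Fin (2 * m)) (Fin (2 * m)) F) i i = 1}
      one_mem' := ⟨fun _ _ h => Matrix.one_apply_ne h.ne', fun _ => Matrix.one_apply_eq _⟩
      mul_mem' := by
        rintro g h ⟨hg, hg'⟩ ⟨hh, hh'⟩
        refine ⟨fun i j hij => ?_, fun i => ?_⟩
        · rw [Units.val_mul, Matrix.mul_apply]
          refine Finset.sum_eq_zero fun k _ => ?_
          rcases lt_or_ge k i with hk | hk
          · rw [hg i k hk, zero_mul]
          · rw [hh k j (hij.trans_le hk), mul_zero]
        · rw [Units.val_mul, Matrix.mul_apply, Finset.sum_eq_single i]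
          · rw [hg', hh', mul_one]
          · intro k _ hk
            rcases lt_or_gt_of_ne hk with hk | hk
            · rw [hg i k hk, zero_mul]
            · rw [hh k i hk, mul_zero]
          · simp }

/-- The Sylow `p`-subgroup `P_m` of the orthogonal group: its upper triangular unipotent elements. -/
def sylow : Subgroup (GL (Fin (2 * m)) F) := orthogonalPlus F m ⊓ unitriangular F m

/-- The Hook subgroup `H` of the orthogonal group: the unipotent matrices that differ from the
identity only in the first row and the last column. -/
def hook : Subgroup (GL (Fin (2 * m)) F) :=
  orthogonalPlus F m ⊓ subgroupOfSubmonoid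
    { carrier := {g | IsNilpotent ((g : Matrix (Fin (2 * m)) (Fin (2 * m)) F) - 1) ∧
        IsHookShaped (g : Matrix (Fin (2 * m)) (Fin (2 * m)) F)}
      one_mem' := ⟨by simp, fun _ _ _ _ => rfl⟩
      mul_mem' := by
        rintro g h ⟨hg, hg'⟩ ⟨hh, hh'⟩
        have hgh := hg'.mul hh'
        refine ⟨?_, by rw [Units.val_mul]; exact hgh⟩
        rw [Units.val_mul, hgh.unipotent_iff]
        intro i
        rw [Matrix.mul_apply, Finset.sum_eq_single i]
        · rw [hg'.unipotent_iff.1 hg, hh'.unipotent_iff.1 hh, mul_one]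
        · intro k _ hk
          rcases lt_or_gt_of_ne hk with hk | hk
          · rw [hg'.isUpperTriangular (show k < i from hk), zero_mul]
          · rw [hh'.isUpperTriangular (show i < k from hk), mul_zero]
        · simp }

theorem mem_hook_iff (g : GL (Fin (2 * m)) F) :
    g ∈ hook F m ↔ act (g : Matrix _ _ F) (xi F m 0) = xi F m 0 ∧
      IsNilpotent ((g : Matrix (Fin (2 * m)) (Fin (2 * m)) F) - 1) ∧
      IsHookShaped (g : Matrix (Fin (2 * m)) (Fin (2 * m)) F) := Iff.rfl

end Forms

section Invariants

variable {F : Type*} [Field F] {m : ℕ}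

/-- The ring of invariants `S_m^G`. -/
def invariants (G : Subgroup (GL (Fin (2 * m)) F)) : Subalgebra F (S F m) where
  carrier := {f | ∀ g ∈ G, act (g : Matrix _ _ F) f = f}
  mul_mem' := fun ha hb g hg => by rw [map_mul, ha g hg, hb g hg]
  add_mem' := fun ha hb g hg => by rw [map_add, ha g hg, hb g hg]
  algebraMap_mem' := fun r g _ => AlgHom.commutes _ r

/-- The orbit product of `v` over `G`: the product of the distinct elements of the (finite) orbit. -/
def orbitProduct (G : Subgroup (GL (Fin (2 * m)) F)) (v : S F m) : S F m :=
  ∏ᶠ w ∈ {w : S F m | ∃ g ∈ G, w = act (g : Matrix _ _ F) v}, w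

end Invariants

section HookRing

variable (F : Type*) [Field F] [Fintype F] (m : ℕ) [NeZero m]

/-- `N(y₁)`, the orbit product of `y₁` over the Sylow subgroup. -/
def normY : S F m := orbitProduct (sylow F m) (y F 0)

/-- `Yᵢ = yᵢ^q - yᵢ x₁^(q-1)`. -/
def bigY (i : Fin m) : S F m :=
  y F i ^ Fintype.card F - y F i * x F 0 ^ (Fintype.card F - 1)

/-- `Xᵢ = xᵢ^q - xᵢ x₁^(q-1)`. -/
def bigX (i : Fin m) : S F m :=
  x F i ^ Fintype.card F - x F i * x F 0 ^ (Fintype.card F - 1)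

/-- `Q`, the subalgebra of `S_m` generated by all the variables except `y₁`. -/
def Q : Subalgebra F (S F m) := supported F {i | i ≠ yIdx 0}

/-- `Q^H`, the `H`-invariants in `Q`. -/
def QH : Subalgebra F (S F m) := Q F m ⊓ invariants (hook F m)

/-- `Q^H[N(y₁)]`. -/
def QHN : Subalgebra F (S F m) := Algebra.adjoin F ((QH F m : Set (S F m)) ∪ {normY F m})

/-- `A = Q^H[N(y₁), ξ₀, …, ξ_{n-3}]`, where `n = 2m`. -/
def A : Subalgebra F (S F m) :=
  Algebra.adjoin F ((QH F m : Set (S F m)) ∪ {normY F m} ∪ {f | ∃ j < 2 * m - 2, f = xi F m j})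

/-- Labels for the elements `x₁`, `Yᵢ` and `Xᵢ` for `2 ≤ i ≤ m`, `N(y₁)`, and `ξ₀, …, ξ_{n-3}`. -/
inductive Gen (m : ℕ) [NeZero m] : Type
  | x₁ : Gen m
  | Y (i : Fin m) (hi : i ≠ 0) : Gen m
  | X (i : Fin m) (hi : i ≠ 0) : Gen m
  | N : Gen m
  | xi (j : Fin (2 * m - 2)) : Gen m

/-- The elements `x₁`, `Yᵢ` and `Xᵢ` for `2 ≤ i ≤ m`, `N(y₁)`, and `ξ₀, …, ξ_{n-3}`. -/
def gen : Gen m → S F m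
  | .x₁ => x F 0
  | .Y i _ => bigY F m i
  | .X i _ => bigX F m i
  | .N => normY F m
  | .xi j => OrthHook.xi F m j

/-- The monomial factors `ξ₀^{e₀} ⋯ ξ_{n-3}^{e_{n-3}}`, `0 ≤ eⱼ ≤ q - 1`, of
`(ξ₀ ⋯ ξ_{n-3})^(q-1)`. -/
def blockMonomial (e : Fin (2 * m - 2) → Fin (Fintype.card F)) : S F m :=
  ∏ j : Fin (2 * m - 2), xi F m (j : ℕ) ^ (e j : ℕ)

end HookRing

/-- The `k`-algebra `B` is a complete intersection: it is the quotient of a polynomial ring in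
finitely many variables by an ideal generated by a regular sequence. -/
def IsCompleteIntersection (k B : Type*) [Field k] [CommRing B] [Algebra k B] : Prop :=
  ∃ (r : ℕ) (π : MvPolynomial (Fin r) k →ₐ[k] B) (rs : List (MvPolynomial (Fin r) k)),
    Function.Surjective π ∧
    RingTheory.Sequence.IsRegular (MvPolynomial (Fin r) k) rs ∧
    RingHom.ker π = Ideal.ofList rs

/-- The elements `rs` are a complete intersection presentation of the subalgebra `B` on the
(homogeneous) generators `g`: the `g i` generate `B`, and `rs` is a regular sequence of polynomials,
homogeneous when the variable of `g i` has the degree of `g i`, that generates the ideal of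
relations between the `g i`. -/
def IsCompleteIntersectionPresentation {k σ ι : Type*} [Field k]
    (B : Subalgebra k (MvPolynomial σ k)) (g : ι → MvPolynomial σ k)
    (rs : List (MvPolynomial ι k)) : Prop :=
  Algebra.adjoin k (Set.range g) = B ∧
  (∀ r ∈ rs, ∃ d, IsWeightedHomogeneous (fun i => (g i).totalDegree) r d) ∧
  RingTheory.Sequence.IsRegular (MvPolynomial ι k) rs ∧
  RingHom.ker (aeval g : MvPolynomial ι k →ₐ[k] MvPolynomial σ k) = Ideal.ofList rs

end

end OrthHook

/-! Put q = |F| and d = 2m - 2, and call the variables other than y₁ and x₁ inner. Every isotropic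
vector whose y₁-entry is 1 is the first row of an element of H (`exists_mem_hook`), so on `Q` the
group acts through all independent translations of inner variables by scalar multiples of x₁. A
polynomial in T that is invariant under all T ↦ T + c x₁ is a polynomial in T^q - x₁^(q-1) T
(`exists_comp_artin`). Applied one variable at a time, this gives Q^H.

The heart of the proof is `X_dvd_of_X_dvd_comb`. Let `theta` substitute N(y₁), Yᵢ, Xᵢ for y₁, yᵢ,
xᵢ; its image is Q^H[N(y₁)]. If x₁ divides a sum of terms `theta (β e)` ξ^e with all exponents below
q, then x₁ divides every `β e`. Indeed, modulo x₁ the Yᵢ and Xᵢ become q-th powers of variables,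
N(y₁) stays monic in y₁, and the ξⱼ lose y₁. Comparing coefficients leaves relations ∑ b_e^q ∏
ξ̄ⱼ^(eⱼ) = 0. The Jacobian matrix of the ξ̄ⱼ in the inner variables is a Moore matrix with nonzero
determinant, so such relations are trivial (`eq_zero_of_sum_pow_card_mul_prod`).

Dividing repeatedly by x₁ gives linear independence of the block monomials. For generation, the
y₁-degree of ξ^e is ∑ eⱼ q^j, which takes each value below q^d exactly once, the leading coefficient
of ξ^e is a power of x₁, and N(y₁) is monic of degree q^d. Division in y₁ therefore writes x₁^K f as
a combination for every invariant f, and the divisibility lemma removes x₁^K (`exists_eq_comb`).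
This proves S^H = A and freeness. Since A is a ring of invariants, x₁S ∩ A = x₁A, so x₁ stays prime
in A.

Expanding ξⱼ^q in the basis gives d relations rⱼ. The nonzero terms of a combination have distinct
y₁-degrees, so none of them exceeds the degree of ξⱼ^q, and a weight built on the y₁-degree makes
ξⱼ^q the leading term of rⱼ. Replacing the q-th powers of the ξ-variables by the rⱼ is then a
bijective linear map that carries regularity over to the rⱼ (`isRegular_of_isLead`). Modulo the rⱼ
all ξ-exponents can be made smaller than q, and on such polynomials evaluation is injective by
freeness, so the rⱼ generate all relations. -/

namespace OrthHook

open MvPolynomial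

noncomputable section

/-! ### Polynomials invariant under translation by multiples of x -/

section Artin

variable (F : Type*) [Field F] [Fintype F] {R : Type*} [CommRing R]

/-- The polynomial `T^q - x^(q-1) T`, the product of the `T - c x` over all scalars `c`. -/
def artin (x : R) : Polynomial R :=
  Polynomial.X ^ Fintype.card F - Polynomial.C (x ^ (Fintype.card F - 1)) * Polynomial.X

theorem artin_monic (x : R) : (artin F x).Monic :=
  Polynomial.monic_X_pow_sub <| (Polynomial.degree_C_mul_X_le _).trans_lt
    (by exact_mod_cast Fintype.one_lt_card)

theorem natDegree_artin [Nontrivial R] (x : R) : (artin F x).natDegree = Fintype.card F := by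
  refine Polynomial.natDegree_eq_of_degree_eq_some ?_
  rw [artin, Polynomial.degree_sub_eq_left_of_degree_lt, Polynomial.degree_X_pow]
  rw [Polynomial.degree_X_pow]
  exact (Polynomial.degree_C_mul_X_le _).trans_lt (by exact_mod_cast Fintype.one_lt_card)

theorem pow_card_pred_mul (x : R) : x ^ (Fintype.card F - 1) * x = x ^ Fintype.card F := by
  rw [← pow_succ, Nat.sub_add_cancel Fintype.card_pos]

end Artin

section FiniteFieldAlgebra

variable {F R : Type*} [Field F] [Fintype F] [CommRing R] [Algebra F R]

theorem add_pow_card (a b : R) :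
    (a + b) ^ Fintype.card F = a ^ Fintype.card F + b ^ Fintype.card F :=
  map_add (FiniteField.frobeniusAlgHom F R) a b

theorem algebraMap_pow_card (c : F) : (algebraMap F R c) ^ Fintype.card F = algebraMap F R c :=
  (FiniteField.frobeniusAlgHom F R).commutes c

theorem artin_eval_smul (x : R) (c : F) : (artin F x).eval (algebraMap F R c * x) = 0 := by
  simp only [artin, Polynomial.eval_sub, Polynomial.eval_pow, Polynomial.eval_X,
    Polynomial.eval_mul, Polynomial.eval_C, mul_pow, algebraMap_pow_card]
  rw [← pow_card_pred_mul F x]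
  ring

theorem artin_comp (x : R) (c : F) :
    (artin F x).comp (Polynomial.X + Polynomial.C (algebraMap F R c * x)) = artin F x := by
  have h := artin_eval_smul (F := F) x c
  simp only [artin, Polynomial.eval_sub, Polynomial.eval_pow, Polynomial.eval_X,
    Polynomial.eval_mul, Polynomial.eval_C] at h
  simp only [artin, Polynomial.sub_comp, Polynomial.pow_comp, Polynomial.X_comp,
    Polynomial.mul_comp, Polynomial.C_comp, add_pow_card, mul_add]
  rw [← Polynomial.C_pow, sub_eq_zero.1 h, Polynomial.C_mul]
  ring

/-- Invariance gives g the value g(0) at all q points c x, so `artin F x` divides g - g(0). The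
quotient is again invariant and has smaller degree. -/
theorem exists_comp_artin [IsDomain R] {x : R} (hx : x ≠ 0) (g : Polynomial R)
    (hg : ∀ c : F, g.comp (Polynomial.X + Polynomial.C (algebraMap F R c * x)) = g) :
    ∃ h : Polynomial R, g = h.comp (artin F x) := by
  induction hn : g.natDegree using Nat.strong_induction_on generalizing g with
  | _ n ih =>
  have hval (c : F) : g.eval (algebraMap F R c * x) = g.eval 0 := by
    conv_rhs => rw [← hg c]
    simp
  have hinj : Function.Injective fun c : F => algebraMap F R c * x := fun a b hab =>
    FaithfulSMul.algebraMap_injective F R (mul_right_cancel₀ hx hab)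
  have hmon := artin_monic (R := R) F x
  have hdvd : artin F x ∣ g - Polynomial.C (g.eval 0) := by
    rw [← Polynomial.modByMonic_eq_zero_iff_dvd hmon]
    -- The remainder vanishes at q distinct points and has degree less than q.
    set r := (g - Polynomial.C (g.eval 0)) %ₘ artin F x with hr
    refine Polynomial.eq_zero_of_natDegree_lt_card_of_eval_eq_zero r hinj (fun c => ?_) ?_
    · rw [hr, Polynomial.modByMonic_eq_sub_mul_div]
      simp [artin_eval_smul, hval]
    · rw [← natDegree_artin (R := R) F x]
      refine Polynomial.natDegree_modByMonic_lt _ hmon fun h1 => ?_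
      have := natDegree_artin (R := R) F x
      rw [h1, Polynomial.natDegree_one] at this
      exact Fintype.card_ne_zero this.symm
  obtain ⟨u, hu⟩ := hdvd
  by_cases h0 : u = 0
  · refine ⟨Polynomial.C (g.eval 0), ?_⟩
    rw [h0, mul_zero, sub_eq_zero] at hu
    simpa using hu
  have hdeg : u.natDegree < n := by
    have h1 : (g - Polynomial.C (g.eval 0)).natDegree = n := by
      rw [Polynomial.natDegree_sub_C, hn]
    rw [hu, hmon.natDegree_mul' h0, natDegree_artin] at h1
    have := Fintype.card_pos (α := F)
    omega
  have hinv (c : F) : u.comp (Polynomial.X + Polynomial.C (algebraMap F R c * x)) = u := by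
    have h1 := congrArg
      (fun p => p.comp (Polynomial.X + Polynomial.C (algebraMap F R c * x))) hu
    simp only [Polynomial.sub_comp, Polynomial.mul_comp, hg, artin_comp, Polynomial.C_comp] at h1
    exact mul_left_cancel₀ hmon.ne_zero (h1.symm.trans hu)
  obtain ⟨h, hh⟩ := ih _ hdeg u hinv rfl
  refine ⟨Polynomial.C (g.eval 0) + Polynomial.X * h, ?_⟩
  simp only [Polynomial.add_comp, Polynomial.C_comp, Polynomial.mul_comp, Polynomial.X_comp, ← hh]
  rw [← hu]
  ring

end FiniteFieldAlgebra

/-! ### Singling out one variable -/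

section ToPoly

variable {F σ : Type*} [Field F]

/-- The polynomials in the variables other than the `i`-th one. -/
abbrev freeOf (F : Type*) [Field F] (i : σ) : Subalgebra F (MvPolynomial σ F) :=
  supported F {j | j ≠ i}

theorem X_mem_freeOf {i j : σ} (h : j ≠ i) : (X j : MvPolynomial σ F) ∈ freeOf F i :=
  X_mem_supported.2 h

variable [DecidableEq σ]

/-- A polynomial, as a univariate polynomial in the `i`-th variable. -/
def toPoly (i : σ) : MvPolynomial σ F →ₐ[F] Polynomial (MvPolynomial σ F) :=
  aeval fun j => if j = i then Polynomial.X else Polynomial.C (X j)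

@[simp] theorem toPoly_X_self (i : σ) : toPoly i (X i : MvPolynomial σ F) = Polynomial.X := by
  simp [toPoly]

theorem toPoly_X_ne {i j : σ} (h : j ≠ i) :
    toPoly i (X j : MvPolynomial σ F) = Polynomial.C (X j) := by
  simp [toPoly, h]

theorem eval_toPoly (i : σ) (f : MvPolynomial σ F) : (toPoly i f).eval (X i) = f := by
  have : ((Polynomial.aeval (X i : MvPolynomial σ F)).restrictScalars F).comp (toPoly i)
      = AlgHom.id F (MvPolynomial σ F) := by
    ext j : 1
    by_cases h : j = i
    · subst h; simp
    · simp [toPoly_X_ne h]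
  simpa [Polynomial.coe_aeval_eq_eval] using DFunLike.congr_fun this f

theorem toPoly_injective (i : σ) :
    Function.Injective (toPoly i : MvPolynomial σ F → Polynomial (MvPolynomial σ F)) :=
  fun f g h => by rw [← eval_toPoly i f, h, eval_toPoly]

theorem toPoly_of_mem {i : σ} {f : MvPolynomial σ F} (hf : f ∈ freeOf F i) :
    toPoly i f = Polynomial.C f := by
  rw [freeOf, supported_eq_adjoin_X] at hf
  induction hf using Algebra.adjoin_induction with
  | mem f hf =>
    obtain ⟨j, hj, rfl⟩ := hf
    exact toPoly_X_ne hj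
  | algebraMap r => rw [AlgHom.commutes]; rfl
  | add f g _ _ hf hg => simp [hf, hg]
  | mul f g _ _ hf hg => simp [hf, hg]

theorem coeff_toPoly_mem (i : σ) (f : MvPolynomial σ F) (n : ℕ) :
    (toPoly i f).coeff n ∈ freeOf F i := by
  induction f using MvPolynomial.induction_on generalizing n with
  | C a =>
    rw [← algebraMap_eq, AlgHom.commutes, Polynomial.algebraMap_apply, Polynomial.coeff_C]
    split_ifs
    · exact Subalgebra.algebraMap_mem _ _
    · exact zero_mem _
  | add f g hf hg => rw [map_add, Polynomial.coeff_add]; exact add_mem (hf n) (hg n)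
  | mul_X f j hf =>
    rw [map_mul]
    by_cases h : j = i
    · subst h
      rw [toPoly_X_self]
      cases n with
      | zero => simp
      | succ n => rw [Polynomial.coeff_mul_X]; exact hf n
    · rw [toPoly_X_ne h, Polynomial.coeff_mul_C]
      exact mul_mem (hf n) (X_mem_freeOf h)

/-- The action on the coefficients and the action on `X i` do not interfere, because φ keeps the
coefficients free of `X i`. -/
theorem toPoly_map (i : σ) (φ : MvPolynomial σ F →ₐ[F] MvPolynomial σ F)
    (hφ : ∀ j ≠ i, φ (X j) ∈ freeOf F i) (f : MvPolynomial σ F) :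
    toPoly i (φ f) = ((toPoly i f).map (φ : MvPolynomial σ F →+* MvPolynomial σ F)).comp
      (toPoly i (φ (X i))) := by
  induction f using MvPolynomial.induction_on with
  | C a =>
    rw [← algebraMap_eq, AlgHom.commutes, AlgHom.commutes, Polynomial.algebraMap_apply]
    simp
  | add f g hf hg => simp only [map_add, hf, hg, Polynomial.map_add, Polynomial.add_comp]
  | mul_X f j hf =>
    rw [map_mul, map_mul, hf, map_mul, Polynomial.map_mul, Polynomial.mul_comp]
    by_cases h : j = i
    · subst h; simp
    · rw [toPoly_of_mem (hφ j h), toPoly_X_ne h]; simp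

end ToPoly

/-! ### Setting a variable to zero -/

section Specialize

variable {F σ : Type*} [Field F]

theorem map_eq_self_of_mem {i : σ} {φ : MvPolynomial σ F →ₐ[F] MvPolynomial σ F}
    (hφ : ∀ j ≠ i, φ (X j) = X j) {f : MvPolynomial σ F} (hf : f ∈ freeOf F i) : φ f = f := by
  rw [freeOf, supported_eq_adjoin_X] at hf
  induction hf using Algebra.adjoin_induction with
  | mem f hf =>
    obtain ⟨j, hj, rfl⟩ := hf
    exact hφ j hj
  | algebraMap r => exact AlgHom.commutes _ _
  | add f g _ _ hf hg => simp [hf, hg]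
  | mul f g _ _ hf hg => simp [hf, hg]

variable [DecidableEq σ]

theorem toPoly_map_eq_self {i : σ} {φ : MvPolynomial σ F →ₐ[F] MvPolynomial σ F}
    (hφ : ∀ j ≠ i, φ (X j) = X j) (f : MvPolynomial σ F) :
    (toPoly i f).map (φ : MvPolynomial σ F →+* MvPolynomial σ F) = toPoly i f := by
  ext1 n
  rw [Polynomial.coeff_map]
  exact map_eq_self_of_mem hφ (coeff_toPoly_mem i f n)

/-- The specialization of the `i`-th variable to zero. -/
def kill (i : σ) : MvPolynomial σ F →ₐ[F] MvPolynomial σ F :=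
  aeval fun j => if j = i then 0 else X j

@[simp] theorem kill_X_self (i : σ) : kill i (X i : MvPolynomial σ F) = 0 := by simp [kill]

theorem kill_X_ne {i j : σ} (h : j ≠ i) : kill i (X j : MvPolynomial σ F) = X j := by
  simp [kill, h]

theorem kill_mem (i : σ) (f : MvPolynomial σ F) : kill i f ∈ freeOf F i := by
  induction f using MvPolynomial.induction_on with
  | C a => rw [← algebraMap_eq, AlgHom.commutes]; exact Subalgebra.algebraMap_mem _ _
  | add f g hf hg => rw [map_add]; exact add_mem hf hg
  | mul_X f j hf =>
    rw [map_mul]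
    by_cases h : j = i
    · subst h; simp
    · rw [kill_X_ne h]; exact mul_mem hf (X_mem_freeOf h)

theorem kill_of_mem {i : σ} {f : MvPolynomial σ F} (hf : f ∈ freeOf F i) : kill i f = f :=
  map_eq_self_of_mem (fun _ h => kill_X_ne h) hf

theorem kill_eq_coeff_zero (i : σ) (f : MvPolynomial σ F) : kill i f = (toPoly i f).coeff 0 := by
  have h := eval_toPoly i (kill i f)
  have h2 := toPoly_map i (kill i) (fun j h => by rw [kill_X_ne h]; exact X_mem_freeOf h) f
  rw [toPoly_map_eq_self (fun _ h => kill_X_ne h), kill_X_self, map_zero,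
    Polynomial.comp_zero] at h2
  rw [h2, Polynomial.eval_C] at h
  rw [← h, Polynomial.coeff_zero_eq_eval_zero]

theorem X_dvd_of_kill_eq_zero {i : σ} {f : MvPolynomial σ F} (h : kill i f = 0) : X i ∣ f := by
  rw [kill_eq_coeff_zero, ← Polynomial.X_dvd_iff] at h
  obtain ⟨u, hu⟩ := h
  refine ⟨u.eval (X i), ?_⟩
  rw [← eval_toPoly i f, hu]
  simp

end Specialize

/-! ### Invariants of independent translations in several variables -/

section Translation

variable {F σ : Type*} [Field F] [DecidableEq σ] (a : σ)

/-- The substitution of `X_i + c X_a` for `X_i`. -/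
def translate (i : σ) (c : F) : MvPolynomial σ F →ₐ[F] MvPolynomial σ F :=
  aeval fun j => if j = i then X i + C c * X a else X j

variable {a}

theorem translate_X_self (i : σ) (c : F) :
    translate a i c (X i : MvPolynomial σ F) = X i + C c * X a := by
  simp [translate]

theorem translate_X_ne {i j : σ} (h : j ≠ i) (c : F) :
    translate a i c (X j : MvPolynomial σ F) = X j := by
  simp [translate, h]

variable [Fintype F] (a)

/-- The substitution of `X_j^q - X_j X_a^(q-1)` for `X_j` for all `j ∈ s`. -/
def artinMap (s : Finset σ) : MvPolynomial σ F →ₐ[F] MvPolynomial σ F :=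
  aeval fun j => if j ∈ s then X j ^ Fintype.card F - X j * X a ^ (Fintype.card F - 1) else X j

variable {a}

theorem artinMap_X_mem {s : Finset σ} {j : σ} (h : j ∈ s) :
    artinMap a s (X j : MvPolynomial σ F)
      = X j ^ Fintype.card F - X j * X a ^ (Fintype.card F - 1) := by
  simp [artinMap, h]

theorem artinMap_X_notMem {s : Finset σ} {j : σ} (h : j ∉ s) :
    artinMap a s (X j : MvPolynomial σ F) = X j := by
  simp [artinMap, h]

theorem translate_bigX {i : σ} (hi : i ≠ a) (c : F) :
    translate a i c (X i ^ Fintype.card F - X i * X a ^ (Fintype.card F - 1) : MvPolynomial σ F)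
      = X i ^ Fintype.card F - X i * X a ^ (Fintype.card F - 1) := by
  have h1 := pow_card_pred_mul F (X a : MvPolynomial σ F)
  have h2 := algebraMap_pow_card (R := MvPolynomial σ F) c
  rw [algebraMap_eq] at h2
  rw [map_sub, map_mul, map_pow, map_pow, translate_X_self, translate_X_ne hi.symm,
    add_pow_card, mul_pow, h2, ← h1]
  ring

theorem artinMap_insert {s : Finset σ} {i : σ} (hi : i ∉ s) (ha : a ∉ s)
    (f : MvPolynomial σ F) : artinMap a (insert i s) f = artinMap a s (artinMap a {i} f) := by
  have : (artinMap a (insert i s) : MvPolynomial σ F →ₐ[F] _)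
      = (artinMap a s).comp (artinMap a {i}) := by
    ext j : 1
    rw [AlgHom.comp_apply]
    by_cases h : j = i
    · subst h
      rw [artinMap_X_mem (by simp), artinMap_X_mem (by simp)]
      simp [artinMap_X_notMem hi, artinMap_X_notMem ha]
    · rw [artinMap_X_notMem (s := {i}) (by simpa using h)]
      by_cases hj : j ∈ s
      · rw [artinMap_X_mem hj, artinMap_X_mem (by simp [hj])]
      · rw [artinMap_X_notMem hj, artinMap_X_notMem (by simp [hj, h])]
  rw [this, AlgHom.comp_apply]

theorem translate_artinMap {s : Finset σ} {i : σ} (hi : i ∉ s) (ha : a ∉ s) (c : F)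
    (f : MvPolynomial σ F) (hia : i ≠ a) :
    translate a i c (artinMap a s f) = artinMap a s (translate a i c f) := by
  suffices (translate a i c).comp (artinMap a s)
      = ((artinMap a s).comp (translate a i c) : MvPolynomial σ F →ₐ[F] _) from
    DFunLike.congr_fun this f
  ext j : 1
  rw [AlgHom.comp_apply, AlgHom.comp_apply]
  by_cases h : j = i
  · subst h
    rw [artinMap_X_notMem hi, translate_X_self, map_add, map_mul, artinMap_X_notMem hi,
      artinMap_X_notMem ha, ← algebraMap_eq, AlgHom.commutes]
  · rw [translate_X_ne h]
    by_cases hj : j ∈ s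
    · rw [artinMap_X_mem hj]
      simp [translate_X_ne h, translate_X_ne hia.symm]
    · rw [artinMap_X_notMem hj, translate_X_ne h]

theorem toPoly_artinMap_singleton {i : σ} (hia : i ≠ a) (f : MvPolynomial σ F) :
    toPoly i (artinMap a {i} f) = (toPoly i f).comp (artin F (X a)) := by
  have hfix : ∀ j ≠ i, artinMap a {i} (X j : MvPolynomial σ F) = X j := fun j hj =>
    artinMap_X_notMem (by simpa using hj)
  rw [toPoly_map i _ (fun j hj => by rw [hfix j hj]; exact X_mem_freeOf hj),
    toPoly_map_eq_self hfix, artinMap_X_mem (by simp)]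
  simp only [map_sub, map_mul, map_pow, toPoly_X_self, toPoly_X_ne hia.symm, artin]
  rw [mul_comm]

theorem artinMap_singleton_injective {i : σ} (hia : i ≠ a) :
    Function.Injective (artinMap a {i} : MvPolynomial σ F → MvPolynomial σ F) := by
  rw [injective_iff_map_eq_zero]
  intro f hf
  have h := toPoly_artinMap_singleton hia f
  rw [hf, map_zero, eq_comm, Polynomial.comp_eq_zero_iff] at h
  rcases h with h | ⟨-, h⟩
  · exact toPoly_injective i (by rw [h, map_zero])
  · have h2 := natDegree_artin F (X a : MvPolynomial σ F)
    rw [h, Polynomial.natDegree_C] at h2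
    exact absurd h2.symm Fintype.card_ne_zero

theorem artinMap_injective {s : Finset σ} (ha : a ∉ s) :
    Function.Injective (artinMap a s : MvPolynomial σ F → MvPolynomial σ F) := by
  induction s using Finset.induction_on with
  | empty =>
    have : (artinMap a ∅ : MvPolynomial σ F →ₐ[F] _) = AlgHom.id F _ := by
      ext j : 1
      simp [artinMap]
    rw [this]
    exact Function.injective_id
  | insert i s hi ih =>
    have ha' : a ∉ s := fun h => ha (by simp [h])
    intro f g hfg
    rw [artinMap_insert hi ha', artinMap_insert hi ha'] at hfg
    exact artinMap_singleton_injective (fun h => ha (by simp [h])) (ih ha' hfg)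

theorem exists_artinMap_singleton {i : σ} (hia : i ≠ a) {f : MvPolynomial σ F}
    (hf : ∀ c : F, translate a i c f = f) : ∃ p, f = artinMap a {i} p := by
  have hg (c : F) : (toPoly i f).comp (Polynomial.X +
      Polynomial.C (algebraMap F (MvPolynomial σ F) c * X a)) = toPoly i f := by
    have hfix : ∀ j ≠ i, translate a i c (X j : MvPolynomial σ F) = X j := fun j hj =>
      translate_X_ne hj c
    have h := toPoly_map i (translate a i c)
      (fun j hj => by rw [hfix j hj]; exact X_mem_freeOf hj) f
    rw [toPoly_map_eq_self hfix, hf, translate_X_self, map_add, map_mul, toPoly_X_self,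
      toPoly_X_ne hia.symm, ← algebraMap_eq, AlgHom.commutes, Polynomial.algebraMap_apply,
      ← Polynomial.C_mul] at h
    exact h.symm
  obtain ⟨h, hh⟩ := exists_comp_artin (X_ne_zero a) _ hg
  -- The coefficients of `h` may still involve `X i`. Setting it to zero there preserves the
  -- identity, since the coefficients of `toPoly i f` and of the Artin polynomial are free of `X i`.
  have hk := congrArg (Polynomial.map
    ((kill i : MvPolynomial σ F →ₐ[F] MvPolynomial σ F) : MvPolynomial σ F →+* MvPolynomial σ F)) hh
  rw [toPoly_map_eq_self (fun j hj => kill_X_ne hj), Polynomial.map_comp] at hk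
  have hart : (artin F (X a : MvPolynomial σ F)).map
      ((kill i : MvPolynomial σ F →ₐ[F] MvPolynomial σ F) :
        MvPolynomial σ F →+* MvPolynomial σ F) = artin F (X a) := by
    simp [artin, kill_X_ne hia.symm]
  rw [hart] at hk
  set h' := h.map
    ((kill i : MvPolynomial σ F →ₐ[F] MvPolynomial σ F) : MvPolynomial σ F →+* MvPolynomial σ F)
    with hh'
  have hfix : ∀ j ≠ i, artinMap a {i} (X j : MvPolynomial σ F) = X j := fun j hj =>
    artinMap_X_notMem (by simpa using hj)
  refine ⟨h'.eval (X i), ?_⟩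
  have h1 : h'.map ((artinMap a {i} : MvPolynomial σ F →ₐ[F] MvPolynomial σ F) :
      MvPolynomial σ F →+* MvPolynomial σ F) = h' := by
    ext1 n
    rw [Polynomial.coeff_map, hh', Polynomial.coeff_map]
    exact map_eq_self_of_mem hfix (kill_mem i _)
  have h2 := Polynomial.hom_eval₂ h' (RingHom.id _)
    ((artinMap a {i} : MvPolynomial σ F →ₐ[F] MvPolynomial σ F) :
      MvPolynomial σ F →+* MvPolynomial σ F) (X i)
  rw [Polynomial.eval₂_id, RingHom.comp_id, ← Polynomial.eval_map, h1] at h2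
  refine Eq.trans ?_ h2.symm
  rw [← eval_toPoly i f, hk, Polynomial.eval_comp]
  congr 1
  simp [artin, artinMap_X_mem, mul_comm]

/-- Induction on `s`: the preimage under `artinMap a s` inherits invariance in a further variable,
because the translation commutes with this injective map. -/
theorem exists_artinMap {s : Finset σ} (ha : a ∉ s) {f : MvPolynomial σ F}
    (hf : ∀ i ∈ s, ∀ c : F, translate a i c f = f) : ∃ p, f = artinMap a s p := by
  induction s using Finset.induction_on with
  | empty => exact ⟨f, by rw [artinMap]; simp⟩
  | insert i s hi ih =>
    have ha' : a ∉ s := fun h => ha (by simp [h])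
    have hia : i ≠ a := fun h => ha (by simp [h])
    obtain ⟨p, hp⟩ := ih ha' fun j hj => hf j (by simp [hj])
    have hpi (c : F) : translate a i c p = p := by
      refine artinMap_injective ha' ?_
      rw [← translate_artinMap hi ha' c p hia, ← hp]
      exact hf i (by simp) c
    obtain ⟨u, rfl⟩ := exists_artinMap_singleton hia hpi
    exact ⟨u, by rw [hp, artinMap_insert hi ha']⟩

end Translation

/-! ### Independence over p-th powers from derivations -/

section FrobeniusIndependence

variable {R : Type*} [CommRing R] (p : ℕ) [CharP R p]

/-- Differentiation multiplies a coefficient by its exponent, so p divides every exponent that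
occurs. -/
theorem exists_expand_of_pderiv_eq_zero [IsDomain R] {σ : Type*} {H : MvPolynomial σ R}
    (hH : ∀ i, pderiv i H = 0) : ∃ H', H = expand p H' := by
  refine ⟨∑ s ∈ H.support, monomial (s.mapRange (· / p) (Nat.zero_div p)) (coeff s H), ?_⟩
  conv_lhs => rw [← support_sum_monomial_coeff H]
  rw [map_sum]
  refine Finset.sum_congr rfl fun s hs => ?_
  suffices h : p • s.mapRange (· / p) (Nat.zero_div p) = s by
    rw [expand_monomial, h]
  ext i
  rw [Finsupp.smul_apply, Finsupp.mapRange_apply, smul_eq_mul]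
  refine Nat.mul_div_cancel' ?_
  by_cases h0 : s i = 0
  · simp [h0]
  have h1 := coeff_pderiv (i := i) H (s - Finsupp.single i 1)
  have h2 : s - Finsupp.single i 1 + Finsupp.single i 1 = s := by
    ext j
    by_cases hj : i = j
    · subst hj
      simp
      omega
    · simp [hj]
  rw [hH, coeff_zero, h2] at h1
  have h3 : (((s - Finsupp.single i 1 : σ →₀ ℕ) i : ℕ) : R) + 1 = (s i : R) := by
    rw [← Nat.cast_succ]
    congr 1
    simp
    omega
  rw [h3] at h1
  rcases mul_eq_zero.1 h1.symm with h | h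
  · exact absurd h (mem_support_iff.1 hs)
  · exact (CharP.cast_eq_zero_iff R p _).1 h

variable [hp : Fact p.Prime]

/-- The coefficients enter as p^r-th powers with r > 0, which every derivation kills. -/
theorem derivation_eval₂_iterateFrobenius {d : ℕ} {ξ : Fin d → R}
    {D : Derivation ℤ R R} {Δ : R} {i : Fin d} (hD : ∀ j, D (ξ j) = if i = j then Δ else 0)
    {r : ℕ} (hr : r ≠ 0) (H : MvPolynomial (Fin d) R) :
    D (eval₂ (iterateFrobenius R p r) ξ H)
      = Δ * eval₂ (iterateFrobenius R p r) ξ (pderiv i H) := by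
  induction H using MvPolynomial.induction_on with
  | C a =>
    rw [eval₂_C, pderiv_C, eval₂_zero, mul_zero, iterateFrobenius_def, Derivation.leibniz_pow]
    have : ((p ^ r : ℕ) : R) = 0 := by simp [hr]
    rw [← Nat.cast_smul_eq_nsmul R, this, zero_smul]
  | add f g hf hg => rw [eval₂_add, map_add, hf, hg, map_add, eval₂_add, mul_add]
  | mul_X f j hf =>
    rw [eval₂_mul, eval₂_X, Derivation.leibniz, hf, hD, pderiv_mul, eval₂_add, eval₂_mul,
      eval₂_mul, eval₂_X, pderiv_X]
    by_cases h : i = j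
    · subst h
      simp only [if_true, smul_eq_mul, Pi.single_eq_same, eval₂_one]
      ring
    · rw [if_neg h, Pi.single_eq_of_ne (fun h' => h h'.symm), eval₂_zero]
      simp only [smul_eq_mul]
      ring

variable [IsDomain R]

/-- The derivations turn the relation into one for each partial derivative of `H`, and these vanish
by induction on the total degree. Hence `H` is a polynomial in p-th powers of the variables, and
taking a p-th root of the relation lowers both r and the degree. -/
theorem eq_zero_of_eval₂_iterateFrobenius_eq_zero {d : ℕ} {ξ : Fin d → R}
    {D : Fin d → Derivation ℤ R R} {Δ : R} (hΔ : Δ ≠ 0)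
    (hD : ∀ i j, D i (ξ j) = if i = j then Δ else 0) (r : ℕ) (H : MvPolynomial (Fin d) R)
    (hdeg : ∀ i, degreeOf i H < p ^ r) (h0 : eval₂ (iterateFrobenius R p r) ξ H = 0) :
    H = 0 := by
  induction hn : H.totalDegree using Nat.strong_induction_on generalizing H r with
  | _ n ih =>
  by_cases hn0 : n = 0
  · rw [hn0, totalDegree_eq_zero_iff_eq_C] at hn
    rw [hn, eval₂_C, iterateFrobenius_def] at h0
    rw [hn, eq_zero_of_pow_eq_zero h0, C_0]
  -- For r = 0 the degree bound would make `H` constant.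
  have hr : r ≠ 0 := by
    rintro rfl
    refine hn0 (hn.symm.trans ((MvPolynomial.totalDegree_eq_zero_iff _ H).2 fun s hs i => ?_))
    have := (degreeOf_lt_iff (by simp)).1 (hdeg i) s hs
    simpa using this
  have hpd (i : Fin d) : pderiv i H = 0 := by
    have hsup : ∀ s ∈ (pderiv i H).support, s + Finsupp.single i 1 ∈ H.support := by
      intro s hs
      rw [mem_support_iff, coeff_pderiv] at hs
      exact mem_support_iff.2 (left_ne_zero_of_mul hs)
    refine ih _ ?_ r (pderiv i H) (fun j => ?_) ?_ rfl
    · rw [totalDegree, Finset.sup_lt_iff (Nat.pos_of_ne_zero hn0)]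
      intro s hs
      have h1 := le_totalDegree (hsup s hs)
      rw [Finsupp.sum_add_index' (by simp) (by simp), Finsupp.sum_single_index rfl, hn] at h1
      exact h1
    · rw [degreeOf_lt_iff (pow_pos hp.out.pos r)]
      intro s hs
      have h1 := (degreeOf_lt_iff (pow_pos hp.out.pos r)).1 (hdeg j) _ (hsup s hs)
      exact (Nat.le_add_right _ _).trans_lt (by simpa using h1)
    · have h1 := derivation_eval₂_iterateFrobenius p (hD i) hr H
      rw [h0, map_zero] at h1
      exact (mul_eq_zero.1 h1.symm).resolve_left hΔ
  obtain ⟨H', rfl⟩ := exists_expand_of_pderiv_eq_zero p hpd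
  have hp0 := hp.out.pos
  rw [totalDegree_expand] at hn
  have hlt : H'.totalDegree < n := by
    rw [← hn]
    refine lt_mul_of_one_lt_right (Nat.pos_of_ne_zero ?_) hp.out.one_lt
    rintro h
    rw [h, zero_mul] at hn
    exact hn0 hn.symm
  obtain ⟨t, rfl⟩ := Nat.exists_eq_succ_of_ne_zero hr
  have h1 : eval₂ (iterateFrobenius R p (t + 1)) ξ (expand p H')
      = (eval₂ (iterateFrobenius R p t) ξ H') ^ p := by
    have h2 : iterateFrobenius R p (t + 1) = (frobenius R p).comp (iterateFrobenius R p t) := by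
      rw [add_comm, iterateFrobenius_add, iterateFrobenius_one]
    have h3 := (eval₂_comp_left (frobenius R p) (iterateFrobenius R p t) ξ H').symm
    rw [frobenius_def] at h3
    rw [eval₂_expand, h2, ← h3]
    rfl
  rw [Nat.succ_eq_add_one, h1] at h0
  rw [ih _ hlt t H' (fun i => ?_) (eq_zero_of_pow_eq_zero h0) rfl, map_zero]
  rw [degreeOf_lt_iff (pow_pos hp0 t)]
  intro s hs
  have h4 := (degreeOf_lt_iff (pow_pos hp0 _)).1 (hdeg i) (p • s)
    (by rw [mem_support_iff, coeff_expand_smul p hp0.ne']; exact mem_support_iff.1 hs)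
  rw [Finsupp.smul_apply, smul_eq_mul, pow_succ'] at h4
  exact lt_of_mul_lt_mul_left h4 hp0.le

end FrobeniusIndependence

/-! ### The Moore determinant and the Jacobian criterion -/

section Moore

variable {F R : Type*} [Field F] [Fintype F] [CommRing R] [IsDomain R] [Algebra F R]

/-- A vanishing combination of the rows is a polynomial ∑ vⱼ T^(q^j) that is F-linear as a function
and vanishes at every `z k`, hence on their F-span. That is q^d roots for a degree below q^d. -/
theorem moore_det_ne_zero {d : ℕ} {z : Fin d → R} (hz : LinearIndependent F z) :
    (Matrix.of fun j k : Fin d => z k ^ Fintype.card F ^ (j : ℕ)).det ≠ 0 := by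
  intro h0
  obtain ⟨v, hv, hv0⟩ := Matrix.exists_vecMul_eq_zero_iff.2 h0
  have hq : 1 < Fintype.card F := Fintype.one_lt_card
  set f : Polynomial R := ∑ j : Fin d, Polynomial.C (v j) *
    Polynomial.X ^ Fintype.card F ^ (j : ℕ) with hf
  have hzk (k : Fin d) : ∑ j : Fin d, v j * z k ^ Fintype.card F ^ (j : ℕ) = 0 := by
    have := congrFun hv0 k
    simpa [Matrix.vecMul, dotProduct] using this
  have hadd (j : ℕ) (c : Fin d → F) : (∑ k, c k • z k) ^ Fintype.card F ^ j
      = ∑ k, c k • z k ^ Fintype.card F ^ j := by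
    induction j with
    | zero => simp
    | succ j ih =>
      rw [pow_succ, pow_mul, ih]
      have := map_sum (FiniteField.frobeniusAlgHom F R)
        (fun k => c k • z k ^ Fintype.card F ^ j) Finset.univ
      simp only [map_smul] at this
      refine this.trans (Finset.sum_congr rfl fun k _ => ?_)
      rw [FiniteField.frobeniusAlgHom_apply, ← pow_mul]
  have hf0 : f = 0 := by
    refine Polynomial.eq_zero_of_natDegree_lt_card_of_eval_eq_zero f
      (f := fun c : Fin d → F => ∑ k, c k • z k) (fun c c' hcc => ?_) (fun c => ?_) ?_
    · have h1 := Fintype.linearIndependent_iff.1 hz (fun k => c k - c' k)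
        (by simpa [sub_smul, sub_eq_zero] using hcc)
      exact funext fun k => sub_eq_zero.1 (h1 k)
    · rw [hf, Polynomial.eval_finsetSum]
      simp only [Polynomial.eval_mul, Polynomial.eval_C, Polynomial.eval_pow, Polynomial.eval_X,
        hadd, Finset.mul_sum, mul_smul_comm]
      rw [Finset.sum_comm]
      simp only [← Finset.smul_sum, hzk, smul_zero, Finset.sum_const_zero]
    · rw [Fintype.card_fun, Fintype.card_fin, Nat.lt_iff_le_pred (by positivity), hf]
      refine Polynomial.natDegree_sum_le_of_forall_le _ _ fun j _ => ?_
      refine (Polynomial.natDegree_C_mul_X_pow_le _ _).trans (Nat.le_pred_of_lt ?_)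
      exact Nat.pow_lt_pow_right hq j.2
  refine hv (funext fun j => ?_)
  have h1 := congrArg (fun g : Polynomial R => g.coeff (Fintype.card F ^ (j : ℕ))) hf0
  simp only [hf, Polynomial.finsetSum_coeff, Polynomial.coeff_C_mul_X_pow,
    Polynomial.coeff_zero] at h1
  rw [Finset.sum_eq_single j] at h1
  · simpa using h1
  · intro k _ hk
    rw [if_neg]
    intro h
    exact hk (Fin.ext (Nat.pow_right_injective hq h.symm))
  · simp

/-- Elements with nonvanishing Jacobian determinant are `q`-independent over the `q`-th powers. -/
theorem eq_zero_of_sum_pow_card_mul_prod {d : ℕ} {ξ : Fin d → R} {D : Fin d → Derivation F R R}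
    (hdet : (Matrix.of fun j k : Fin d => D k (ξ j)).det ≠ 0)
    (b : (Fin d → Fin (Fintype.card F)) → R)
    (hb : ∑ e, b e ^ Fintype.card F * ∏ j, ξ j ^ (e j : ℕ) = 0) : b = 0 := by
  obtain ⟨p, hchar⟩ := CharP.exists F
  obtain ⟨r, hp, hcard⟩ := FiniteField.card F p
  have : Fact p.Prime := ⟨hp⟩
  have : CharP R p := charP_of_injective_algebraMap (FaithfulSMul.algebraMap_injective F R) p
  set J : Matrix (Fin d) (Fin d) R := Matrix.of fun j k : Fin d => D k (ξ j) with hJ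
  -- The adjugate combines the `D k` into derivations dual to the `ξ j` up to the factor det J.
  let D' (i : Fin d) : Derivation ℤ R R :=
    (∑ k, J.adjugate k i • D k).restrictScalars ℤ
  have hD' (i j : Fin d) : D' i (ξ j) = if i = j then J.det else 0 := by
    have h1 := congrFun (congrFun (Matrix.mul_adjugate J) j) i
    rw [Matrix.mul_apply, Matrix.smul_apply, Matrix.one_apply] at h1
    have h2 : D' i (ξ j) = ∑ k, J.adjugate k i * D k (ξ j) := by
      change (∑ k, J.adjugate k i • D k) (ξ j) = _
      rw [← Derivation.coeFnAddMonoidHom_apply, map_sum, Finset.sum_apply]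
      rfl
    rw [h2]
    simp only [mul_comm (J.adjugate _ _)]
    refine h1.trans ?_
    simp [eq_comm]
  let mon (e : Fin d → Fin (Fintype.card F)) : Fin d →₀ ℕ :=
    Finsupp.equivFunOnFinite.symm fun j => (e j : ℕ)
  have hmon : Function.Injective mon := fun e e' h => by
    funext j
    exact Fin.ext (DFunLike.congr_fun h j)
  set H : MvPolynomial (Fin d) R := ∑ e, monomial (mon e) (b e) with hH
  have hcoeff (e) : coeff (mon e) H = b e := by
    rw [hH, coeff_sum, Finset.sum_eq_single e]
    · simp
    · intro e' _ he
      rw [coeff_monomial, if_neg fun h => he (hmon h)]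
    · simp
  have hH0 : H = 0 := by
    refine eq_zero_of_eval₂_iterateFrobenius_eq_zero p hdet hD' r H (fun i => ?_) ?_
    · rw [degreeOf_lt_iff (pow_pos hp.pos _)]
      intro s hs
      obtain ⟨e, -, he⟩ := Finset.mem_biUnion.1 (support_sum hs)
      have := support_monomial_subset he
      rw [Finset.mem_singleton] at this
      rw [this, ← hcard]
      exact (e i).2
    · rw [hH, eval₂_sum]
      refine Eq.trans (Finset.sum_congr rfl fun e _ => ?_) hb
      rw [eval₂_monomial, iterateFrobenius_def, ← hcard, Finsupp.prod_fintype _ _ (by simp)]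
      rfl
  funext e
  rw [← hcoeff, hH0, coeff_zero]
  rfl

end Moore

/-! ### Index bookkeeping for hyperbolic pairs -/

section Indices

variable {m : ℕ}

@[simp] theorem yIdx_val (i : Fin m) : ((yIdx i : Fin (2 * m)) : ℕ) = i := rfl

@[simp] theorem xIdx_val (i : Fin m) : ((xIdx i : Fin (2 * m)) : ℕ) = 2 * m - 1 - i := by
  simp only [xIdx, Fin.val_rev, yIdx_val]
  omega

@[simp] theorem rev_yIdx (i : Fin m) : (yIdx i).rev = xIdx i := rfl

@[simp] theorem rev_xIdx (i : Fin m) : (xIdx i).rev = yIdx i := Fin.rev_rev _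

theorem yIdx_ne_xIdx (i j : Fin m) : yIdx i ≠ xIdx j := fun h => by
  have := congrArg Fin.val h
  simp only [yIdx_val, xIdx_val] at this
  omega

theorem yIdx_injective : Function.Injective (yIdx : Fin m → Fin (2 * m)) := fun i j h =>
  Fin.ext (by simpa using congrArg Fin.val h)

theorem xIdx_injective : Function.Injective (xIdx : Fin m → Fin (2 * m)) := fun _ _ h =>
  yIdx_injective (Fin.rev_injective h)

theorem rev_ne_self (i : Fin (2 * m)) : i.rev ≠ i := fun h => by
  have := congrArg Fin.val h
  simp only [Fin.val_rev] at this
  omega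

theorem index_cases (i : Fin (2 * m)) : (∃ j, i = yIdx j) ∨ ∃ j, i = xIdx j := by
  by_cases h : (i : ℕ) < m
  · exact .inl ⟨⟨i, h⟩, rfl⟩
  · refine .inr ⟨⟨2 * m - 1 - i, by omega⟩, Fin.ext ?_⟩
    simp only [xIdx_val]
    omega

theorem sum_index {M : Type*} [AddCommMonoid M] (f : Fin (2 * m) → M) :
    ∑ i, f i = ∑ i : Fin m, (f (yIdx i) + f (xIdx i)) := by
  have hb : Function.Bijective (Sum.elim yIdx xIdx : Fin m ⊕ Fin m → Fin (2 * m)) := by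
    refine ⟨fun a b h => ?_, fun i => ?_⟩
    · rcases a with a | a <;> rcases b with b | b
      · exact congrArg _ (yIdx_injective h)
      · exact absurd h (yIdx_ne_xIdx a b)
      · exact absurd h.symm (yIdx_ne_xIdx b a)
      · exact congrArg _ (xIdx_injective h)
    · rcases index_cases i with ⟨j, rfl⟩ | ⟨j, rfl⟩
      · exact ⟨.inl j, rfl⟩
      · exact ⟨.inr j, rfl⟩
  rw [← (Equiv.ofBijective _ hb).sum_comp f, Fintype.sum_sum_type, Finset.sum_add_distrib]
  rfl

end Indices

/-! ### The hyperbolic form and the orthogonal group -/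

section Quadratic

variable {R : Type*} [CommRing R] {m : ℕ}

/-- The hyperbolic quadratic form `∑ yᵢ xᵢ`. -/
def hypForm (v : Fin (2 * m) → R) : R := ∑ i : Fin m, v (yIdx i) * v (xIdx i)

theorem hypForm_add (v w : Fin (2 * m) → R) :
    hypForm (v + w) = hypForm v + hypForm w + ∑ i, v i * w i.rev := by
  rw [sum_index, hypForm, hypForm, hypForm, ← Finset.sum_add_distrib, ← Finset.sum_add_distrib]
  refine Finset.sum_congr rfl fun i _ => ?_
  simp only [Pi.add_apply, rev_yIdx, rev_xIdx]
  ring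

theorem sum_mul_rev_self (v : Fin (2 * m) → R) : ∑ i, v i * v i.rev = 2 * hypForm v := by
  rw [sum_index, hypForm, Finset.mul_sum]
  refine Finset.sum_congr rfl fun i _ => ?_
  simp only [rev_yIdx, rev_xIdx]
  ring

end Quadratic

section Orthogonal

variable {F : Type*} [Field F] {m : ℕ}

theorem act_X (g : Matrix (Fin (2 * m)) (Fin (2 * m)) F) (i : Fin (2 * m)) :
    act g (X i) = ∑ j, C (g i j) * X j := by
  simp [act]

theorem eval_act (g : Matrix (Fin (2 * m)) (Fin (2 * m)) F) (v : Fin (2 * m) → F) (f : S F m) :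
    eval v (act g f) = eval (g.mulVec v) f := by
  induction f using MvPolynomial.induction_on with
  | C a => rw [← algebraMap_eq, AlgHom.commutes]; simp
  | add f g hf hg => simp [hf, hg]
  | mul_X f j hf =>
    rw [map_mul, map_mul, map_mul, hf, act_X]
    simp [Matrix.mulVec, dotProduct]

variable [Fintype F]

theorem xi_zero : xi F m 0 = hypForm X := by
  rw [xi, if_pos rfl]
  rfl

theorem eval_xi_zero (v : Fin (2 * m) → F) : eval v (xi F m 0) = hypForm v := by
  rw [xi_zero, hypForm, hypForm]
  simp

/-- In this shape ξⱼ is the polar form of ξ₀ paired between the vector of q^j-th powers and the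
vector of variables. At j = 0 the same sum is 2ξ₀. -/
theorem xi_of_ne_zero {j : ℕ} (hj : j ≠ 0) :
    xi F m j = ∑ i, X i ^ Fintype.card F ^ j * X i.rev := by
  rw [xi, if_neg hj, sum_index]
  refine Finset.sum_congr rfl fun i _ => ?_
  simp only [rev_yIdx, rev_xIdx, y, x]
  ring

variable {g : Matrix (Fin (2 * m)) (Fin (2 * m)) F}

/-- Polarization: the preserved form is evaluated at the sum of two standard basis vectors. No
division by 2 is involved. -/
theorem sum_col_mul_col (hg : act g (xi F m 0) = xi F m 0) (a b : Fin (2 * m)) :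
    ∑ i, g i a * g i.rev b = if b = a.rev then 1 else 0 := by
  have hq (v : Fin (2 * m) → F) : hypForm (g.mulVec v) = hypForm v := by
    rw [← eval_xi_zero, ← eval_act, hg, eval_xi_zero]
  have h := hq (Pi.single a 1 + Pi.single b 1)
  rw [Matrix.mulVec_add, hypForm_add, hypForm_add, hq, hq] at h
  have h2 := add_left_cancel h
  simp only [Matrix.mulVec_single_one, Matrix.col_apply] at h2
  rw [h2, Finset.sum_eq_single a]
  · simp [Pi.single_apply, eq_comm]
  · intro i _ hi
    simp [Pi.single_eq_of_ne hi]
  · simp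

/-- By the column relations, the reflection of `g` in the antidiagonal is a left inverse of `g`,
hence also a right inverse. -/
theorem sum_row_mul_row (hg : act g (xi F m 0) = xi F m 0) (a b : Fin (2 * m)) :
    ∑ k, g a k * g b.rev k.rev = if a = b then 1 else 0 := by
  set B : Matrix (Fin (2 * m)) (Fin (2 * m)) F := Matrix.of fun a b => g b.rev a.rev with hB
  have h1 : B * g = 1 := by
    ext a b
    rw [Matrix.mul_apply, Matrix.one_apply]
    have h2 := sum_col_mul_col hg b a.rev
    simp only [Fin.rev_inj] at h2
    rw [← h2]
    exact Finset.sum_congr rfl fun i _ => mul_comm _ _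
  have h2 : g * B = 1 := mul_eq_one_comm.1 h1
  have h3 := congrFun (congrFun h2 a) b
  rwa [Matrix.mul_apply, Matrix.one_apply] at h3

/-- For j > 0, `g` has entries in F, so it acts on q^j-th powers as it acts on the variables, and it
preserves the polar form. -/
theorem act_xi (hg : act g (xi F m 0) = xi F m 0) (j : ℕ) : act g (xi F m j) = xi F m j := by
  by_cases hj : j = 0
  · rw [hj, hg]
  have hpow (i : Fin (2 * m)) : act g (X i ^ Fintype.card F ^ j)
      = ∑ k, C (g i k) * X k ^ Fintype.card F ^ j := by
    rw [map_pow, act_X]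
    generalize j = t
    induction t with
    | zero => simp
    | succ t ih =>
      rw [pow_succ, pow_mul, ih]
      refine (map_sum (FiniteField.frobeniusAlgHom F (S F m)) _ _).trans
        (Finset.sum_congr rfl fun k _ => ?_)
      rw [map_mul, ← algebraMap_eq, AlgHom.commutes, FiniteField.frobeniusAlgHom_apply, ← pow_mul]
  rw [xi_of_ne_zero hj, map_sum]
  simp only [map_mul, hpow, act_X, Finset.sum_mul_sum]
  rw [Finset.sum_comm]
  refine Finset.sum_congr rfl fun k _ => ?_
  rw [Finset.sum_comm, Finset.sum_eq_single k.rev]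
  · have h := congrArg (C : F → S F m) (sum_col_mul_col hg k k.rev)
    rw [if_pos rfl, map_sum, C_1] at h
    rw [← one_mul (X k ^ _ * _), ← h, Finset.sum_mul]
    refine Finset.sum_congr rfl fun i _ => ?_
    rw [C_mul]
    ring
  · intro l _ hl
    have h := congrArg (C : F → S F m) (sum_col_mul_col hg k l)
    rw [if_neg hl, map_sum, C_0] at h
    rw [← zero_mul (X k ^ Fintype.card F ^ j * X l), ← h, Finset.sum_mul]
    refine Finset.sum_congr rfl fun i _ => ?_
    rw [C_mul]
    ring
  · simp

end Orthogonal

theorem hook_le_sylow (F : Type*) [Field F] [Fintype F] (m : ℕ) : hook F m ≤ sylow F m := by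
  intro g hg
  obtain ⟨h1, h2, h3⟩ := (mem_hook_iff F m g).1 hg
  exact ⟨h1, fun i j hij => h3.isUpperTriangular hij, h3.unipotent_iff.1 h2⟩

/-! ### Elements of the Hook subgroup -/

section HookMatrix

variable {F : Type*} [Field F] {m : ℕ} [NeZero m]

theorem eq_yIdx_zero_iff (i : Fin (2 * m)) : i = yIdx 0 ↔ (i : ℕ) = 0 := by
  rw [Fin.ext_iff]
  simp

theorem eq_xIdx_zero_iff (i : Fin (2 * m)) : i = xIdx 0 ↔ (i : ℕ) + 1 = 2 * m := by
  have := NeZero.pos m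
  rw [Fin.ext_iff]
  simp only [xIdx_val, Fin.val_zero]
  omega

theorem IsHookShaped.act_X {g : Matrix (Fin (2 * m)) (Fin (2 * m)) F} (hg : IsHookShaped g)
    (hu : IsNilpotent (g - 1)) {i : Fin (2 * m)} (hi : i ≠ yIdx 0) (hi' : i ≠ xIdx 0) :
    act g (X i) = X i + C (g i (xIdx 0)) * X (xIdx 0) := by
  rw [OrthHook.act_X, ← Finset.add_sum_erase _ _ (Finset.mem_univ (xIdx 0)), add_comm]
  congr 1
  rw [Finset.sum_eq_single i]
  · rw [(hg.unipotent_iff).1 hu, C_1, one_mul]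
  · intro j hj hji
    rw [hg i j (fun h => hi ((eq_yIdx_zero_iff i).2 h))
      (fun h => (Finset.mem_erase.1 hj).1 ((eq_xIdx_zero_iff j).2 h)),
      Matrix.one_apply_ne hji.symm, C_0, zero_mul]
  · exact fun h => absurd (Finset.mem_erase.2 ⟨hi', Finset.mem_univ _⟩) h

theorem IsHookShaped.act_X_last {g : Matrix (Fin (2 * m)) (Fin (2 * m)) F} (hg : IsHookShaped g)
    (hu : IsNilpotent (g - 1)) : act g (X (xIdx 0)) = X (xIdx 0) := by
  rw [OrthHook.act_X, Finset.sum_eq_single (xIdx 0)]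
  · rw [(hg.unipotent_iff).1 hu, C_1, one_mul]
  · intro j _ hj
    have h0 : xIdx (0 : Fin m) ≠ yIdx 0 := (yIdx_ne_xIdx 0 0).symm
    rw [hg _ j (fun h => h0 ((eq_yIdx_zero_iff _).2 h))
      (fun h => hj ((eq_xIdx_zero_iff j).2 h)), Matrix.one_apply_ne hj.symm, C_0, zero_mul]
  · simp

/-- The matrix in the Hook subgroup with first row `v`. -/
def hookMatrix (v : Fin (2 * m) → F) : Matrix (Fin (2 * m)) (Fin (2 * m)) F :=
  Matrix.of fun i j => if i = yIdx 0 then v j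
    else (if i = j then 1 else 0) - if j = xIdx 0 ∧ i ≠ xIdx 0 then v i.rev else 0

theorem hookMatrix_apply_zero (v : Fin (2 * m) → F) (j : Fin (2 * m)) :
    hookMatrix v (yIdx 0) j = v j := by
  simp [hookMatrix]

theorem hookMatrix_isHookShaped (v : Fin (2 * m) → F) : IsHookShaped (hookMatrix v) := by
  intro i j hi hj
  rw [hookMatrix, Matrix.of_apply, if_neg (fun h => hi ((eq_yIdx_zero_iff i).1 h)),
    if_neg (c := _ ∧ _) (fun h => hj ((eq_xIdx_zero_iff j).1 h.1)), sub_zero, Matrix.one_apply]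

theorem hookMatrix_diag {v : Fin (2 * m) → F} (hv : v (yIdx 0) = 1) (i : Fin (2 * m)) :
    hookMatrix v i i = 1 := by
  rw [hookMatrix, Matrix.of_apply]
  split_ifs with h1 h2 h2
  · rw [h1, hv]
  · exact absurd h2.1 h2.2
  · exact sub_zero 1
  · exact absurd rfl ‹¬i = i›
  · exact absurd rfl ‹¬i = i›

theorem act_hookMatrix_X (v : Fin (2 * m) → F) {i : Fin (2 * m)} (hv : v (yIdx 0) = 1)
    (hi : i ≠ yIdx 0) (hi' : i ≠ xIdx 0) :
    act (hookMatrix v) (X i) = X i - C (v i.rev) * X (xIdx 0) := by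
  rw [(hookMatrix_isHookShaped v).act_X
    ((hookMatrix_isHookShaped v).unipotent_iff.2 (hookMatrix_diag hv)) hi hi', hookMatrix,
    Matrix.of_apply, if_neg hi, if_neg hi', if_pos ⟨rfl, hi'⟩]
  simp [sub_eq_add_neg]

variable [Fintype F]

theorem hypForm_split {R : Type*} [CommRing R] (v : Fin (2 * m) → R) : hypForm v =
    v (yIdx 0) * v (xIdx 0) + ∑ i ∈ Finset.univ.erase 0, v (yIdx i) * v (xIdx i) :=
  (Finset.add_sum_erase _ _ (Finset.mem_univ 0)).symm

/-- The terms linear in x₁ coming from the first row and the last column cancel, and the coefficient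
left at x₁² is `hypForm v`. -/
theorem act_hookMatrix_xi_zero {v : Fin (2 * m) → F} (hv : v (yIdx 0) = 1) (hq : hypForm v = 0) :
    act (hookMatrix v) (xi F m 0) = xi F m 0 := by
  have hne (i : Fin m) : yIdx i ≠ xIdx 0 := yIdx_ne_xIdx i 0
  have hne' (i : Fin m) : xIdx i ≠ yIdx 0 := (yIdx_ne_xIdx 0 i).symm
  have h1 : act (hookMatrix v) (X (yIdx 0)) = X (yIdx 0) + C (v (xIdx 0)) * X (xIdx 0) +
      ∑ i ∈ Finset.univ.erase (0 : Fin m),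
        (C (v (yIdx i)) * X (yIdx i) + C (v (xIdx i)) * X (xIdx i)) := by
    rw [act_X, sum_index, ← Finset.add_sum_erase _ _ (Finset.mem_univ 0)]
    simp only [hookMatrix_apply_zero, hv, C_1, one_mul]
  have h2 : act (hookMatrix v) (X (xIdx 0)) = X (xIdx 0) :=
    (hookMatrix_isHookShaped v).act_X_last
      ((hookMatrix_isHookShaped v).unipotent_iff.2 (hookMatrix_diag hv))
  have h3 := congrArg (C : F → S F m) (hq)
  rw [hypForm_split, hv, one_mul, C_add, map_sum, C_0] at h3
  rw [xi_zero, hypForm_split, map_add, map_sum, map_mul, h1, h2]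
  have h4 : ∑ i ∈ Finset.univ.erase (0 : Fin m), act (hookMatrix v) (X (yIdx i) * X (xIdx i))
      = ∑ i ∈ Finset.univ.erase (0 : Fin m), (X (yIdx i) * X (xIdx i)
        - (C (v (yIdx i)) * X (yIdx i) + C (v (xIdx i)) * X (xIdx i)) * X (xIdx 0)
        + C (v (yIdx i) * v (xIdx i)) * X (xIdx 0) ^ 2) := by
    refine Finset.sum_congr rfl fun i hi => ?_
    have hi0 := Finset.ne_of_mem_erase hi
    rw [map_mul, act_hookMatrix_X v hv (fun h => hi0 (yIdx_injective h)) (hne i),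
      act_hookMatrix_X v hv (hne' i) (fun h => hi0 (xIdx_injective h)), rev_yIdx, rev_xIdx, C_mul]
    ring
  rw [h4, Finset.sum_add_distrib (f := fun i => X (yIdx i) * X (xIdx i) - _),
    Finset.sum_sub_distrib, ← Finset.sum_mul, ← Finset.sum_mul]
  linear_combination (X (xIdx 0)) ^ 2 * h3

/-- The single source of group elements: it supplies both the translations on `Q` and the orbit of
y₁. -/
theorem exists_mem_hook {v : Fin (2 * m) → F} (hv : v (yIdx 0) = 1) (hq : hypForm v = 0) :
    ∃ g ∈ hook F m, (g : Matrix (Fin (2 * m)) (Fin (2 * m)) F) = hookMatrix v := by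
  have hs := hookMatrix_isHookShaped v
  have hdet : (hookMatrix v).det ≠ 0 := by
    rw [Matrix.det_of_isUpperTriangular hs.isUpperTriangular]
    simp [hookMatrix_diag hv]
  refine ⟨Matrix.GeneralLinearGroup.mkOfDetNeZero _ hdet, ?_, rfl⟩
  rw [mem_hook_iff]
  exact ⟨act_hookMatrix_xi_zero hv hq, hs.unipotent_iff.2 (hookMatrix_diag hv), hs⟩

end HookMatrix

theorem algHom_eq_of_mem_freeOf {F σ B : Type*} [Field F] [CommRing B] [Algebra F B] {i : σ}
    {φ ψ : MvPolynomial σ F →ₐ[F] B} (h : ∀ j ≠ i, φ (X j) = ψ (X j)) {f : MvPolynomial σ F}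
    (hf : f ∈ freeOf F i) : φ f = ψ f := by
  rw [freeOf, supported_eq_adjoin_X] at hf
  induction hf using Algebra.adjoin_induction with
  | mem f hf =>
    obtain ⟨j, hj, rfl⟩ := hf
    exact h j hj
  | algebraMap r => rw [AlgHom.commutes, AlgHom.commutes]
  | add f g _ _ hf hg => simp [hf, hg]
  | mul f g _ _ hf hg => simp [hf, hg]

/-! ### The invariants in `Q` -/

section Base

variable {F : Type*} [Field F] [Fintype F] {m : ℕ} [NeZero m]

/-- The positions of the variables other than `y₁` and `x₁`. -/
def inner (m : ℕ) [NeZero m] : Finset (Fin (2 * m)) :=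
  Finset.univ.filter fun i => i ≠ yIdx 0 ∧ i ≠ xIdx 0

theorem mem_inner {i : Fin (2 * m)} : i ∈ inner m ↔ i ≠ yIdx 0 ∧ i ≠ xIdx 0 := by
  simp [inner]

theorem xIdx_notMem_inner : xIdx (0 : Fin m) ∉ inner m := fun h => (mem_inner.1 h).2 rfl

theorem yIdx_notMem_inner : yIdx (0 : Fin m) ∉ inner m := fun h => (mem_inner.1 h).1 rfl

/-- The substitution of `Yᵢ` and `Xᵢ` for `yᵢ` and `xᵢ`, `i ≥ 2`. -/
abbrev base : S F m →ₐ[F] S F m := artinMap (xIdx 0) (inner m)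

theorem base_mem_Q {f : S F m} (hf : f ∈ Q F m) : base f ∈ Q F m := by
  have hx : (X (xIdx 0) : S F m) ∈ Q F m := X_mem_freeOf (yIdx_ne_xIdx 0 0).symm
  rw [Q, supported_eq_adjoin_X] at hf
  induction hf using Algebra.adjoin_induction with
  | mem f hf =>
    obtain ⟨j, hj, rfl⟩ := hf
    have hj' : (X j : S F m) ∈ Q F m := X_mem_freeOf hj
    by_cases h : j ∈ inner m
    · rw [base, artinMap_X_mem h]
      exact sub_mem (pow_mem hj' _) (mul_mem hj' (pow_mem hx _))
    · rwa [base, artinMap_X_notMem h]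
  | algebraMap r => rw [AlgHom.commutes]; exact Subalgebra.algebraMap_mem _ _
  | add f g _ _ hf hg => rw [map_add]; exact add_mem hf hg
  | mul f g _ _ hf hg => rw [map_mul]; exact mul_mem hf hg

theorem act_hook_X {g : GL (Fin (2 * m)) F} (hg : g ∈ hook F m) {i : Fin (2 * m)}
    (hi : i ∈ inner m) : ∃ c : F, act (g : Matrix _ _ F) (X i) = X i + C c * X (xIdx 0) := by
  obtain ⟨-, h2, h3⟩ := (mem_hook_iff F m g).1 hg
  exact ⟨_, h3.act_X h2 (mem_inner.1 hi).1 (mem_inner.1 hi).2⟩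

theorem act_hook_X_last {g : GL (Fin (2 * m)) F} (hg : g ∈ hook F m) :
    act (g : Matrix (Fin (2 * m)) (Fin (2 * m)) F) (X (xIdx 0)) = X (xIdx 0) := by
  obtain ⟨-, h2, h3⟩ := (mem_hook_iff F m g).1 hg
  exact h3.act_X_last h2

theorem act_hook_base_X {g : GL (Fin (2 * m)) F} (hg : g ∈ hook F m) {i : Fin (2 * m)}
    (hi : i ≠ yIdx 0) : act (g : Matrix _ _ F) (base (X i)) = base (X i) := by
  by_cases h : i ∈ inner m
  · obtain ⟨c, hc⟩ := act_hook_X hg h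
    have hix := (mem_inner.1 h).2
    rw [base, artinMap_X_mem h]
    conv_rhs => rw [← translate_bigX hix c]
    simp only [map_sub, map_mul, map_pow, hc, act_hook_X_last hg, translate_X_self,
      translate_X_ne hix.symm]
  · have hx : i = xIdx 0 := by
      by_contra hx
      exact h (mem_inner.2 ⟨hi, hx⟩)
    rw [base, artinMap_X_notMem h, hx, act_hook_X_last hg]

theorem act_hook_mem_Q {g : GL (Fin (2 * m)) F} (hg : g ∈ hook F m) {i : Fin (2 * m)}
    (hi : i ≠ yIdx 0) : act (g : Matrix _ _ F) (X i) ∈ Q F m := by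
  have hx : (X (xIdx 0) : S F m) ∈ Q F m := X_mem_freeOf (yIdx_ne_xIdx 0 0).symm
  by_cases h : i ∈ inner m
  · obtain ⟨c, hc⟩ := act_hook_X hg h
    rw [hc]
    exact add_mem (X_mem_freeOf hi) (mul_mem (Subalgebra.algebraMap_mem _ c) hx)
  · have hxi : i = xIdx 0 := by
      by_contra hx
      exact h (mem_inner.2 ⟨hi, hx⟩)
    rwa [hxi, act_hook_X_last hg]

theorem base_mem_QH {p : S F m} (hp : p ∈ Q F m) : base p ∈ QH F m := by
  refine ⟨base_mem_Q hp, fun g hg => ?_⟩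
  rw [← AlgHom.comp_apply]
  exact algHom_eq_of_mem_freeOf (i := yIdx 0) (fun j hj => act_hook_base_X hg hj) hp

theorem exists_hook_translate {i : Fin (2 * m)} (hi : i ∈ inner m) (c : F) :
    ∃ g ∈ hook F m, ∀ f ∈ Q F m, act (g : Matrix _ _ F) f = translate (xIdx 0) i c f := by
  obtain ⟨hiy, hix⟩ := mem_inner.1 hi
  have hr : yIdx 0 ≠ i.rev := fun h => hix (by rw [← Fin.rev_rev i, ← h]; rfl)
  -- The last column of row `i` is `-v i.rev`, so the entry `-c` translates `X i` by `c` x₁. The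
  -- vector is isotropic because its support contains no pair of opposite indices.
  set v : Fin (2 * m) → F := fun j => if j = yIdx 0 then 1 else if j = i.rev then -c else 0 with hv
  have hv0 : v (yIdx 0) = 1 := by simp [hv]
  have hq : hypForm v = 0 := by
    refine Finset.sum_eq_zero fun j _ => ?_
    rw [← rev_yIdx]
    generalize yIdx j = k
    simp only [hv]
    by_cases h1 : k = yIdx 0
    · subst h1
      have h3 : xIdx 0 ≠ i.rev := by
        rw [← rev_yIdx, Ne, Fin.rev_inj]
        exact hiy.symm
      rw [rev_yIdx, if_neg (yIdx_ne_xIdx 0 0).symm, if_neg h3, mul_zero]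
    · rw [if_neg h1]
      by_cases h2 : k = i.rev
      · rw [h2, Fin.rev_rev, if_neg hiy, if_neg (rev_ne_self i).symm, mul_zero]
      · rw [if_neg h2, zero_mul]
  obtain ⟨g, hg, hgv⟩ := exists_mem_hook hv0 hq
  refine ⟨g, hg, fun f hf => algHom_eq_of_mem_freeOf (i := yIdx 0) (fun j hj => ?_) hf⟩
  by_cases hjx : j = xIdx 0
  · rw [hjx, act_hook_X_last hg, translate_X_ne hix.symm]
  · rw [hgv, act_hookMatrix_X v hv0 hj hjx]
    have hjr : j.rev ≠ yIdx 0 := fun h => hjx (by rw [← Fin.rev_rev j, h]; rfl)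
    by_cases hji : j = i
    · subst hji
      rw [translate_X_self]
      simp [hv, hjr]
    · rw [translate_X_ne hji]
      simp [hv, hjr, hji]

theorem mem_QH_iff {f : S F m} : f ∈ QH F m ↔ ∃ p ∈ Q F m, f = base p := by
  refine ⟨fun hf => ?_, fun ⟨p, hp, h⟩ => h ▸ base_mem_QH hp⟩
  obtain ⟨hfQ, hfi⟩ := hf
  obtain ⟨p, hp⟩ := exists_artinMap (a := xIdx 0) xIdx_notMem_inner (f := f) fun i hi c => by
    obtain ⟨g, hg, hgt⟩ := exists_hook_translate hi c
    rw [← hgt f hfQ]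
    exact hfi g hg
  -- The preimage `p` might involve y₁. Setting y₁ = 0 in it is harmless, since this commutes with
  -- `base` and `f` is free of y₁.
  refine ⟨kill (yIdx 0) p, kill_mem _ _, ?_⟩
  have hcomm : (kill (yIdx 0)).comp base = (base.comp (kill (yIdx 0)) : S F m →ₐ[F] _) := by
    ext j : 1
    rw [AlgHom.comp_apply, AlgHom.comp_apply]
    by_cases hj : j = yIdx 0
    · subst hj
      rw [base, artinMap_X_notMem yIdx_notMem_inner, kill_X_self, map_zero]
    · rw [kill_X_ne hj, kill_of_mem (base_mem_Q (X_mem_freeOf hj))]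
  rw [← AlgHom.comp_apply, ← hcomm, AlgHom.comp_apply, ← hp, kill_of_mem hfQ]

theorem base_X_zero : base (X (xIdx 0)) = (X (xIdx 0) : S F m) :=
  artinMap_X_notMem xIdx_notMem_inner

theorem yIdx_mem_inner {i : Fin m} (hi : i ≠ 0) : yIdx i ∈ inner m :=
  mem_inner.2 ⟨fun h => hi (yIdx_injective h), yIdx_ne_xIdx _ _⟩

theorem xIdx_mem_inner {i : Fin m} (hi : i ≠ 0) : xIdx i ∈ inner m :=
  mem_inner.2 ⟨(yIdx_ne_xIdx _ _).symm, fun h => hi (xIdx_injective h)⟩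

theorem base_X_yIdx {i : Fin m} (hi : i ≠ 0) : base (X (yIdx i)) = bigY F m i :=
  artinMap_X_mem (yIdx_mem_inner hi)

theorem base_X_xIdx {i : Fin m} (hi : i ≠ 0) : base (X (xIdx i)) = bigX F m i :=
  artinMap_X_mem (xIdx_mem_inner hi)

variable (F m)

theorem QH_eq_adjoin : QH F m = Algebra.adjoin F ({x F 0} ∪
    {f | ∃ i : Fin m, i ≠ 0 ∧ (f = bigY F m i ∨ f = bigX F m i)}) := by
  apply le_antisymm
  · intro f hf
    obtain ⟨p, hp, rfl⟩ := mem_QH_iff.1 hf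
    rw [Q, supported_eq_adjoin_X] at hp
    have h1 : base p ∈ (Algebra.adjoin F (X '' {i : Fin (2 * m) | i ≠ yIdx 0})).map base :=
      ⟨p, hp, rfl⟩
    rw [AlgHom.map_adjoin] at h1
    refine Algebra.adjoin_mono ?_ h1
    rintro _ ⟨_, ⟨j, hj, rfl⟩, rfl⟩
    rcases index_cases j with ⟨i, rfl⟩ | ⟨i, rfl⟩
    · have hi : i ≠ 0 := by rintro rfl; exact hj rfl
      exact .inr ⟨i, hi, .inl (base_X_yIdx hi)⟩
    · by_cases hi : i = 0
      · exact .inl (by rw [hi]; exact base_X_zero)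
      · exact .inr ⟨i, hi, .inr (base_X_xIdx hi)⟩
  · refine Algebra.adjoin_le ?_
    rintro f (rfl | ⟨i, hi, rfl | rfl⟩)
    · exact mem_QH_iff.2 ⟨_, X_mem_freeOf (yIdx_ne_xIdx 0 0).symm, base_X_zero.symm⟩
    · exact mem_QH_iff.2 ⟨_, X_mem_freeOf (mem_inner.1 (yIdx_mem_inner hi)).1,
        (base_X_yIdx hi).symm⟩
    · exact mem_QH_iff.2 ⟨_, X_mem_freeOf (mem_inner.1 (xIdx_mem_inner hi)).1,
        (base_X_xIdx hi).symm⟩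

end Base

/-! ### Linear forms, the orbit of y₁ and its product -/

section LinearForms

variable {F : Type*} [Field F] {m : ℕ}

/-- The linear form with coefficients `v`. -/
def linForm (v : Fin (2 * m) → F) : S F m := ∑ j, C (v j) * X j

theorem act_X_eq_linForm (g : Matrix (Fin (2 * m)) (Fin (2 * m)) F) (i : Fin (2 * m)) :
    act g (X i) = linForm (g i) := act_X g i

theorem eval_linForm (v : Fin (2 * m) → F) (j : Fin (2 * m)) :
    eval (Pi.single j 1) (linForm v) = v j := by
  rw [linForm, map_sum, Finset.sum_eq_single j]
  · simp
  · intro i _ hi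
    simp [Pi.single_eq_of_ne hi]
  · simp

theorem linForm_injective : Function.Injective (linForm : (Fin (2 * m) → F) → S F m) :=
  fun v w h => funext fun j => by rw [← eval_linForm v, h, eval_linForm]

theorem linForm_isHomogeneous (v : Fin (2 * m) → F) : (linForm v).IsHomogeneous 1 :=
  IsHomogeneous.sum _ _ _ fun j _ => (isHomogeneous_X F j).C_mul (v j)

theorem act_injective (g : GL (Fin (2 * m)) F) :
    Function.Injective (act (g : Matrix (Fin (2 * m)) (Fin (2 * m)) F)) := by
  refine Function.LeftInverse.injective (g := act (↑g⁻¹ : Matrix (Fin (2 * m)) (Fin (2 * m)) F))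
    fun f => ?_
  rw [← act_mul, ← Units.val_mul, mul_inv_cancel, Units.val_one, act_one, AlgHom.id_apply]

variable [NeZero m]

theorem toPoly_linForm {v : Fin (2 * m) → F} (hv : v (yIdx 0) = 1) :
    ∃ l ∈ Q F m, toPoly (yIdx 0) (linForm v) = Polynomial.X + Polynomial.C l := by
  have hl : (∑ j ∈ Finset.univ.erase (yIdx 0), C (v j) * X j) ∈ Q F m := by
    refine sum_mem fun j hj => ?_
    exact mul_mem (Subalgebra.algebraMap_mem _ (v j)) (X_mem_freeOf (Finset.ne_of_mem_erase hj))
  refine ⟨_, hl, ?_⟩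
  rw [linForm, ← Finset.add_sum_erase _ _ (Finset.mem_univ (yIdx 0)), map_add, toPoly_of_mem hl,
    hv, C_1, one_mul, toPoly_X_self]

end LinearForms

section Orbit

variable {F : Type*} [Field F] {m : ℕ}

/-- The vector with entries `1, a, 0`. -/
def extendVec (a : Fin (2 * m - 2) → F) (i : Fin (2 * m)) : F :=
  if h : 0 < (i : ℕ) ∧ (i : ℕ) + 1 < 2 * m then a ⟨i - 1, by omega⟩
  else if (i : ℕ) = 0 then 1 else 0

/-- The position of the `k`-th variable after `y₁`. -/
def midIdx (k : Fin (2 * m - 2)) : Fin (2 * m) := ⟨k + 1, by omega⟩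

theorem extendVec_midIdx (a : Fin (2 * m - 2) → F) (k : Fin (2 * m - 2)) :
    extendVec a (midIdx k) = a k := by
  have h : 0 < ((midIdx k : Fin (2 * m)) : ℕ) ∧ ((midIdx k : Fin (2 * m)) : ℕ) + 1 < 2 * m := by
    simp only [midIdx]
    omega
  rw [extendVec, dif_pos h]
  rfl

theorem midIdx_injective : Function.Injective (midIdx : Fin (2 * m - 2) → Fin (2 * m)) :=
  fun a b h => Fin.ext (by simpa [midIdx] using congrArg Fin.val h)

theorem rev_midIdx (k : Fin (2 * m - 2)) : (midIdx k).rev = midIdx k.rev := by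
  refine Fin.ext ?_
  simp only [midIdx, Fin.val_rev]
  omega

variable [NeZero m]

theorem midIdx_mem_inner (k : Fin (2 * m - 2)) : midIdx k ∈ inner m := by
  rw [mem_inner, Ne, Ne, eq_yIdx_zero_iff, eq_xIdx_zero_iff]
  simp only [midIdx]
  omega

theorem exists_midIdx {i : Fin (2 * m)} (hi : i ∈ inner m) : ∃ k, i = midIdx k := by
  rw [mem_inner, Ne, Ne, eq_yIdx_zero_iff, eq_xIdx_zero_iff] at hi
  refine ⟨⟨i - 1, by omega⟩, Fin.ext ?_⟩
  simp only [midIdx]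
  omega

theorem index_cases' (i : Fin (2 * m)) : i = yIdx 0 ∨ i = xIdx 0 ∨ ∃ k, i = midIdx k := by
  by_cases h : i ∈ inner m
  · exact .inr (.inr (exists_midIdx h))
  · rw [mem_inner] at h
    tauto

theorem extendVec_yIdx (a : Fin (2 * m - 2) → F) : extendVec a (yIdx 0) = 1 := by
  simp [extendVec]

/-- The isotropic vector with entries `1, a` followed by one more. -/
def isoVec (a : Fin (2 * m - 2) → F) : Fin (2 * m) → F :=
  extendVec a + Pi.single (xIdx 0) (-hypForm (extendVec a))

theorem isoVec_of_ne (a : Fin (2 * m - 2) → F) {i : Fin (2 * m)} (hi : i ≠ xIdx 0) :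
    isoVec a i = extendVec a i := by
  simp [isoVec, Pi.single_eq_of_ne hi]

theorem isoVec_yIdx (a : Fin (2 * m - 2) → F) : isoVec a (yIdx 0) = 1 := by
  rw [isoVec_of_ne a (yIdx_ne_xIdx 0 0), extendVec_yIdx]

theorem isoVec_midIdx (a : Fin (2 * m - 2) → F) (k : Fin (2 * m - 2)) :
    isoVec a (midIdx k) = a k := by
  rw [isoVec_of_ne a (mem_inner.1 (midIdx_mem_inner k)).2, extendVec_midIdx]

theorem hypForm_isoVec (a : Fin (2 * m - 2) → F) : hypForm (isoVec a) = 0 := by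
  rw [isoVec, hypForm_add, Finset.sum_eq_single (yIdx 0)]
  · rw [extendVec_yIdx, rev_yIdx, Pi.single_eq_same, one_mul]
    have : hypForm (Pi.single (xIdx 0) (-hypForm (extendVec a)) : Fin (2 * m) → F) = 0 :=
      Finset.sum_eq_zero fun i _ => by
        rw [Pi.single_eq_of_ne (yIdx_ne_xIdx i 0), zero_mul]
    rw [this]
    ring
  · intro i _ hi
    rw [Pi.single_eq_of_ne, mul_zero]
    intro h
    exact hi (by rw [← Fin.rev_rev i, h, rev_xIdx])
  · simp

theorem isoVec_injective : Function.Injective (isoVec : (Fin (2 * m - 2) → F) → _) :=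
  fun a b h => funext fun k => by rw [← isoVec_midIdx a, h, isoVec_midIdx]

/-- With y₁-entry 1 the isotropy condition is linear in the x₁-entry with coefficient 1, so the
middle entries determine it. -/
theorem eq_isoVec {v : Fin (2 * m) → F} (hv : v (yIdx 0) = 1) (hq : hypForm v = 0) :
    v = isoVec fun k => v (midIdx k) := by
  set a : Fin (2 * m - 2) → F := fun k => v (midIdx k) with ha
  have hne {i : Fin (2 * m)} (hi : i ≠ xIdx 0) : v i = isoVec a i := by
    rcases index_cases' i with rfl | rfl | ⟨k, rfl⟩
    · rw [hv, isoVec_yIdx]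
    · exact absurd rfl hi
    · rw [isoVec_midIdx]
  funext i
  by_cases hi : i = xIdx 0
  · subst hi
    have h1 := hypForm_isoVec a
    rw [hypForm_split, hv, one_mul] at hq
    rw [hypForm_split, isoVec_yIdx, one_mul, ← hq] at h1
    have h2 : ∑ i ∈ Finset.univ.erase (0 : Fin m), isoVec a (yIdx i) * isoVec a (xIdx i)
        = ∑ i ∈ Finset.univ.erase (0 : Fin m), v (yIdx i) * v (xIdx i) :=
      Finset.sum_congr rfl fun i hi => by
        rw [hne (yIdx_ne_xIdx i 0), hne fun h => Finset.ne_of_mem_erase hi (xIdx_injective h)]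
    rw [h2] at h1
    exact (add_right_cancel h1).symm
  · exact hne hi

variable [Fintype F]

theorem two_ne_zero_of_odd (hF : Odd (Fintype.card F)) : (2 : F) ≠ 0 := by
  refine Ring.two_ne_zero fun h => ?_
  have := FiniteField.even_card_of_char_two h
  rw [Nat.odd_iff] at hF
  omega

/-- The row relation for an orthogonal matrix says that twice the form vanishes on its first row;
this is where odd q enters. Conversely, the Hook subgroup alone already reaches every such linear
form. -/
theorem orbit_eq_range (hF : Odd (Fintype.card F)) :
    {w : S F m | ∃ g ∈ sylow F m, w = act (g : Matrix _ _ F) (y F 0)}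
      = Set.range fun a => linForm (isoVec a) := by
  ext w
  constructor
  · rintro ⟨g, ⟨hg, hu⟩, rfl⟩
    have h1 := sum_row_mul_row hg (yIdx 0) (xIdx 0)
    rw [rev_xIdx, if_neg (yIdx_ne_xIdx 0 0), sum_mul_rev_self] at h1
    have h2 := eq_isoVec (hu.2 (yIdx 0))
      ((mul_eq_zero.1 h1).resolve_left (two_ne_zero_of_odd hF))
    exact ⟨_, (congrArg linForm h2.symm).trans (act_X_eq_linForm _ _).symm⟩
  · rintro ⟨a, rfl⟩
    obtain ⟨g, hg, hgv⟩ := exists_mem_hook (isoVec_yIdx a) (hypForm_isoVec a)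
    refine ⟨g, hook_le_sylow F m hg, ?_⟩
    rw [hgv, y, act_X_eq_linForm]
    exact congrArg linForm (funext fun j => (hookMatrix_apply_zero _ j).symm)

theorem normY_eq_prod (hF : Odd (Fintype.card F)) :
    normY F m = ∏ a : Fin (2 * m - 2) → F, linForm (isoVec a) := by
  rw [normY, orbitProduct, orbit_eq_range hF]
  exact (finprod_mem_range (linForm_injective.comp isoVec_injective)).trans
    (finprod_eq_prod_of_fintype _)

theorem normY_isHomogeneous (hF : Odd (Fintype.card F)) :
    (normY F m).IsHomogeneous (Fintype.card F ^ (2 * m - 2)) := by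
  rw [normY_eq_prod hF]
  convert! IsHomogeneous.prod Finset.univ _ (fun _ => 1)
    (fun a _ => linForm_isHomogeneous (isoVec (F := F) (m := m) a))
  simp

theorem toPoly_normY_monic (hF : Odd (Fintype.card F)) :
    (toPoly (yIdx 0) (normY F m)).Monic := by
  rw [normY_eq_prod hF, map_prod]
  refine Polynomial.monic_prod_of_monic _ _ fun a _ => ?_
  obtain ⟨l, -, hl⟩ := toPoly_linForm (isoVec_yIdx a)
  rw [hl]
  exact Polynomial.monic_X_add_C l

theorem natDegree_toPoly_normY (hF : Odd (Fintype.card F)) :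
    (toPoly (yIdx 0) (normY F m)).natDegree = Fintype.card F ^ (2 * m - 2) := by
  rw [normY_eq_prod hF, map_prod, Polynomial.natDegree_prod_of_monic]
  · rw [Finset.sum_congr rfl fun a _ => ?_, Finset.sum_const, Finset.card_univ, Fintype.card_fun,
      Fintype.card_fin, smul_eq_mul, mul_one]
    obtain ⟨l, -, hl⟩ := toPoly_linForm (isoVec_yIdx a)
    rw [hl, Polynomial.natDegree_X_add_C]
  · intro a _
    obtain ⟨l, -, hl⟩ := toPoly_linForm (isoVec_yIdx a)
    rw [hl]
    exact Polynomial.monic_X_add_C l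

theorem act_normY (hF : Odd (Fintype.card F)) {g : GL (Fin (2 * m)) F} (hg : g ∈ sylow F m) :
    act (g : Matrix (Fin (2 * m)) (Fin (2 * m)) F) (normY F m) = normY F m := by
  set O : Set (S F m) := {w | ∃ g ∈ sylow F m, w = act (g : Matrix _ _ F) (y F 0)} with hO
  have hfin : O.Finite := by
    rw [hO, orbit_eq_range hF]
    exact Set.finite_range _
  have himg : act (g : Matrix (Fin (2 * m)) (Fin (2 * m)) F) '' O = O := by
    ext w
    constructor
    · rintro ⟨_, ⟨h, hh, rfl⟩, rfl⟩
      exact ⟨h * g, mul_mem hh hg, by rw [← act_mul, Units.val_mul]⟩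
    · rintro ⟨h, hh, rfl⟩
      refine ⟨_, ⟨h * g⁻¹, mul_mem hh (inv_mem hg), rfl⟩, ?_⟩
      rw [← act_mul, ← Units.val_mul, inv_mul_cancel_right]
  have h1 := MonoidHom.map_finprod_mem (fun w : S F m => w)
    (act (g : Matrix (Fin (2 * m)) (Fin (2 * m)) F) : S F m →* S F m) hfin
  have h2 := finprod_mem_image (f := fun w : S F m => w) ((act_injective g).injOn (s := O))
  rw [himg] at h2
  exact h1.trans h2.symm

end Orbit

/-- The Frobenius endomorphism `a ↦ a^q` of an `F`-algebra, as a ring homomorphism. -/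
def cardFrobenius (F R : Type*) [Field F] [Fintype F] [CommRing R] [Algebra F R] : R →+* R :=
  (FiniteField.frobeniusAlgHom F R).toRingHom

theorem cardFrobenius_apply {F R : Type*} [Field F] [Fintype F] [CommRing R] [Algebra F R]
    (a : R) : cardFrobenius F R a = a ^ Fintype.card F := rfl

theorem pderiv_kill {F σ : Type*} [Field F] [DecidableEq σ] {a b : σ} (hab : a ≠ b)
    (f : MvPolynomial σ F) : pderiv a (kill b f) = kill b (pderiv a f) := by
  induction f using MvPolynomial.induction_on with
  | C r => rw [← algebraMap_eq, AlgHom.commutes, algebraMap_eq, pderiv_C, map_zero]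
  | add f g hf hg => simp only [map_add, hf, hg]
  | mul_X f j hf =>
    by_cases hj : j = b
    · subst hj
      rw [map_mul, kill_X_self, mul_zero, map_zero, pderiv_mul, pderiv_X_of_ne hab.symm,
        mul_zero, add_zero, map_mul, kill_X_self, mul_zero]
    · rw [map_mul, kill_X_ne hj, pderiv_mul, pderiv_mul, hf, map_add, map_mul, map_mul,
        kill_X_ne hj]
      by_cases hja : j = a
      · subst hja; simp
      · rw [pderiv_X_of_ne hja, map_zero]

/-! ### The Jacobian of the reduced ξⱼ -/

section Jacobian

theorem sum_pderiv_X_mul {F : Type*} [Field F] {m : ℕ} (a : Fin (2 * m)) (f : Fin (2 * m) → S F m) :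
    ∑ i, pderiv a (X i) * f i = f a := by
  rw [Finset.sum_eq_single a]
  · simp
  · intro i _ hi
    rw [pderiv_X_of_ne hi, zero_mul]
  · simp

variable {F : Type*} [Field F] [Fintype F] {m : ℕ}

theorem card_pow_cast (j : ℕ) (hj : j ≠ 0) : ((Fintype.card F ^ j : ℕ) : S F m) = 0 := by
  rw [Nat.cast_pow, ← map_natCast (C : F →+* S F m), FiniteField.cast_card_eq_zero, C_0,
    zero_pow hj]

/-- For j > 0 the q^j-th powers have derivative zero, so only the linear factors contribute. The
formula is uniform in j, which makes the Jacobian a Moore matrix. -/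
theorem pderiv_xi (a : Fin (2 * m)) (j : ℕ) :
    pderiv a (xi F m j) = X a.rev ^ Fintype.card F ^ j := by
  by_cases hj : j = 0
  · subst hj
    rw [pow_zero, pow_one, ← sum_pderiv_X_mul a fun i => (X i.rev : S F m), sum_index, xi_zero,
      hypForm, map_sum]
    refine Finset.sum_congr rfl fun i _ => ?_
    rw [pderiv_mul, rev_yIdx, rev_xIdx]
    ring
  · rw [xi_of_ne_zero hj, map_sum, ← Equiv.sum_comp Fin.revPerm,
      ← sum_pderiv_X_mul a fun i => (X i.rev : S F m) ^ Fintype.card F ^ j]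
    refine Finset.sum_congr rfl fun i _ => ?_
    rw [pderiv_mul, pderiv_pow, card_pow_cast j hj, Fin.revPerm_apply, Fin.rev_rev]
    ring

variable [NeZero m]

/-- The reduction of `ξⱼ` modulo `x₁`. -/
def xibar (F : Type*) [Field F] [Fintype F] (m : ℕ) [NeZero m] (j : ℕ) : S F m :=
  kill (xIdx 0) (xi F m j)

/-- Inner derivatives commute with setting x₁ = 0, so the Jacobian matrix is the Moore matrix of the
inner variables in reverse order, and these are linearly independent. -/
theorem eq_zero_of_sum_pow_card_mul_xibar
    (b : (Fin (2 * m - 2) → Fin (Fintype.card F)) → S F m)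
    (hb : ∑ e, b e ^ Fintype.card F * ∏ j : Fin (2 * m - 2), xibar F m j ^ (e j : ℕ) = 0) :
    b = 0 := by
  refine eq_zero_of_sum_pow_card_mul_prod (F := F) (D := fun k => pderiv (midIdx k)) ?_ b hb
  have hz : LinearIndependent F fun k : Fin (2 * m - 2) => (X (midIdx k.rev) : S F m) :=
    (linearIndependent_X _ F).comp _ (midIdx_injective.comp Fin.rev_injective)
  refine ne_of_eq_of_ne (congrArg Matrix.det ?_) (moore_det_ne_zero hz)
  ext1 j k
  rw [Matrix.of_apply, Matrix.of_apply, xibar,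
    pderiv_kill (mem_inner.1 (midIdx_mem_inner k)).2, pderiv_xi, map_pow, rev_midIdx,
    kill_X_ne (mem_inner.1 (midIdx_mem_inner _)).2]

end Jacobian

theorem toPoly_kill {F : Type*} [Field F] {m : ℕ} [NeZero m] (f : S F m) :
    toPoly (yIdx 0) (kill (xIdx 0) f) =
    (toPoly (yIdx 0) f).map ((kill (xIdx 0) : S F m →ₐ[F] S F m) : S F m →+* S F m) := by
  rw [toPoly_map _ (kill (xIdx 0)), kill_X_ne (yIdx_ne_xIdx 0 0), toPoly_X_self,
    Polynomial.comp_X]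
  intro j hj
  by_cases h : j = xIdx 0
  · rw [h, kill_X_self]; exact zero_mem _
  · rw [kill_X_ne h]; exact X_mem_freeOf hj

/-! ### Combinations of block monomials modulo x₁ -/

section Combination

variable {F : Type*} [Field F] [Fintype F] {m : ℕ} [NeZero m]

/-- The substitution of `N(y₁)`, `Yᵢ` and `Xᵢ` for `y₁`, `yᵢ` and `xᵢ`. -/
def theta : S F m →ₐ[F] S F m := aeval fun i => if i = yIdx 0 then normY F m else base (X i)

theorem theta_X_yIdx : theta (X (yIdx 0)) = normY F m := by simp [theta]

theorem theta_X_ne {i : Fin (2 * m)} (hi : i ≠ yIdx 0) :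
    theta (X i : S F m) = base (X i) := by simp [theta, hi]

theorem theta_X_last : theta (X (xIdx 0)) = (X (xIdx 0) : S F m) := by
  rw [theta_X_ne (yIdx_ne_xIdx 0 0).symm, base_X_zero]

theorem theta_of_mem_Q {f : S F m} (hf : f ∈ Q F m) : theta f = base f :=
  algHom_eq_of_mem_freeOf (i := yIdx 0) (fun _ h => theta_X_ne h) hf

/-- Combinations of the block monomials with coefficients in `Q^H[N(y₁)]`. -/
def comb (β : (Fin (2 * m - 2) → Fin (Fintype.card F)) → S F m) : S F m :=
  ∑ e, theta (β e) * blockMonomial F m e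

theorem comb_add (β γ : (Fin (2 * m - 2) → Fin (Fintype.card F)) → S F m) :
    comb (β + γ) = comb β + comb γ := by
  simp only [comb, Pi.add_apply, map_add, add_mul, Finset.sum_add_distrib]

theorem comb_smul (a : S F m) (β : (Fin (2 * m - 2) → Fin (Fintype.card F)) → S F m) :
    comb (a • β) = theta a * comb β := by
  simp only [comb, Pi.smul_apply, smul_eq_mul, map_mul, Finset.mul_sum, mul_assoc]

theorem comb_single (e : Fin (2 * m - 2) → Fin (Fintype.card F)) (a : S F m) :
    comb (Pi.single e a) = theta a * blockMonomial F m e := by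
  rw [comb, Finset.sum_eq_single e]
  · simp
  · intro e' _ he
    rw [Pi.single_eq_of_ne he, map_zero, zero_mul]
  · simp

theorem kill_blockMonomial (e : Fin (2 * m - 2) → Fin (Fintype.card F)) :
    kill (xIdx 0) (blockMonomial F m e)
      = ∏ j : Fin (2 * m - 2), xibar F m j ^ (e j : ℕ) := by
  simp only [blockMonomial, map_prod, map_pow, xibar]

/-- In ξⱼ the variable y₁ occurs only together with a power of x₁. -/
theorem xibar_mem_Q (j : ℕ) : xibar F m j ∈ Q F m := by
  have hmem (i : Fin m) (hi : i ≠ 0) : y F i ∈ Q F m ∧ x F i ∈ Q F m :=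
    ⟨X_mem_freeOf (mem_inner.1 (yIdx_mem_inner hi)).1,
      X_mem_freeOf (mem_inner.1 (xIdx_mem_inner hi)).1⟩
  have hy (i : Fin m) : kill (xIdx 0) (y F i) = y F i := kill_X_ne (yIdx_ne_xIdx i 0)
  have hx (i : Fin m) (hi : i ≠ 0) : kill (xIdx 0) (x F i) = x F i :=
    kill_X_ne fun h => hi (xIdx_injective h)
  have hx0 : kill (xIdx 0) (x F (0 : Fin m)) = 0 := kill_X_self _
  rw [xibar, xi]
  split_ifs with hj
  · rw [map_sum]
    refine sum_mem fun i _ => ?_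
    rw [map_mul]
    by_cases hi : i = 0
    · rw [hi, hx0, mul_zero]
      exact zero_mem _
    · rw [hy, hx i hi]
      exact mul_mem (hmem i hi).1 (hmem i hi).2
  · rw [map_sum]
    refine sum_mem fun i _ => ?_
    rw [map_add, map_mul, map_mul, map_pow, map_pow]
    by_cases hi : i = 0
    · rw [hi, hx0, mul_zero, zero_pow (pow_ne_zero _ Fintype.card_ne_zero), mul_zero, add_zero]
      exact zero_mem _
    · rw [hy, hx i hi]
      exact add_mem (mul_mem (pow_mem (hmem i hi).1 _) (hmem i hi).2)
        (mul_mem (hmem i hi).1 (pow_mem (hmem i hi).2 _))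

/-- Modulo x₁ the elements Yᵢ and Xᵢ become yᵢ^q and xᵢ^q. Thus `theta` turns into Frobenius on
coefficients, followed by the substitution of the reduced N(y₁) for y₁. -/
theorem toPoly_kill_theta (f : S F m) :
    toPoly (yIdx 0) (kill (xIdx 0) (theta f)) =
      ((toPoly (yIdx 0) (kill (xIdx 0) f)).map
        (cardFrobenius F (S F m))).comp
      (toPoly (yIdx 0) (kill (xIdx 0) (normY F m))) := by
  have hq1 : Fintype.card F - 1 ≠ 0 := by
    have := Fintype.one_lt_card (α := F)
    omega
  induction f using MvPolynomial.induction_on with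
  | C a =>
    rw [← algebraMap_eq, AlgHom.commutes, AlgHom.commutes, AlgHom.commutes,
      Polynomial.algebraMap_apply, Polynomial.map_C, Polynomial.C_comp]
    rw [cardFrobenius_apply, algebraMap_pow_card]
  | add f g hf hg => simp only [map_add, hf, hg, Polynomial.map_add, Polynomial.add_comp]
  | mul_X f j hf =>
    rw [map_mul, map_mul, map_mul, hf, map_mul, map_mul, Polynomial.map_mul, Polynomial.mul_comp]
    refine congrArg₂ (· * ·) rfl ?_
    rcases index_cases' j with rfl | rfl | ⟨k, rfl⟩
    · rw [theta_X_yIdx, kill_X_ne (yIdx_ne_xIdx 0 0), toPoly_X_self, Polynomial.map_X,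
        Polynomial.X_comp]
    · rw [theta_X_last, kill_X_self, map_zero, Polynomial.map_zero, Polynomial.zero_comp]
    · have hk := midIdx_mem_inner k
      obtain ⟨h1, h2⟩ := mem_inner.1 hk
      rw [theta_X_ne h1, base, artinMap_X_mem hk, map_sub, map_mul, map_pow, map_pow, kill_X_self,
        zero_pow hq1, mul_zero, sub_zero, kill_X_ne h2, map_pow, toPoly_X_ne h1,
        Polynomial.map_C, Polynomial.C_comp, ← Polynomial.C_pow, cardFrobenius_apply]

/-- Modulo x₁ the combination is a polynomial `P` evaluated at the reduced N(y₁), which has positive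
degree in y₁; so `P` itself vanishes. Each coefficient of `P` is then a relation over q-th powers
between the reduced ξⱼ. -/
theorem X_dvd_of_X_dvd_comb (hF : Odd (Fintype.card F))
    {β : (Fin (2 * m - 2) → Fin (Fintype.card F)) → S F m} (h : X (xIdx 0) ∣ comb β)
    (e : Fin (2 * m - 2) → Fin (Fintype.card F)) : X (xIdx 0) ∣ β e := by
  set Nb := toPoly (yIdx 0) (kill (xIdx 0) (normY F m)) with hNb
  have hmon : Nb.Monic := by
    rw [hNb, toPoly_kill]
    exact (toPoly_normY_monic hF).map _
  have hdeg : Nb.natDegree ≠ 0 := by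
    rw [hNb, toPoly_kill, (toPoly_normY_monic hF).natDegree_map, natDegree_toPoly_normY hF]
    exact pow_ne_zero _ Fintype.card_ne_zero
  obtain ⟨u, hu⟩ := h
  have h1 := congrArg (fun f => toPoly (yIdx 0) (kill (xIdx 0) f)) hu
  simp only [comb, map_sum, map_mul, kill_X_self, map_zero, zero_mul, toPoly_kill_theta,
    kill_blockMonomial] at h1
  set P : Polynomial (S F m) := ∑ e, (toPoly (yIdx 0) (kill (xIdx 0) (β e))).map
        (cardFrobenius F (S F m)) *
          Polynomial.C (∏ j : Fin (2 * m - 2), xibar F m j ^ (e j : ℕ)) with hP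
  have hP0 : P.comp Nb = 0 := by
    rw [← h1, hP, ← Polynomial.coe_compRingHom_apply, map_sum]
    refine Finset.sum_congr rfl fun e _ => ?_
    rw [Polynomial.coe_compRingHom_apply, Polynomial.mul_comp, Polynomial.C_comp,
      toPoly_of_mem (prod_mem fun j _ => pow_mem (xibar_mem_Q _) _)]
  have hPz : P = 0 := by
    rcases Polynomial.comp_eq_zero_iff.1 hP0 with h | ⟨-, h⟩
    · exact h
    · rw [h, Polynomial.natDegree_C] at hdeg
      exact absurd rfl hdeg
  have hcoeff (k : ℕ) : (fun e => (toPoly (yIdx 0) (kill (xIdx 0) (β e))).coeff k) = 0 := by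
    refine eq_zero_of_sum_pow_card_mul_xibar _ ?_
    have h2 := congrArg (fun p => Polynomial.coeff p k) hPz
    simpa only [hP, Polynomial.finsetSum_coeff, Polynomial.coeff_mul_C, Polynomial.coeff_map,
      Polynomial.coeff_zero, cardFrobenius_apply] using h2
  refine X_dvd_of_kill_eq_zero (toPoly_injective (yIdx 0) ?_)
  ext1 k
  rw [map_zero, Polynomial.coeff_zero]
  exact congrFun (hcoeff k) e

end Combination

section

/-! ### Linear independence and degrees in y₁ -/

section DegY

variable {F : Type*} [Field F] {m : ℕ} [NeZero m]

/-- The degree in `y₁`. -/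
def degY (f : S F m) : ℕ := (toPoly (yIdx 0) f).natDegree

theorem toPoly_ne_zero {f : S F m} (hf : f ≠ 0) : toPoly (yIdx 0) f ≠ 0 := fun h =>
  hf (toPoly_injective (yIdx 0) (by rw [h, map_zero]))

theorem degY_mul {f g : S F m} (hf : f ≠ 0) (hg : g ≠ 0) : degY (f * g) = degY f + degY g := by
  rw [degY, map_mul, Polynomial.natDegree_mul (toPoly_ne_zero hf) (toPoly_ne_zero hg)]
  rfl

end DegY

variable {F : Type*} [Field F] [Fintype F] {m : ℕ} [NeZero m]

theorem exists_smul_of_X_dvd_comb (hF : Odd (Fintype.card F))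
    {β : (Fin (2 * m - 2) → Fin (Fintype.card F)) → S F m} (h : X (xIdx 0) ∣ comb β) :
    ∃ γ, β = (X (xIdx 0) : S F m) • γ ∧ comb β = X (xIdx 0) * comb γ := by
  choose γ hγ using X_dvd_of_X_dvd_comb hF h
  have h1 : β = (X (xIdx 0) : S F m) • γ := funext fun e => by rw [hγ, Pi.smul_apply, smul_eq_mul]
  exact ⟨γ, h1, by rw [h1, comb_smul, theta_X_last]⟩

/-- A vanishing combination can be divided by x₁ forever, so all powers of x₁ divide every
coefficient. -/
theorem eq_zero_of_comb_eq_zero (hF : Odd (Fintype.card F))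
    {β : (Fin (2 * m - 2) → Fin (Fintype.card F)) → S F m} (h : comb β = 0) : β = 0 := by
  have hdvd (n : ℕ) : ∀ β : (Fin (2 * m - 2) → Fin (Fintype.card F)) → S F m, comb β = 0 →
      ∀ e, X (xIdx 0) ^ n ∣ β e := by
    induction n with
    | zero => intro β _ e; simp
    | succ n ih =>
      intro β hβ e
      obtain ⟨γ, hγ, hc⟩ := exists_smul_of_X_dvd_comb hF (hβ ▸ dvd_zero _)
      rw [hβ, eq_comm] at hc
      have h1 := ih γ ((mul_eq_zero.1 hc).resolve_left (X_ne_zero _)) e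
      rw [hγ, Pi.smul_apply, smul_eq_mul, pow_succ']
      exact mul_dvd_mul_left _ h1
  funext e
  by_contra h0
  obtain ⟨u, hu⟩ := hdvd ((β e).totalDegree + 1) β h e
  have hu0 : u ≠ 0 := by
    rintro rfl
    exact h0 (by simpa using hu)
  have h1 := congrArg totalDegree hu
  rw [totalDegree_mul_of_isDomain (pow_ne_zero _ (X_ne_zero _)) hu0, totalDegree_X_pow] at h1
  omega

theorem theta_injective (hF : Odd (Fintype.card F)) :
    Function.Injective (theta : S F m → S F m) := by
  rw [injective_iff_map_eq_zero]
  intro f hf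
  have e : Fin (2 * m - 2) → Fin (Fintype.card F) := fun _ => ⟨0, Fintype.card_pos⟩
  have h1 := eq_zero_of_comb_eq_zero hF (β := Pi.single e f) (by rw [comb_single, hf, zero_mul])
  have h2 := congrFun h1 e
  rwa [Pi.single_eq_same] at h2

section Degrees

/-- The degree of a block monomial in `y₁`. -/
def blockDegree {q d : ℕ} (e : Fin d → Fin q) : ℕ := ∑ j, (e j : ℕ) * q ^ (j : ℕ)

/-- The exponents are the base q digits of the degree; existence and uniqueness of expansions give
this lemma and the next two. -/
theorem blockDegree_lt {q d : ℕ} (e : Fin d → Fin q) : blockDegree e < q ^ d :=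
  (finFunctionFinEquiv e).2

theorem blockDegree_injective {q d : ℕ} :
    Function.Injective (blockDegree : (Fin d → Fin q) → ℕ) := fun _ _ h =>
  finFunctionFinEquiv.injective (Fin.ext h)

theorem exists_blockDegree {q d n : ℕ} (h : n < q ^ d) :
    ∃ e : Fin d → Fin q, blockDegree e = n := by
  obtain ⟨e, he⟩ := finFunctionFinEquiv.surjective (⟨n, h⟩ : Fin (q ^ d))
  exact ⟨e, congrArg Fin.val he⟩

theorem exists_toPoly_xi (j : ℕ) : ∃ p : Polynomial (S F m), p.natDegree < Fintype.card F ^ j ∧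
    toPoly (yIdx 0) (xi F m j)
      = Polynomial.C (X (xIdx 0)) * Polynomial.X ^ Fintype.card F ^ j + p := by
  have hmem (i : Fin m) (hi : i ≠ 0) : y F i ∈ Q F m ∧ x F i ∈ Q F m :=
    ⟨X_mem_freeOf (mem_inner.1 (yIdx_mem_inner hi)).1,
      X_mem_freeOf (mem_inner.1 (xIdx_mem_inner hi)).1⟩
  have hx0 : toPoly (yIdx 0) (x F (0 : Fin m)) = Polynomial.C (X (xIdx 0)) :=
    toPoly_X_ne (yIdx_ne_xIdx 0 0).symm
  have hy0 : toPoly (yIdx 0) (y F (0 : Fin m)) = Polynomial.X := toPoly_X_self _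
  by_cases hj : j = 0
  · subst hj
    rw [xi, if_pos rfl, ← Finset.add_sum_erase _ _ (Finset.mem_univ 0), map_add, map_mul, hx0, hy0,
      toPoly_of_mem (sum_mem fun i hi => mul_mem (hmem i (Finset.ne_of_mem_erase hi)).1
        (hmem i (Finset.ne_of_mem_erase hi)).2)]
    refine ⟨Polynomial.C (∑ i ∈ Finset.univ.erase 0, y F i * x F i), ?_, ?_⟩
    rotate_left
    · rw [pow_zero, pow_one, mul_comm Polynomial.X]
    · rw [Polynomial.natDegree_C, pow_zero]
      exact one_pos
  · rw [xi, if_neg hj, ← Finset.add_sum_erase _ _ (Finset.mem_univ 0), map_add, map_add, map_mul,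
      map_mul, map_pow, map_pow, hx0, hy0,
      toPoly_of_mem (sum_mem fun i hi => add_mem
        (mul_mem (pow_mem (hmem i (Finset.ne_of_mem_erase hi)).1 _)
          (hmem i (Finset.ne_of_mem_erase hi)).2)
        (mul_mem (hmem i (Finset.ne_of_mem_erase hi)).1
          (pow_mem (hmem i (Finset.ne_of_mem_erase hi)).2 _)))]
    refine ⟨Polynomial.C (X (xIdx 0) ^ Fintype.card F ^ j) * Polynomial.X + Polynomial.C
      (∑ i ∈ Finset.univ.erase 0,
        (y F i ^ Fintype.card F ^ j * x F i + y F i * x F i ^ Fintype.card F ^ j)), ?_, ?_⟩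
    rotate_left
    · rw [Polynomial.C_pow, add_assoc, mul_comm (Polynomial.X ^ _),
        mul_comm Polynomial.X]
    · exact Polynomial.natDegree_linear_le.trans_lt (Nat.one_lt_pow hj Fintype.one_lt_card)

theorem natDegree_C_X_mul_X_pow (j : ℕ) :
    (Polynomial.C (X (xIdx 0) : S F m) * Polynomial.X ^ Fintype.card F ^ j).natDegree
      = Fintype.card F ^ j :=
  Polynomial.natDegree_C_mul_X_pow _ _ (X_ne_zero _)

theorem degY_xi (j : ℕ) : degY (xi F m j) = Fintype.card F ^ j := by
  obtain ⟨p, hp, h⟩ := exists_toPoly_xi (F := F) (m := m) j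
  rw [degY, h, Polynomial.natDegree_add_eq_left_of_natDegree_lt, natDegree_C_X_mul_X_pow]
  rwa [natDegree_C_X_mul_X_pow]

theorem leadingCoeff_toPoly_xi (j : ℕ) :
    (toPoly (yIdx 0) (xi F m j)).leadingCoeff = X (xIdx 0) := by
  obtain ⟨p, hp, h⟩ := exists_toPoly_xi (F := F) (m := m) j
  rw [h, Polynomial.leadingCoeff_add_of_degree_lt', Polynomial.leadingCoeff_C_mul_X_pow]
  refine Polynomial.degree_lt_degree ?_
  rwa [natDegree_C_X_mul_X_pow]

theorem xi_ne_zero (j : ℕ) : xi F m j ≠ 0 := fun h => by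
  have := leadingCoeff_toPoly_xi (F := F) (m := m) j
  rw [h, map_zero, Polynomial.leadingCoeff_zero] at this
  exact X_ne_zero _ this.symm

theorem blockMonomial_ne_zero (e : Fin (2 * m - 2) → Fin (Fintype.card F)) :
    blockMonomial F m e ≠ 0 :=
  Finset.prod_ne_zero_iff.2 fun _ _ => pow_ne_zero _ (xi_ne_zero _)

theorem degY_blockMonomial (e : Fin (2 * m - 2) → Fin (Fintype.card F)) :
    degY (blockMonomial F m e) = blockDegree e := by
  rw [degY, blockMonomial, map_prod, Polynomial.natDegree_prod _ _
    fun j _ => toPoly_ne_zero (pow_ne_zero _ (xi_ne_zero _)), blockDegree]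
  refine Finset.sum_congr rfl fun j _ => ?_
  rw [map_pow, Polynomial.natDegree_pow, ← degY_xi (F := F) (m := m)]
  rfl

theorem leadingCoeff_blockMonomial (e : Fin (2 * m - 2) → Fin (Fintype.card F)) :
    ∃ s, (toPoly (yIdx 0) (blockMonomial F m e)).leadingCoeff = X (xIdx 0) ^ s := by
  refine ⟨∑ j, (e j : ℕ), ?_⟩
  rw [blockMonomial, map_prod, Polynomial.leadingCoeff_prod, ← Finset.prod_pow_eq_pow_sum]
  refine Finset.prod_congr rfl fun j _ => ?_
  rw [map_pow, Polynomial.leadingCoeff_pow, leadingCoeff_toPoly_xi]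

theorem toPoly_theta (f : S F m) : toPoly (yIdx 0) (theta f) =
    ((toPoly (yIdx 0) f).map ((theta : S F m →ₐ[F] S F m) : S F m →+* S F m)).comp
      (toPoly (yIdx 0) (normY F m)) := by
  rw [toPoly_map (yIdx 0) theta, theta_X_yIdx]
  intro j hj
  rw [theta_X_ne hj]
  exact base_mem_Q (X_mem_freeOf hj)

theorem degY_theta (hF : Odd (Fintype.card F)) (f : S F m) :
    degY (theta f) = degY f * Fintype.card F ^ (2 * m - 2) := by
  rw [degY, toPoly_theta, Polynomial.natDegree_comp, natDegree_toPoly_normY hF,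
    Polynomial.natDegree_map_eq_of_injective
      (f := ((theta : S F m →ₐ[F] S F m) : S F m →+* S F m)) (theta_injective hF), degY]

/-- Nonzero terms have y₁-degrees that are distinct modulo q^(2m-2), so leading terms cannot cancel.
-/
theorem degY_le_degY_comb (hF : Odd (Fintype.card F))
    (β : (Fin (2 * m - 2) → Fin (Fintype.card F)) → S F m)
    {e : Fin (2 * m - 2) → Fin (Fintype.card F)} (he : β e ≠ 0) :
    degY (β e) * Fintype.card F ^ (2 * m - 2) + blockDegree e ≤ degY (comb β) := by
  set t : (Fin (2 * m - 2) → Fin (Fintype.card F)) → Polynomial (S F m) :=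
    fun e => toPoly (yIdx 0) (theta (β e) * blockMonomial F m e) with ht
  have hth {e} (he : β e ≠ 0) : theta (β e) ≠ 0 := fun h =>
    he (theta_injective hF (by rw [h, map_zero]))
  have hdeg {e} (he : β e ≠ 0) :
      (t e).natDegree = degY (β e) * Fintype.card F ^ (2 * m - 2) + blockDegree e := by
    rw [← degY_theta hF, ← degY_blockMonomial, ← degY_mul (hth he) (blockMonomial_ne_zero e)]
    rfl
  have hne {e} (he : β e ≠ 0) : t e ≠ 0 :=
    toPoly_ne_zero (mul_ne_zero (hth he) (blockMonomial_ne_zero e))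
  have hsum := Polynomial.degree_sum_eq_of_disjoint t Finset.univ ?_
  · rw [← hdeg he]
    refine Polynomial.natDegree_le_natDegree ?_
    rw [comb, map_sum, hsum]
    exact Finset.le_sup (f := fun i => (t i).degree) (Finset.mem_univ e)
  · rintro a ⟨-, ha⟩ b ⟨-, hb⟩ hab h
    have ha' : β a ≠ 0 := fun h => ha (by simp [ht, h])
    have hb' : β b ≠ 0 := fun h => hb (by simp [ht, h])
    have h1 : (t a).natDegree = (t b).natDegree := Polynomial.natDegree_eq_of_degree_eq h
    rw [hdeg ha', hdeg hb'] at h1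
    have h2 := congrArg (· % Fintype.card F ^ (2 * m - 2)) h1
    simp only [Nat.mul_add_mod_self_right, Nat.mod_eq_of_lt (blockDegree_lt _)] at h2
    exact hab (blockDegree_injective h2)

end Degrees

/-! ### Every invariant is a combination of block monomials -/

section Invariants

theorem xi_mem_invariants {F : Type*} [Field F] [Fintype F] {m : ℕ} (j : ℕ) :
    xi F m j ∈ invariants (hook F m) := fun g hg =>
  act_xi ((mem_hook_iff F m g).1 hg).1 j

theorem blockMonomial_mem_invariants {F : Type*} [Field F] [Fintype F] {m : ℕ}
    (e : Fin (2 * m - 2) → Fin (Fintype.card F)) :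
    blockMonomial F m e ∈ invariants (hook F m) :=
  prod_mem fun _ _ => pow_mem (xi_mem_invariants _) _

theorem normY_mem_invariants (hF : Odd (Fintype.card F)) : normY F m ∈ invariants (hook F m) :=
  fun _ hg => act_normY hF (hook_le_sylow F m hg)

theorem theta_mem_invariants (hF : Odd (Fintype.card F)) (f : S F m) :
    theta f ∈ invariants (hook F m) := by
  induction f using MvPolynomial.induction_on with
  | C a => rw [← algebraMap_eq, AlgHom.commutes]; exact Subalgebra.algebraMap_mem _ _
  | add f g hf hg => rw [map_add]; exact add_mem hf hg
  | mul_X f j hf =>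
    rw [map_mul]
    refine mul_mem hf ?_
    by_cases hj : j = yIdx 0
    · rw [hj, theta_X_yIdx]
      exact normY_mem_invariants hF
    · rw [theta_X_ne hj]
      exact (base_mem_QH (X_mem_freeOf hj)).2

/-- A group element sends y₁ to y₁ + l with l in `Q` and maps `Q` to itself, so it acts on the
leading coefficient in y₁. -/
theorem leadingCoeff_mem_QH {f : S F m} (hf : f ∈ invariants (hook F m)) :
    (toPoly (yIdx 0) f).leadingCoeff ∈ QH F m := by
  refine ⟨coeff_toPoly_mem _ _ _, fun g hg => ?_⟩
  obtain ⟨-, h2, h3⟩ := (mem_hook_iff F m g).1 hg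
  obtain ⟨l, -, hl⟩ := toPoly_linForm (h3.unipotent_iff.1 h2 (yIdx 0))
  have h := toPoly_map (yIdx 0) (act (g : Matrix (Fin (2 * m)) (Fin (2 * m)) F))
    (fun j hj => act_hook_mem_Q hg hj) f
  rw [hf g hg, act_X_eq_linForm, hl] at h
  have h4 := congrArg Polynomial.leadingCoeff h
  rw [Polynomial.leadingCoeff_comp (by rw [Polynomial.natDegree_X_add_C]; exact one_ne_zero),
    Polynomial.leadingCoeff_X_add_C, one_pow, mul_one,
    Polynomial.leadingCoeff_map_of_injective
      (f := (act (g : Matrix (Fin (2 * m)) (Fin (2 * m)) F) : S F m →+* S F m))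
      (act_injective g)] at h4
  exact h4.symm

theorem exists_pow_mul_eq_comb (hF : Odd (Fintype.card F)) {f : S F m}
    (hf : f ∈ invariants (hook F m)) : ∃ K β, X (xIdx 0) ^ K * f = comb β := by
  induction hn : degY f using Nat.strong_induction_on generalizing f with
  | _ n ih =>
  by_cases hf0 : f = 0
  · exact ⟨0, 0, by simp [hf0, comb]⟩
  set q := Fintype.card F with hq
  set d := 2 * m - 2 with hd
  have hqd : 0 < q ^ d := pow_pos Fintype.card_pos _
  obtain ⟨c, hcQ, hc⟩ := mem_QH_iff.1 (leadingCoeff_mem_QH hf)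
  obtain ⟨e, he⟩ := exists_blockDegree (Nat.mod_lt n hqd)
  obtain ⟨s, hs⟩ := leadingCoeff_blockMonomial e
  -- The quotient of n by q^(2m-2) is the exponent of N(y₁), and the digits of the remainder select
  -- the block monomial. After multiplication of `f` by x₁^s the leading terms agree.
  set a : S F m := c * X (yIdx 0) ^ (n / q ^ d) with ha
  have hta : toPoly (yIdx 0) (theta a)
      = Polynomial.C (base c) * toPoly (yIdx 0) (normY F m) ^ (n / q ^ d) := by
    rw [ha, map_mul, map_pow, theta_X_yIdx, theta_of_mem_Q hcQ, map_mul, map_pow,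
      toPoly_of_mem (base_mem_Q hcQ)]
  have hlc0 : base c ≠ 0 := by
    rw [← hc]
    exact Polynomial.leadingCoeff_ne_zero.2 (toPoly_ne_zero hf0)
  have hu : toPoly (yIdx 0) (theta a * blockMonomial F m e) ≠ 0 := by
    rw [map_mul, hta]
    exact mul_ne_zero (mul_ne_zero (Polynomial.C_ne_zero.2 hlc0)
      (pow_ne_zero _ (toPoly_normY_monic hF).ne_zero)) (toPoly_ne_zero (blockMonomial_ne_zero e))
  have hudeg : (toPoly (yIdx 0) (theta a * blockMonomial F m e)).natDegree = n := by
    rw [map_mul] at hu ⊢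
    rw [Polynomial.natDegree_mul (left_ne_zero_of_mul hu) (right_ne_zero_of_mul hu), hta,
      Polynomial.natDegree_C_mul hlc0, Polynomial.natDegree_pow, natDegree_toPoly_normY hF]
    have := degY_blockMonomial (m := m) e
    rw [degY] at this
    rw [this, he]
    exact Nat.div_add_mod' n _
  have hulc : (toPoly (yIdx 0) (theta a * blockMonomial F m e)).leadingCoeff
      = base c * X (xIdx 0) ^ s := by
    rw [map_mul, Polynomial.leadingCoeff_mul, hs, hta, Polynomial.leadingCoeff_mul,
      Polynomial.leadingCoeff_C, Polynomial.leadingCoeff_pow, toPoly_normY_monic hF, one_pow,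
      mul_one]
  have hX : (X (xIdx 0) ^ s : S F m) ∈ Q F m := pow_mem (X_mem_freeOf (yIdx_ne_xIdx 0 0).symm) _
  have hX0 : (X (xIdx 0) ^ s : S F m) ≠ 0 := pow_ne_zero _ (X_ne_zero _)
  have hfX : toPoly (yIdx 0) (X (xIdx 0) ^ s * f)
      = Polynomial.C (X (xIdx 0) ^ s) * toPoly (yIdx 0) f := by
    rw [map_mul, toPoly_of_mem hX]
  set f1 := X (xIdx 0) ^ s * f - theta a * blockMonomial F m e with hf1
  have hXinv : (X (xIdx 0) : S F m) ∈ invariants (hook F m) := fun g hg => act_hook_X_last hg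
  have hf1inv : f1 ∈ invariants (hook F m) := sub_mem (mul_mem (pow_mem hXinv s) hf)
    (mul_mem (theta_mem_invariants hF a) (blockMonomial_mem_invariants e))
  have key : ∃ K β, X (xIdx 0) ^ K * f1 = comb β := by
    by_cases h0 : f1 = 0
    · exact ⟨0, 0, by simp [h0, comb]⟩
    refine ih (degY f1) ?_ hf1inv rfl
    have hdl : (toPoly (yIdx 0) (X (xIdx 0) ^ s * f)).natDegree = n := by
      rw [hfX, Polynomial.natDegree_C_mul hX0]
      exact hn
    have h1 : (toPoly (yIdx 0) f1).degree < (toPoly (yIdx 0) (X (xIdx 0) ^ s * f)).degree := by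
      rw [hf1, map_sub]
      refine Polynomial.degree_sub_lt_left ?_ (toPoly_ne_zero (mul_ne_zero hX0 hf0)) ?_
      · rw [Polynomial.degree_eq_natDegree (toPoly_ne_zero (mul_ne_zero hX0 hf0)),
          Polynomial.degree_eq_natDegree hu, hdl, hudeg]
      · rw [hulc, hfX, Polynomial.leadingCoeff_mul, Polynomial.leadingCoeff_C, hc]
        exact mul_comm _ _
    rw [← hdl]
    exact Polynomial.natDegree_lt_natDegree (toPoly_ne_zero h0) h1
  obtain ⟨K, β, hβ⟩ := key
  refine ⟨K + s, β + Pi.single e (X (xIdx 0) ^ K * a), ?_⟩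
  rw [comb_add, comb_single, ← hβ, map_mul, map_pow, theta_X_last, hf1, pow_add]
  ring

/-- The factors x₁ are cancelled one at a time: x₁ divides the combination, hence all its
coefficients. -/
theorem exists_eq_comb (hF : Odd (Fintype.card F)) {f : S F m}
    (hf : f ∈ invariants (hook F m)) : ∃ β, f = comb β := by
  obtain ⟨K, β, h⟩ := exists_pow_mul_eq_comb hF hf
  induction K generalizing β with
  | zero => exact ⟨β, by simpa using h⟩
  | succ K ih =>
    obtain ⟨γ, -, hγ⟩ := exists_smul_of_X_dvd_comb hF (β := β)
      (h ▸ (dvd_pow_self _ K.succ_ne_zero).mul_right f)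
    refine ih γ (mul_left_cancel₀ (X_ne_zero (xIdx 0)) ?_)
    rw [← hγ, ← h, pow_succ']
    ring

end Invariants

end

/-! ### The algebra A: invariants, basis, prime element, generators -/

section

variable {F : Type*} [Field F] [Fintype F] {m : ℕ} [NeZero m]

theorem QHN_eq_range : QHN F m = (theta : S F m →ₐ[F] S F m).range := by
  apply le_antisymm
  · refine Algebra.adjoin_le ?_
    rintro f (hf | rfl)
    · obtain ⟨p, hp, rfl⟩ := mem_QH_iff.1 hf
      exact ⟨p, theta_of_mem_Q hp⟩
    · exact ⟨_, theta_X_yIdx⟩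
  · rintro _ ⟨f, rfl⟩
    change theta f ∈ QHN F m
    induction f using MvPolynomial.induction_on with
    | C a => rw [← algebraMap_eq, AlgHom.commutes]; exact Subalgebra.algebraMap_mem _ _
    | add f g hf hg => rw [map_add]; exact add_mem hf hg
    | mul_X f j hf =>
      rw [map_mul]
      refine mul_mem hf (Algebra.subset_adjoin ?_)
      by_cases hj : j = yIdx 0
      · rw [hj, theta_X_yIdx]
        exact .inr rfl
      · rw [theta_X_ne hj]
        exact .inl (base_mem_QH (X_mem_freeOf hj))

theorem theta_mem_QHN (f : S F m) : theta f ∈ QHN F m := by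
  rw [QHN_eq_range]
  exact ⟨f, rfl⟩

theorem QHN_le_A : QHN F m ≤ A F m := Algebra.adjoin_mono Set.subset_union_left

theorem xi_mem_A (j : Fin (2 * m - 2)) : xi F m j ∈ A F m :=
  Algebra.subset_adjoin (.inr ⟨j, j.2, rfl⟩)

theorem comb_mem_A (β : (Fin (2 * m - 2) → Fin (Fintype.card F)) → S F m) :
    comb β ∈ A F m :=
  sum_mem fun _ _ => mul_mem (QHN_le_A (theta_mem_QHN _))
    (prod_mem fun j _ => pow_mem (xi_mem_A j) _)

theorem invariants_hook_eq (hF : Odd (Fintype.card F)) : invariants (hook F m) = A F m := by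
  apply le_antisymm
  · intro f hf
    obtain ⟨β, rfl⟩ := exists_eq_comb hF hf
    exact comb_mem_A β
  · refine Algebra.adjoin_le ?_
    rintro f ((hf | rfl) | ⟨j, -, rfl⟩)
    · exact hf.2
    · exact normY_mem_invariants hF
    · exact xi_mem_invariants j

theorem sum_smul_eq_comb (c : (Fin (2 * m - 2) → Fin (Fintype.card F)) → QHN F m) :
    ∃ β, (∑ e, c e • blockMonomial F m e = comb β) ∧ ∀ e, (c e : S F m) = theta (β e) := by
  have h (e) : ∃ f, theta f = (c e : S F m) :=
     QHN_eq_range.le (c e).2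
  choose β hβ using h
  refine ⟨β, Finset.sum_congr rfl fun e _ => ?_, fun e => (hβ e).symm⟩
  rw [hβ]
  rfl

theorem linearIndependent_blockMonomial (hF : Odd (Fintype.card F)) :
    LinearIndependent (QHN F m) (blockMonomial F m) := by
  refine Fintype.linearIndependent_iff.2 fun c hc e => ?_
  obtain ⟨β, h1, h2⟩ := sum_smul_eq_comb c
  refine Subtype.ext ?_
  rw [h2, eq_zero_of_comb_eq_zero hF (h1.symm.trans hc), Pi.zero_apply, map_zero]
  rfl

theorem span_blockMonomial (hF : Odd (Fintype.card F)) :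
    (Submodule.span (QHN F m) (Set.range (blockMonomial F m)) : Set (S F m)) = A F m := by
  ext f
  rw [SetLike.mem_coe, Submodule.mem_span_range_iff_exists_fun]
  constructor
  · rintro ⟨c, rfl⟩
    obtain ⟨β, h1, -⟩ := sum_smul_eq_comb c
    rw [h1]
    exact comb_mem_A β
  · intro hf
    rw [SetLike.mem_coe, ← invariants_hook_eq hF] at hf
    obtain ⟨β, rfl⟩ := exists_eq_comb hF hf
    exact ⟨fun e => ⟨theta (β e), theta_mem_QHN _⟩, rfl⟩

theorem mem_A_of_X_mul_mem (hF : Odd (Fintype.card F)) {f : S F m}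
    (h : X (xIdx 0) * f ∈ A F m) : f ∈ A F m := by
  rw [← invariants_hook_eq hF] at h ⊢
  intro g hg
  have h1 := h g hg
  rw [map_mul, act_hook_X_last hg] at h1
  exact mul_left_cancel₀ (X_ne_zero _) h1

theorem x_mem_A : X (xIdx 0) ∈ A F m := by
  rw [← theta_X_last]
  exact QHN_le_A (theta_mem_QHN _)

/-- By `mem_A_of_X_mul_mem` an element of `A` divisible by x₁ in the polynomial ring is divisible by
x₁ in `A`, so primality descends. -/
theorem prime_x (hF : Odd (Fintype.card F)) :
    ∃ h : x F 0 ∈ A F m, Prime (⟨x F 0, h⟩ : A F m) := by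
  have hx : x F 0 ∈ A F m := x_mem_A
  have hp : Prime (X (xIdx 0) : S F m) := X_prime
  have hdvd {a : A F m} (h : X (xIdx 0) ∣ (a : S F m)) : (⟨x F 0, hx⟩ : A F m) ∣ a := by
    obtain ⟨u, hu⟩ := h
    have hA : u ∈ A F m := mem_A_of_X_mul_mem hF (hu ▸ a.2)
    exact ⟨⟨u, hA⟩, Subtype.ext hu⟩
  refine ⟨hx, fun h => X_ne_zero (R := F) (xIdx (0 : Fin m)) (congrArg Subtype.val h),
    fun h => hp.not_isUnit ?_, fun a b hab => ?_⟩
  · exact h.map (A F m).val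
  · obtain ⟨u, hu⟩ := hab
    rcases hp.dvd_or_dvd ⟨(u : S F m), congrArg Subtype.val hu⟩ with h | h
    · exact .inl (hdvd h)
    · exact .inr (hdvd h)

theorem gen_mem_A (g : Gen m) : gen F m g ∈ A F m := by
  cases g with
  | x₁ => exact x_mem_A
  | Y i hi =>
    refine QHN_le_A (Algebra.subset_adjoin (.inl ?_))
    rw [gen, ← base_X_yIdx hi]
    exact base_mem_QH (X_mem_freeOf (mem_inner.1 (yIdx_mem_inner hi)).1)
  | X i hi =>
    refine QHN_le_A (Algebra.subset_adjoin (.inl ?_))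
    rw [gen, ← base_X_xIdx hi]
    exact base_mem_QH (X_mem_freeOf (mem_inner.1 (xIdx_mem_inner hi)).1)
  | N => exact QHN_le_A (Algebra.subset_adjoin (.inr rfl))
  | xi j => exact xi_mem_A j

theorem adjoin_range_gen : Algebra.adjoin F (Set.range (gen F m)) = A F m := by
  apply le_antisymm
  · refine Algebra.adjoin_le ?_
    rintro _ ⟨g, rfl⟩
    exact gen_mem_A g
  · refine Algebra.adjoin_le ?_
    rintro f ((hf | rfl) | ⟨j, hj, rfl⟩)
    · rw [SetLike.mem_coe, QH_eq_adjoin] at hf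
      refine Algebra.adjoin_mono ?_ hf
      rintro f (rfl | ⟨i, hi, rfl | rfl⟩)
      · exact ⟨.x₁, rfl⟩
      · exact ⟨.Y i hi, rfl⟩
      · exact ⟨.X i hi, rfl⟩
    · exact Algebra.subset_adjoin ⟨.N, rfl⟩
    · exact Algebra.subset_adjoin ⟨.xi ⟨j, hj⟩, rfl⟩

end

/-! ### Weight filtration and leading monomials -/

section Below

variable {k σ : Type*} [Field k]

/-- The polynomials all of whose monomials have weight less than `n`. -/
def below (k : Type*) [Field k] (v : σ → ℕ) (n : ℕ) : Submodule k (MvPolynomial σ k) :=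
  restrictSupport k {s | Finsupp.weight v s < n}

theorem mem_below {v : σ → ℕ} {n : ℕ} {f : MvPolynomial σ k} :
    f ∈ below k v n ↔ ∀ s ∈ f.support, Finsupp.weight v s < n := mem_restrictSupport_iff k

theorem below_mono {v : σ → ℕ} {a b : ℕ} (h : a ≤ b) : below k v a ≤ below k v b :=
  restrictSupport_mono k fun _ hs => lt_of_lt_of_le hs h

theorem monomial_mem_below {v : σ → ℕ} {n : ℕ} {s : σ →₀ ℕ} (h : Finsupp.weight v s < n) (c : k) :
    monomial s c ∈ below k v n := (monomial_mem_restrictSupport k).2 (.inl h)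

open scoped Pointwise in
theorem mul_mem_below {v : σ → ℕ} {a b : ℕ} {f g : MvPolynomial σ k}
    (hf : f ∈ below k v a) (hg : g ∈ below k v (b + 1)) : f * g ∈ below k v (a + b) := by
  have h := Submodule.mul_mem_mul hf hg
  rw [below, below, ← restrictSupport_add] at h
  refine restrictSupport_mono k ?_ h
  rintro _ ⟨s, hs, t, ht, rfl⟩
  simp only [Set.mem_ofPred_eq, map_add] at *
  omega

/-- The polynomial `f` is the sum of the monomial `s` and of monomials of smaller weight. -/
def IsLead (v : σ → ℕ) (f : MvPolynomial σ k) (s : σ →₀ ℕ) : Prop :=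
  f - monomial s 1 ∈ below k v (Finsupp.weight v s)

theorem IsLead.monomial (v : σ → ℕ) (s : σ →₀ ℕ) :
    IsLead v (monomial s 1 : MvPolynomial σ k) s := by
  rw [IsLead, sub_self]
  exact zero_mem _

theorem IsLead.mem_below {v : σ → ℕ} {f : MvPolynomial σ k} {s : σ →₀ ℕ} (h : IsLead v f s) :
    f ∈ below k v (Finsupp.weight v s + 1) := by
  rw [← sub_add_cancel f (MvPolynomial.monomial s 1)]
  exact add_mem (below_mono (Nat.le_succ _) h) (monomial_mem_below (Nat.lt_succ_self _) _)

theorem IsLead.mul {v : σ → ℕ} {f g : MvPolynomial σ k} {s t : σ →₀ ℕ} (hf : IsLead v f s)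
    (hg : IsLead v g t) : IsLead v (f * g) (s + t) := by
  have h : f * g - MvPolynomial.monomial (s + t) 1
      = (f - MvPolynomial.monomial s 1) * g
        + (g - MvPolynomial.monomial t 1) * MvPolynomial.monomial s 1 := by
    rw [← mul_one (1 : k), ← monomial_mul, mul_one]
    ring
  rw [IsLead, h, map_add]
  refine add_mem (mul_mem_below hf hg.mem_below) ?_
  rw [add_comm]
  exact mul_mem_below hg (IsLead.monomial v s).mem_below

theorem IsLead.one (v : σ → ℕ) : IsLead v (1 : MvPolynomial σ k) 0 := IsLead.monomial v 0

theorem IsLead.pow {v : σ → ℕ} {f : MvPolynomial σ k} {s : σ →₀ ℕ} (hf : IsLead v f s) (n : ℕ) :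
    IsLead v (f ^ n) (n • s) := by
  induction n with
  | zero => rw [pow_zero, zero_smul]; exact IsLead.one v
  | succ n ih => rw [pow_succ, succ_nsmul]; exact ih.mul hf

theorem IsLead.prod {ι : Type*} {v : σ → ℕ} (J : Finset ι) {f : ι → MvPolynomial σ k}
    {s : ι → σ →₀ ℕ} (h : ∀ j, IsLead v (f j) (s j)) :
    IsLead v (∏ j ∈ J, f j) (∑ j ∈ J, s j) := by
  classical
  induction J using Finset.induction_on with
  | empty => exact IsLead.one v
  | insert a J ha ih =>
    rw [Finset.prod_insert ha, Finset.sum_insert ha]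
    exact (h a).mul ih

theorem map_sub_self_mem_below {v : σ → ℕ} {L : MvPolynomial σ k →ₗ[k] MvPolynomial σ k}
    (hL : ∀ s, IsLead v (L (monomial s 1)) s) {n : ℕ} {f : MvPolynomial σ k}
    (hf : f ∈ below k v (n + 1)) : L f - f ∈ below k v n := by
  have h : L f - f = ∑ s ∈ f.support, coeff s f • (L (monomial s 1) - monomial s 1) := by
    conv_lhs => rw [f.as_sum, map_sum, ← Finset.sum_sub_distrib]
    refine Finset.sum_congr rfl fun s _ => ?_
    have h1 : monomial s (coeff s f) = coeff s f • (monomial s 1 : MvPolynomial σ k) := by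
      rw [smul_monomial, smul_eq_mul, mul_one]
    rw [h1, map_smul, smul_sub]
  rw [h]
  refine sum_mem fun s hs => Submodule.smul_mem _ _ (below_mono ?_ (hL s))
  exact Nat.lt_succ_iff.1 (OrthHook.mem_below.1 hf s hs)

theorem exists_mem_below (v : σ → ℕ) (f : MvPolynomial σ k) : ∃ n, f ∈ below k v n :=
  ⟨f.support.sup (Finsupp.weight v) + 1, mem_below.2 fun _ hs =>
    Nat.lt_succ_of_le (Finset.le_sup (f := Finsupp.weight v) hs)⟩

theorem below_zero (v : σ → ℕ) : below k v 0 = ⊥ := by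
  refine (Submodule.eq_bot_iff _).2 fun f hf => ?_
  rw [← support_eq_empty, Finset.eq_empty_iff_forall_notMem]
  exact fun s hs => Nat.not_lt_zero _ (mem_below.1 hf s hs)

/-- `L` is the identity plus a map that lowers weights, so induction on a weight bound gives both
claims, ending at `below_zero`. No finiteness is needed, so variables of weight zero are allowed. -/
theorem bijective_of_isLead {v : σ → ℕ} {L : MvPolynomial σ k →ₗ[k] MvPolynomial σ k}
    (hL : ∀ s, IsLead v (L (monomial s 1)) s) : Function.Bijective L := by
  constructor
  · rw [injective_iff_map_eq_zero]
    intro f hf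
    obtain ⟨n, hn⟩ := exists_mem_below v f
    induction n with
    | zero => rwa [below_zero, Submodule.mem_bot] at hn
    | succ n ih =>
      refine ih ?_
      have h := map_sub_self_mem_below hL hn
      rw [hf, zero_sub] at h
      exact neg_mem_iff.1 h
  · intro f
    obtain ⟨n, hn⟩ := exists_mem_below v f
    induction n generalizing f with
    | zero =>
      rw [below_zero, Submodule.mem_bot] at hn
      exact ⟨0, by rw [hn, map_zero]⟩
    | succ n ih =>
      obtain ⟨g, hg⟩ := ih _ (map_sub_self_mem_below hL hn)
      exact ⟨f - g, by rw [map_sub, hg, sub_sub_cancel]⟩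

end Below

/-! ### Powers of distinct variables form a regular sequence -/

section MonomialSequence

variable {k σ : Type*} [Field k] {d : ℕ}

theorem mem_ofList_ofFn {R : Type*} [CommRing R] (r : Fin d → R) (j : Fin d) :
    r j ∈ Ideal.ofList (List.ofFn r) :=
  Ideal.subset_span ((List.mem_ofFn' r (r j)).2 ⟨j, rfl⟩)

theorem ofList_take_powers (T : Fin d → σ) (q i : ℕ) :
    (Ideal.ofList ((List.ofFn fun j => (X (T j) : MvPolynomial σ k) ^ q).take i)) =
      Ideal.span ((fun s => monomial s (1 : k)) ''
        {s | ∃ j : Fin d, (j : ℕ) < i ∧ s = Finsupp.single (T j) q}) := by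
  refine congrArg Ideal.span (Set.ext fun f => ?_)
  simp only [Set.mem_ofPred_eq, Set.mem_image]
  constructor
  · intro h
    obtain ⟨n, hn, rfl⟩ := List.mem_iff_getElem.1 h
    rw [List.length_take, List.length_ofFn, lt_min_iff] at hn
    refine ⟨_, ⟨⟨n, hn.2⟩, hn.1, rfl⟩, ?_⟩
    rw [List.getElem_take, List.getElem_ofFn, X_pow_eq_monomial]
  · rintro ⟨_, ⟨j, hj, rfl⟩, rfl⟩
    refine List.mem_iff_getElem.2 ⟨j, ?_, ?_⟩
    · rw [List.length_take, List.length_ofFn]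
      exact lt_min hj j.2
    · rw [List.getElem_take, List.getElem_ofFn, X_pow_eq_monomial]

/-- Membership in a monomial ideal is tested on exponents, and multiplying by a power of a new
variable does not change divisibility by powers of the earlier ones. -/
theorem isRegular_powers {T : Fin d → σ} (hT : Function.Injective T) {q : ℕ} (hq : 0 < q) :
    RingTheory.Sequence.IsRegular (MvPolynomial σ k)
      (List.ofFn fun j => (X (T j) : MvPolynomial σ k) ^ q) := by
  refine ⟨⟨fun i hi => ?_⟩, ?_⟩
  · rw [isSMulRegular_quotient_iff_mem_of_smul_mem]
    intro f hf
    rw [Ideal.smul_top_eq_map, Submodule.restrictScalars_mem, Algebra.algebraMap_self, Ideal.map_id,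
      ofList_take_powers, mem_ideal_span_monomial_image] at *
    intro s hs
    rw [List.length_ofFn] at hi
    rw [List.getElem_ofFn, X_pow_eq_monomial, smul_eq_mul] at hf
    obtain ⟨_, ⟨j, hj, rfl⟩, h⟩ := hf (Finsupp.single (T ⟨i, hi⟩) q + s) (by
      rw [mem_support_iff, coeff_monomial_mul, one_mul]
      exact mem_support_iff.1 hs)
    refine ⟨_, ⟨j, hj, rfl⟩, ?_⟩
    rw [Finsupp.single_le_iff] at h ⊢
    rwa [Finsupp.add_apply, Finsupp.single_eq_of_ne, zero_add] at h
    intro h1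
    rw [hT h1] at hj
    exact lt_irrefl _ hj
  · rw [Ideal.smul_top_eq_map, Algebra.algebraMap_self, Ideal.map_id]
    intro h
    have h1 : (1 : MvPolynomial σ k) ∈
        (Ideal.ofList (List.ofFn fun j => (X (T j) : MvPolynomial σ k) ^ q)) := by
      have : (1 : MvPolynomial σ k) ∈ (⊤ : Submodule (MvPolynomial σ k) (MvPolynomial σ k)) :=
        Submodule.mem_top
      rw [h] at this
      exact this
    rw [← List.take_of_length_le (l := List.ofFn _) (i := d) (List.length_ofFn).le,
      ofList_take_powers, mem_ideal_span_monomial_image] at h1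
    obtain ⟨_, ⟨j, -, rfl⟩, h⟩ := h1 0 (by simp)
    rw [Finsupp.single_le_iff] at h
    simp at h
    omega

end MonomialSequence

/-! ### Sequences with leading terms that are powers of variables -/

section Triangular

variable {k σ : Type*} [Field k] {d : ℕ} (T : Fin d → σ) (q : ℕ)

/-- The largest product of `q`-th powers of the variables `T j` that divides a monomial. -/
def powerPart (s : σ →₀ ℕ) : σ →₀ ℕ := ∑ j, (s (T j) / q) • Finsupp.single (T j) q

variable {T}

theorem powerPart_apply (hT : Function.Injective T) (s : σ →₀ ℕ) (j : Fin d) :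
    powerPart T q s (T j) = s (T j) / q * q := by
  rw [powerPart, Finsupp.finsetSum_apply, Finset.sum_eq_single j]
  · simp
  · intro i _ hi
    rw [Finsupp.smul_apply, Finsupp.single_eq_of_ne (fun h => hi (hT h).symm), smul_zero]
  · simp

theorem powerPart_apply_of_ne (s : σ →₀ ℕ) {i : σ} (hi : ∀ j, T j ≠ i) :
    powerPart T q s i = 0 := by
  rw [powerPart, Finsupp.finsetSum_apply]
  refine Finset.sum_eq_zero fun j _ => ?_
  rw [Finsupp.smul_apply, Finsupp.single_eq_of_ne (hi j).symm, smul_zero]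

theorem powerPart_le (hT : Function.Injective T) (s : σ →₀ ℕ) : powerPart T q s ≤ s := by
  intro i
  by_cases hi : ∃ j, T j = i
  · obtain ⟨j, rfl⟩ := hi
    rw [powerPart_apply q hT]
    exact Nat.div_mul_le_self _ _
  · rw [powerPart_apply_of_ne q s (not_exists.1 hi)]
    exact Nat.zero_le _

variable {q}

theorem single_add_div (hT : Function.Injective T) (hq : 0 < q) (s : σ →₀ ℕ) (i j : Fin d) :
    (Finsupp.single (T j) q + s : σ →₀ ℕ) (T i) / q = (if i = j then 1 else 0) + s (T i) / q := by
  rw [Finsupp.add_apply]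
  split_ifs with h
  · rw [h, Finsupp.single_eq_same, Nat.add_div_left _ hq, add_comm]
  · rw [Finsupp.single_eq_of_ne (fun h' => h (hT h')), zero_add, zero_add]

theorem powerPart_single_add (hT : Function.Injective T) (hq : 0 < q) (s : σ →₀ ℕ) (j : Fin d) :
    powerPart T q (Finsupp.single (T j) q + s) = Finsupp.single (T j) q + powerPart T q s := by
  simp only [powerPart, single_add_div hT hq, add_smul, Finset.sum_add_distrib, ite_smul, one_smul,
    zero_smul, Finset.sum_ite_eq', Finset.mem_univ, if_true]

variable (T q) in
/-- The linear map that replaces the `q`-th powers of the variables `T j` by the polynomials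
`r j`. -/
def replacePowers (r : Fin d → MvPolynomial σ k) : MvPolynomial σ k →ₗ[k] MvPolynomial σ k :=
  (basisMonomials σ k).constr k fun s =>
    (∏ j, r j ^ (s (T j) / q)) * monomial (s - powerPart T q s) 1

theorem replacePowers_monomial (r : Fin d → MvPolynomial σ k) (s : σ →₀ ℕ) :
    replacePowers T q r (monomial s 1)
      = (∏ j, r j ^ (s (T j) / q)) * monomial (s - powerPart T q s) 1 := by
  have := (basisMonomials σ k).constr_basis k (fun s : σ →₀ ℕ =>
    (∏ j, r j ^ (s (T j) / q)) * monomial (s - powerPart T q s) 1) s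
  rwa [coe_basisMonomials] at this

/-- An extra factor `X (T j) ^ q` raises the quotient of the exponent by one and leaves the
remainder alone. The map need not be multiplicative, but this much is enough to transport
regularity. -/
theorem replacePowers_mul (hT : Function.Injective T) (hq : 0 < q) (r : Fin d → MvPolynomial σ k)
    (j : Fin d) (f : MvPolynomial σ k) :
    replacePowers T q r (X (T j) ^ q * f) = r j * replacePowers T q r f := by
  suffices h : replacePowers T q r ∘ₗ LinearMap.mulLeft k (X (T j) ^ q)
      = LinearMap.mulLeft k (r j) ∘ₗ replacePowers T q r from LinearMap.congr_fun h f
  refine (basisMonomials σ k).ext fun s => ?_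
  rw [coe_basisMonomials, LinearMap.comp_apply, LinearMap.comp_apply, LinearMap.mulLeft_apply,
    LinearMap.mulLeft_apply, X_pow_eq_monomial, monomial_mul, one_mul, replacePowers_monomial,
    replacePowers_monomial, powerPart_single_add hT hq, add_tsub_add_eq_tsub_left]
  simp only [single_add_div hT hq, pow_add, Finset.prod_mul_distrib]
  rw [Finset.prod_eq_single j (fun i _ hi => by rw [if_neg hi, pow_zero])
    (fun h => absurd (Finset.mem_univ j) h), if_pos rfl, pow_one, mul_assoc]

theorem isLead_replacePowers (hT : Function.Injective T) {v : σ → ℕ}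
    {r : Fin d → MvPolynomial σ k} (hr : ∀ j, IsLead v (r j) (Finsupp.single (T j) q))
    (s : σ →₀ ℕ) : IsLead v (replacePowers T q r (monomial s 1)) s := by
  have h := (IsLead.prod Finset.univ fun j => (hr j).pow (s (T j) / q)).mul
    (IsLead.monomial v (s - powerPart T q s))
  rw [replacePowers_monomial]
  rwa [← powerPart, add_tsub_cancel_of_le (powerPart_le q hT s)] at h

theorem isRegular_of_isLead (hT : Function.Injective T) (hq : 0 < q) {v : σ → ℕ}
    {r : Fin d → MvPolynomial σ k} (hr : ∀ j, IsLead v (r j) (Finsupp.single (T j) q)) :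
    RingTheory.Sequence.IsRegular (MvPolynomial σ k) (List.ofFn r) := by
  refine (AddEquiv.isRegular_congr (e := (LinearEquiv.ofBijective (replacePowers T q r)
    (bijective_of_isLead (isLead_replacePowers hT hr))).toAddEquiv) ?_).1 (isRegular_powers hT hq)
  refine List.forall₂_iff_get.2 ⟨by rw [List.length_ofFn, List.length_ofFn], ?_⟩
  intro i h1 h2 f
  rw [List.get_ofFn, List.get_ofFn]
  exact replacePowers_mul hT hq r _ f

/-- Every polynomial is an image under `replacePowers`, which fixes the reduced monomials and sends
all other monomials into the ideal. -/
theorem exists_reduced (hT : Function.Injective T) (hq : 0 < q) {v : σ → ℕ}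
    {r : Fin d → MvPolynomial σ k} (hr : ∀ j, IsLead v (r j) (Finsupp.single (T j) q))
    (f : MvPolynomial σ k) : ∃ g : MvPolynomial σ k, (∀ s ∈ g.support, ∀ j, s (T j) < q) ∧
      f - g ∈ Ideal.ofList (List.ofFn r) := by
  obtain ⟨f, rfl⟩ := (bijective_of_isLead (isLead_replacePowers hT hr)).2 f
  classical
  induction f using MvPolynomial.induction_on' with
  | add f₁ f₂ h₁ h₂ =>
    obtain ⟨g₁, hg₁, h₁⟩ := h₁
    obtain ⟨g₂, hg₂, h₂⟩ := h₂
    refine ⟨g₁ + g₂, fun s hs => ?_, ?_⟩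
    · rcases Finset.mem_union.1 (support_add hs) with h | h
      exacts [hg₁ s h, hg₂ s h]
    · rw [map_add, add_sub_add_comm]
      exact add_mem h₁ h₂
  | monomial s c =>
    have hc : (monomial s c : MvPolynomial σ k) = c • monomial s 1 := by
      rw [smul_monomial, smul_eq_mul, mul_one]
    by_cases h : ∀ j, s (T j) < q
    · refine ⟨monomial s c, fun t ht => ?_, ?_⟩
      · rwa [Finset.mem_singleton.1 (support_monomial_subset ht)]
      · have h0 : powerPart T q s = 0 := Finset.sum_eq_zero fun j _ => by
          rw [Nat.div_eq_of_lt (h j), zero_smul]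
        rw [hc, map_smul, replacePowers_monomial, h0, tsub_zero, Finset.prod_eq_one fun j _ => by
          rw [Nat.div_eq_of_lt (h j), pow_zero], one_mul, sub_self]
        exact zero_mem _
    · push Not at h
      obtain ⟨j, hj⟩ := h
      refine ⟨0, by simp, ?_⟩
      obtain ⟨t, rfl⟩ := exists_add_of_le (Finsupp.single_le_iff.2 hj)
      have h1 : (monomial (Finsupp.single (T j) q + t) c : MvPolynomial σ k)
          = X (T j) ^ q * monomial t c := by rw [X_pow_eq_monomial, monomial_mul, one_mul]
      rw [sub_zero, h1, replacePowers_mul hT hq]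
      exact Ideal.mul_mem_right _ _ (mem_ofList_ofFn r j)

end Triangular

/-! ### Coefficients and homogeneous components -/

section Coefficients

variable {F σ : Type*} [Field F] [DecidableEq σ]

theorem toPoly_monomial (i : σ) (s : σ →₀ ℕ) (c : F) : toPoly i (monomial s c) =
    Polynomial.C (monomial (s.erase i) c) * Polynomial.X ^ s i := by
  have h : (monomial s c : MvPolynomial σ F) = monomial (s.erase i) c * X i ^ s i := by
    rw [X_pow_eq_monomial, monomial_mul, mul_one, Finsupp.erase_add_single]
  have hm : (monomial (s.erase i) c : MvPolynomial σ F) ∈ freeOf F i := by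
    rw [mem_supported]
    intro j hj
    obtain ⟨t, ht, hjt⟩ := (mem_vars_iff_mem_support j).1 (Finset.mem_coe.1 hj)
    rw [Finset.mem_singleton.1 (support_monomial_subset ht)] at hjt
    exact (Finset.mem_erase.1 ((Finsupp.support_erase (f := s)) ▸ hjt)).1
  rw [h, map_mul, map_pow, toPoly_X_self, toPoly_of_mem hm]

theorem coeff_coeff_toPoly (i : σ) (u : σ →₀ ℕ) (f : MvPolynomial σ F) :
    coeff (u.erase i) ((toPoly i f).coeff (u i)) = coeff u f := by
  induction f using MvPolynomial.induction_on' with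
  | add f g hf hg => rw [map_add, Polynomial.coeff_add, coeff_add, hf, hg, coeff_add]
  | monomial s c =>
    rw [toPoly_monomial, Polynomial.coeff_C_mul_X_pow, coeff_monomial]
    by_cases h : s = u
    · rw [h, if_pos rfl, if_pos rfl, coeff_monomial, if_pos rfl]
    · rw [if_neg h]
      split_ifs with h1
      · rw [coeff_monomial, if_neg]
        intro h2
        refine h ?_
        rw [← Finsupp.erase_add_single i s, h2, ← h1, Finsupp.erase_add_single]
      · exact coeff_zero _

theorem le_natDegree_toPoly (i : σ) {u : σ →₀ ℕ} {f : MvPolynomial σ F} (hu : u ∈ f.support) :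
    u i ≤ (toPoly i f).natDegree := by
  refine Polynomial.le_natDegree_of_ne_zero fun h => mem_support_iff.1 hu ?_
  rw [← coeff_coeff_toPoly i, h, coeff_zero]

end Coefficients

section WeightedComponents

variable {k σ ι : Type*} [Field k] {w : ι → ℕ} {g : ι → MvPolynomial σ k}

theorem isHomogeneous_aeval_monomial (hg : ∀ i, (g i).IsHomogeneous (w i)) (s : ι →₀ ℕ) (c : k) :
    (aeval g (monomial s c)).IsHomogeneous (Finsupp.weight w s) := by
  rw [aeval_monomial, algebraMap_eq]
  refine IsHomogeneous.C_mul ?_ c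
  have h : Finsupp.weight w s = ∑ i ∈ s.support, w i * s i := by
    rw [Finsupp.weight_apply, Finsupp.sum]
    exact Finset.sum_congr rfl fun i _ => by rw [smul_eq_mul, mul_comm (s i)]
  rw [h, Finsupp.prod]
  exact IsHomogeneous.prod _ _ _ fun i _ => (hg i).pow _

theorem aeval_weightedHomogeneousComponent (hg : ∀ i, (g i).IsHomogeneous (w i)) (n : ℕ)
    (f : MvPolynomial ι k) :
    aeval g (weightedHomogeneousComponent w n f) = homogeneousComponent n (aeval g f) := by
  induction f using MvPolynomial.induction_on' with
  | add f₁ f₂ h₁ h₂ => simp only [map_add, h₁, h₂]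
  | monomial s c =>
    rw [weightedHomogeneousComponent_of_mem
        ((mem_weightedHomogeneousSubmodule k w _ _).2 (isWeightedHomogeneous_monomial w s c rfl)),
      homogeneousComponent_of_mem
        ((mem_homogeneousSubmodule _ _).2 (isHomogeneous_aeval_monomial hg s c))]
    split_ifs
    · rfl
    · exact map_zero _

end WeightedComponents

/-! ### Digit sums -/

section Digits

/-- Digits are unique, so a product of powers of N(y₁) and the ξ's with y₁-degree q^(j+1) is ξ_(j+1)
or, for the last j, N(y₁). -/
theorem digit_sum_lt {q d j u : ℕ} (hq : 1 < q) (hj : j < d) (e : Fin d → Fin q)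
    (h : u * q ^ d + blockDegree e = q ^ (j + 1)) : ∑ i, (e i : ℕ) < q := by
  rcases Nat.lt_or_ge (j + 1) d with hd | hd
  · have h1 : q ^ (j + 1) < q ^ d := Nat.pow_lt_pow_right hq hd
    have hu : u = 0 := by
      by_contra hu
      have := Nat.le_mul_of_pos_left (q ^ d) (Nat.pos_of_ne_zero hu)
      omega
    rw [hu, zero_mul, zero_add] at h
    have he : e = fun i => if i = ⟨j + 1, hd⟩ then ⟨1, hq⟩ else ⟨0, by omega⟩ := by
      apply blockDegree_injective
      rw [h, blockDegree, Finset.sum_eq_single ⟨j + 1, hd⟩]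
      · simp
      · intro i _ hi
        rw [if_neg hi, zero_mul]
      · simp
    rw [he, Finset.sum_eq_single ⟨j + 1, hd⟩]
    · simpa using hq
    · intro i _ hi
      simp [hi]
    · simp
  · obtain rfl : d = j + 1 := by omega
    have h1 := congrArg (· % q ^ (j + 1)) h
    simp only [Nat.mul_add_mod_self_right, Nat.mod_self, Nat.mod_eq_of_lt (blockDegree_lt e)] at h1
    have he : ∀ i, (e i : ℕ) = 0 := fun i => by
      have := (Finset.sum_eq_zero_iff.1 h1) i (Finset.mem_univ i)
      exact (Nat.mul_eq_zero.1 this).resolve_right (pow_pos (by omega) _).ne'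
    simp only [he, Finset.sum_const_zero]
    omega

theorem digit_sum_le {q d : ℕ} (e : Fin d → Fin q) : ∑ i, (e i : ℕ) ≤ q * d := by
  refine (Finset.sum_le_card_nsmul _ _ q fun i _ => (e i).2.le).trans ?_
  rw [Finset.card_univ, Fintype.card_fin, smul_eq_mul, mul_comm]

end Digits

/-! ### Polynomials in the generators -/

section Labels

variable {m : ℕ} [NeZero m]

/-- The labels of `x₁`, the `Yᵢ`, the `Xᵢ` and `N(y₁)` correspond to the variables of `S_m`. -/
def Gen.toSum : Gen m → Fin (2 * m) ⊕ Fin (2 * m - 2)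
  | .x₁ => .inl (xIdx 0)
  | .Y i _ => .inl (yIdx i)
  | .X i _ => .inl (xIdx i)
  | .N => .inl (yIdx 0)
  | .xi j => .inr j

theorem Gen.toSum_bijective : Function.Bijective (Gen.toSum : Gen m → _) := by
  have hyx (i j : Fin m) : xIdx i ≠ yIdx j := (yIdx_ne_xIdx j i).symm
  constructor
  · intro a b h
    cases a <;> cases b <;>
      simp_all [Gen.toSum, yIdx_injective.eq_iff, xIdx_injective.eq_iff, yIdx_ne_xIdx,
        eq_comm (a := (0 : Fin m))]
  · rintro (i | j)
    · rcases index_cases i with ⟨i, rfl⟩ | ⟨i, rfl⟩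
      · by_cases hi : i = 0
        · exact ⟨.N, by rw [hi]; rfl⟩
        · exact ⟨.Y i hi, rfl⟩
      · by_cases hi : i = 0
        · exact ⟨.x₁, by rw [hi]; rfl⟩
        · exact ⟨.X i hi, rfl⟩
    · exact ⟨.xi j, rfl⟩

/-- The label of the generator that `theta` substitutes for a variable. -/
def genIdx (i : Fin (2 * m)) : Gen m := (Equiv.ofBijective _ Gen.toSum_bijective).symm (.inl i)

theorem toSum_genIdx (i : Fin (2 * m)) : (genIdx i).toSum = .inl i :=
  (Equiv.ofBijective _ Gen.toSum_bijective).apply_symm_apply _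

theorem genIdx_eq {i : Fin (2 * m)} {g : Gen m} (h : g.toSum = .inl i) : genIdx i = g :=
  Gen.toSum_bijective.1 ((toSum_genIdx i).trans h.symm)

theorem genIdx_injective : Function.Injective (genIdx : Fin (2 * m) → Gen m) := fun i j h =>
  Sum.inl_injective (by rw [← toSum_genIdx, h, toSum_genIdx])

theorem genIdx_ne_xi (i : Fin (2 * m)) (j : Fin (2 * m - 2)) : genIdx i ≠ .xi j := fun h => by
  have := toSum_genIdx i
  rw [h] at this
  exact Sum.inr_ne_inl this

theorem gen_cases (g : Gen m) : (∃ i, g = genIdx i) ∨ ∃ j, g = .xi j := by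
  rcases h : g.toSum with i | j
  · exact .inl ⟨i, (genIdx_eq h).symm⟩
  · exact .inr ⟨j, Gen.toSum_bijective.1 h⟩

theorem xi_label_injective : Function.Injective (Gen.xi : Fin (2 * m - 2) → Gen m) := fun _ _ h =>
  Gen.xi.inj h

instance : Finite (Gen m) := Finite.of_injective _ Gen.toSum_bijective.1

theorem gen_genIdx {F : Type*} [Field F] [Fintype F] (i : Fin (2 * m)) :
    gen F m (genIdx i) = theta (X i) := by
  rcases index_cases i with ⟨i, rfl⟩ | ⟨i, rfl⟩
  · by_cases hi : i = 0
    · rw [hi, genIdx_eq (g := .N) rfl, theta_X_yIdx, gen]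
    · rw [genIdx_eq (g := .Y i hi) rfl, theta_X_ne fun h => hi (yIdx_injective h),
        base_X_yIdx hi, gen]
  · by_cases hi : i = 0
    · rw [hi, genIdx_eq (g := .x₁) rfl, theta_X_last, gen, x]
    · rw [genIdx_eq (g := .X i hi) rfl, theta_X_ne (yIdx_ne_xIdx 0 i).symm,
        base_X_xIdx hi, gen]

end Labels

section Lift

variable {F : Type*} [Field F] [Fintype F] {m : ℕ} [NeZero m]

/-- The exponent of a block monomial. -/
def blockExponent {q : ℕ} (e : Fin (2 * m - 2) → Fin q) : Gen m →₀ ℕ :=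
  ∑ j, Finsupp.single (.xi j) (e j : ℕ)

theorem blockExponent_apply_xi {q : ℕ} (e : Fin (2 * m - 2) → Fin q) (j : Fin (2 * m - 2)) :
    blockExponent e (.xi j : Gen m) = e j := by
  rw [blockExponent, Finsupp.finsetSum_apply, Finset.sum_eq_single j]
  · rw [Finsupp.single_eq_same]
  · intro i _ hi
    rw [Finsupp.single_eq_of_ne fun h => hi (xi_label_injective h).symm]
  · simp

theorem blockExponent_apply_genIdx {q : ℕ} (e : Fin (2 * m - 2) → Fin q) (i : Fin (2 * m)) :
    blockExponent e (genIdx i : Gen m) = 0 := by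
  rw [blockExponent, Finsupp.finsetSum_apply]
  exact Finset.sum_eq_zero fun j _ => Finsupp.single_eq_of_ne (genIdx_ne_xi i j)

/-- The combinations of block monomials, as polynomials in the generators. -/
def combLift : ((Fin (2 * m - 2) → Fin (Fintype.card F)) → S F m) →ₗ[F] MvPolynomial (Gen m) F :=
  ∑ e, LinearMap.mulRight F (monomial (blockExponent e) 1) ∘ₗ
    (rename genIdx : S F m →ₐ[F] MvPolynomial (Gen m) F).toLinearMap ∘ₗ LinearMap.proj e

theorem combLift_apply (β : (Fin (2 * m - 2) → Fin (Fintype.card F)) → S F m) :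
    combLift β = ∑ e, rename genIdx (β e) * monomial (blockExponent e) 1 := by
  rw [combLift, LinearMap.sum_apply]
  rfl

theorem aeval_rename_genIdx (f : S F m) : aeval (gen F m) (rename genIdx f) = theta f := by
  have h : (aeval (gen F m)).comp (rename genIdx) = (theta : S F m →ₐ[F] S F m) := by
    ext i : 1
    rw [AlgHom.comp_apply, rename_X, aeval_X, gen_genIdx]
  exact DFunLike.congr_fun h f

theorem aeval_combLift (β : (Fin (2 * m - 2) → Fin (Fintype.card F)) → S F m) :
    aeval (gen F m) (combLift β) = comb β := by
  rw [combLift_apply, map_sum, comb]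
  refine Finset.sum_congr rfl fun e _ => ?_
  rw [map_mul, aeval_rename_genIdx, blockExponent, monomial_sum_one, map_prod, blockMonomial]
  refine congrArg _ (Finset.prod_congr rfl fun j _ => ?_)
  rw [← X_pow_eq_monomial, map_pow, aeval_X, gen]

theorem mem_support_combLift {β : (Fin (2 * m - 2) → Fin (Fintype.card F)) → S F m}
    {s : Gen m →₀ ℕ} (hs : s ∈ (combLift β).support) :
    ∃ e, ∃ u ∈ (β e).support, s = u.mapDomain genIdx + blockExponent e := by
  classical
  rw [combLift_apply] at hs
  obtain ⟨e, -, he⟩ := Finset.mem_biUnion.1 (support_sum hs)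
  obtain ⟨t, ht, t', ht', rfl⟩ := Finset.mem_add.1 (support_mul _ _ he)
  obtain ⟨u, rfl, hu⟩ := coeff_rename_ne_zero _ _ _ (mem_support_iff.1 ht)
  exact ⟨e, u, mem_support_iff.2 hu, by rw [Finset.mem_singleton.1 (support_monomial_subset ht')]⟩

theorem exists_eq_combLift {f : MvPolynomial (Gen m) F}
    (hf : ∀ s ∈ f.support, ∀ j, s (.xi j) < Fintype.card F) : ∃ β, combLift β = f := by
  change f ∈ LinearMap.range (combLift (F := F) (m := m))
  rw [f.as_sum]
  refine sum_mem fun s hs => ?_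
  set e : Fin (2 * m - 2) → Fin (Fintype.card F) := fun j => ⟨s (.xi j), hf s hs j⟩ with he
  set u := s.comapDomain genIdx genIdx_injective.injOn with hu
  refine ⟨Pi.single e (monomial u (coeff s f)), ?_⟩
  rw [combLift_apply, Finset.sum_eq_single e]
  · rw [Pi.single_eq_same, rename_monomial, monomial_mul, mul_one]
    refine congrArg (fun t => monomial t _) (Finsupp.ext fun g => ?_)
    rw [Finsupp.add_apply]
    rcases gen_cases g with ⟨i, rfl⟩ | ⟨j, rfl⟩
    · rw [Finsupp.mapDomain_apply genIdx_injective, blockExponent_apply_genIdx, add_zero]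
      rfl
    · rw [Finsupp.mapDomain_of_notMem_range _ _ fun ⟨i, hi⟩ => genIdx_ne_xi i j hi, zero_add,
        blockExponent_apply_xi]
  · intro e' _ h
    rw [Pi.single_eq_of_ne h, map_zero, zero_mul]
  · simp

/-- Freeness of `A`, read as injectivity of evaluation on polynomials with small ξ-exponents. -/
theorem eq_zero_of_aeval_eq_zero (hF : Odd (Fintype.card F)) {f : MvPolynomial (Gen m) F}
    (hf : ∀ s ∈ f.support, ∀ j, s (.xi j) < Fintype.card F) (h : aeval (gen F m) f = 0) :
    f = 0 := by
  obtain ⟨β, rfl⟩ := exists_eq_combLift hf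
  rw [aeval_combLift] at h
  rw [eq_zero_of_comb_eq_zero hF h, map_zero]

end Lift

section

variable {F : Type*} [Field F] [Fintype F] {m : ℕ} [NeZero m]

/-! ### The relations between the generators -/

section Relations

theorem weight_mapDomain {σ τ : Type*} (w : τ → ℕ) (f : σ → τ) (u : σ →₀ ℕ) :
    Finsupp.weight w (u.mapDomain f) = Finsupp.weight (w ∘ f) u :=
  Finsupp.linearCombination_mapDomain ℕ f u

theorem isHomogeneous_xi {F : Type*} [Field F] [Fintype F] {m : ℕ} (j : ℕ) :
    (xi F m j).IsHomogeneous (Fintype.card F ^ j + 1) := by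
  have hX (i : Fin (2 * m)) : (X i : S F m).IsHomogeneous 1 := isHomogeneous_X _ i
  rw [xi]
  split_ifs with hj
  · subst hj
    exact IsHomogeneous.sum _ _ _ fun i _ => (hX _).mul (hX _)
  · refine IsHomogeneous.sum _ _ _ fun i _ => ?_
    have h (a b : Fin (2 * m)) : (X a ^ Fintype.card F ^ j * X b : S F m).IsHomogeneous
        (Fintype.card F ^ j + 1) := (isHomogeneous_X_pow a _).mul (hX b)
    refine (h _ _).add ?_
    rw [mul_comm (y F i)]
    exact h _ _

variable (m) in
/-- Weights on the generators for which `ξⱼ^q` is heavier than the other terms of its relation. -/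
def relationWeight (q : ℕ) : Gen m → ℕ
  | .N => q * (2 * m - 2) * q ^ (2 * m - 2)
  | .xi j => q * (2 * m - 2) * q ^ (j : ℕ) + 1
  | _ => 0

/-- The weight is q(2m-2) times the y₁-degree of the corresponding product, plus the number of
ξ-factors. The second summand is at most q(2m-2), so it serves to break ties. -/
theorem weight_relationWeight (q : ℕ) (u : Fin (2 * m) →₀ ℕ) (e : Fin (2 * m - 2) → Fin q) :
    Finsupp.weight (relationWeight m q) (u.mapDomain genIdx + blockExponent e)
      = q * (2 * m - 2) * (u (yIdx 0) * q ^ (2 * m - 2) + blockDegree e) + ∑ j, (e j : ℕ) := by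
  have h : relationWeight m q ∘ genIdx
      = Pi.single (yIdx 0) (q * (2 * m - 2) * q ^ (2 * m - 2)) := by
    funext i
    rw [Function.comp_apply]
    rcases index_cases i with ⟨i, rfl⟩ | ⟨i, rfl⟩
    · by_cases hi : i = 0
      · rw [hi, genIdx_eq (g := .N) rfl, Pi.single_eq_same, relationWeight]
      · rw [genIdx_eq (g := .Y i hi) rfl, Pi.single_eq_of_ne fun h => hi (yIdx_injective h)]
        rfl
    · rw [Pi.single_eq_of_ne (yIdx_ne_xIdx 0 i).symm]
      by_cases hi : i = 0
      · rw [hi, genIdx_eq (g := .x₁) rfl]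
        rfl
      · rw [genIdx_eq (g := .X i hi) rfl]
        rfl
  rw [map_add, weight_mapDomain, h, Finsupp.weight_single_index,
    blockExponent, map_sum, blockDegree, mul_add, smul_eq_mul, add_assoc, Finset.mul_sum,
    ← Finset.sum_add_distrib]
  congr 1
  · ring
  · refine Finset.sum_congr rfl fun j _ => ?_
    rw [Finsupp.weight_single, relationWeight, smul_eq_mul]
    ring

theorem isHomogeneous_artin (i : Fin (2 * m)) :
    (X i ^ Fintype.card F - X i * x F 0 ^ (Fintype.card F - 1) : S F m).IsHomogeneous
      (Fintype.card F) := by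
  refine (isHomogeneous_X_pow i _).sub ?_
  have h := (isHomogeneous_X F i).mul (isHomogeneous_X_pow (R := F) (xIdx (0 : Fin m))
    (Fintype.card F - 1))
  rwa [Nat.add_sub_cancel' Fintype.card_pos] at h

theorem isHomogeneous_gen (hF : Odd (Fintype.card F)) (g : Gen m) :
    (gen F m g).IsHomogeneous (gen F m g).totalDegree := by
  have h : ∃ n, (gen F m g).IsHomogeneous n := by
    cases g with
    | x₁ => exact ⟨1, isHomogeneous_X F _⟩
    | Y i hi => exact ⟨_, isHomogeneous_artin _⟩
    | X i hi => exact ⟨_, isHomogeneous_artin _⟩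
    | N => exact ⟨_, normY_isHomogeneous hF⟩
    | xi j => exact ⟨_, isHomogeneous_xi _⟩
  obtain ⟨n, hn⟩ := h
  by_cases h0 : gen F m g = 0
  · rw [h0]
    exact isHomogeneous_zero _ _ _
  · rwa [hn.totalDegree h0]

theorem exists_xi_pow_eq (hF : Odd (Fintype.card F)) (j : Fin (2 * m - 2)) :
    ∃ p : MvPolynomial (Gen m) F,
      p ∈ below F (relationWeight m (Fintype.card F))
        (Finsupp.weight (relationWeight m (Fintype.card F))
          (Finsupp.single (.xi j) (Fintype.card F))) ∧
      IsWeightedHomogeneous (fun g => (gen F m g).totalDegree) p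
        (Fintype.card F * (gen F m (.xi j)).totalDegree) ∧
      aeval (gen F m) p = xi F m j ^ Fintype.card F := by
  obtain ⟨β, hβ⟩ := exists_eq_comb hF (pow_mem (xi_mem_invariants (F := F) (m := m) j)
    (Fintype.card F))
  -- Passing to a component makes the relation homogeneous. Its value is unchanged because ξⱼ^q is
  -- homogeneous of that degree.
  refine ⟨weightedHomogeneousComponent (fun g => (gen F m g).totalDegree)
    (Fintype.card F * (gen F m (.xi j)).totalDegree) (combLift β), ?_,
    weightedHomogeneousComponent_isWeightedHomogeneous _ _, ?_⟩
  · refine mem_below.2 fun s hs => ?_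
    have hs' : s ∈ (combLift β).support := by
      classical
      rw [support_weightedHomogeneousComponent] at hs
      exact Finset.mem_of_mem_filter s hs
    obtain ⟨e, u, hu, rfl⟩ := mem_support_combLift hs'
    have hq : 1 < Fintype.card F := Fintype.one_lt_card
    have hne : β e ≠ 0 := fun h => by simp [h] at hu
    have h1 := degY_le_degY_comb hF β hne
    rw [← hβ, degY, degY, map_pow, Polynomial.natDegree_pow, ← degY, ← degY, degY_xi,
      ← pow_succ'] at h1
    have h2 : u (yIdx 0) * Fintype.card F ^ (2 * m - 2) + blockDegree e
        ≤ Fintype.card F ^ ((j : ℕ) + 1) :=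
      (Nat.add_le_add_right (Nat.mul_le_mul_right _ (le_natDegree_toPoly _ hu)) _).trans h1
    have h3 : Finsupp.weight (relationWeight m (Fintype.card F))
        (Finsupp.single (.xi j) (Fintype.card F))
        = Fintype.card F * (2 * m - 2) * Fintype.card F ^ ((j : ℕ) + 1) + Fintype.card F := by
      rw [Finsupp.weight_single, relationWeight, smul_eq_mul, pow_succ]
      ring
    rw [weight_relationWeight, h3]
    -- At equal y₁-degree the term has fewer than the q ξ-factors of ξⱼ^q. At smaller y₁-degree the
    -- weight drops by at least q(2m-2), which the digit sum cannot make up.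
    rcases h2.eq_or_lt with h2 | h2
    · rw [h2]
      exact Nat.add_lt_add_left (digit_sum_lt hq j.2 e h2) _
    · have h4 := Nat.mul_le_mul_left (Fintype.card F * (2 * m - 2)) (Nat.succ_le_of_lt h2)
      rw [Nat.mul_succ] at h4
      have h5 := digit_sum_le e
      omega
  · rw [aeval_weightedHomogeneousComponent (isHomogeneous_gen hF), aeval_combLift, ← hβ]
    refine homogeneousComponent_eq_self ?_
    rw [mul_comm (Fintype.card F)]
    exact (isHomogeneous_gen hF (.xi j)).pow _

theorem exists_presentation (hF : Odd (Fintype.card F)) :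
    ∃ rs : List (MvPolynomial (Gen m) F), rs.length = 2 * m - 2 ∧
      IsCompleteIntersectionPresentation (A F m) (gen F m) rs := by
  choose p hlow hhom hp using exists_xi_pow_eq (F := F) (m := m) hF
  set r : Fin (2 * m - 2) → MvPolynomial (Gen m) F :=
    fun j => X (.xi j) ^ Fintype.card F - p j with hr
  have hlead (j) : IsLead (relationWeight m (Fintype.card F)) (r j)
      (Finsupp.single (.xi j) (Fintype.card F)) := by
    rw [IsLead, ← X_pow_eq_monomial, sub_sub_cancel_left]
    exact neg_mem (hlow j)
  have hker : Ideal.ofList (List.ofFn r)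
      ≤ RingHom.ker (aeval (gen F m) : MvPolynomial (Gen m) F →ₐ[F] S F m) := by
    refine Ideal.span_le.2 fun f hf => ?_
    obtain ⟨j, rfl⟩ := (List.mem_ofFn' r f).1 hf
    rw [SetLike.mem_coe, RingHom.mem_ker, hr, map_sub, map_pow, aeval_X, hp, gen, sub_self]
  refine ⟨List.ofFn r, List.length_ofFn, adjoin_range_gen, fun f hf => ?_,
    isRegular_of_isLead xi_label_injective Fintype.card_pos hlead, ?_⟩
  · obtain ⟨j, rfl⟩ := (List.mem_ofFn' r f).1 hf
    refine ⟨_, IsWeightedHomogeneous.sub ?_ (hhom j)⟩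
    exact (isWeightedHomogeneous_X F _ (Gen.xi j)).pow _
  · refine le_antisymm (fun f hf => ?_) hker
    -- Modulo the relations `f` equals a reduced polynomial `g`, and a reduced polynomial with value
    -- zero is zero.
    obtain ⟨g, hg, hfg⟩ := exists_reduced xi_label_injective Fintype.card_pos hlead f
    have h : aeval (gen F m) g = 0 := by
      have := hker hfg
      rw [RingHom.mem_ker, map_sub, RingHom.mem_ker.1 hf, zero_sub, neg_eq_zero] at this
      exact this
    rwa [eq_zero_of_aeval_eq_zero hF hg h, sub_zero] at hfg

end Relations

/-! ### From labelled generators to numbered variables -/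

section CompleteIntersection

theorem IsCompleteIntersectionPresentation.isCompleteIntersection {k σ ι : Type*} [Field k]
    [Finite ι] {B : Subalgebra k (MvPolynomial σ k)} {g : ι → MvPolynomial σ k}
    {rs : List (MvPolynomial ι k)} (h : IsCompleteIntersectionPresentation B g rs) :
    IsCompleteIntersection k B := by
  obtain ⟨hB, -, hreg, hker⟩ := h
  obtain ⟨n, ⟨e⟩⟩ := Finite.exists_equiv_fin ι
  set ε : MvPolynomial ι k ≃ₐ[k] MvPolynomial (Fin n) k := renameEquiv k e with hε
  have hmem (f : MvPolynomial ι k) : aeval g f ∈ B := by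
    rw [← hB, Algebra.adjoin_range_eq_range_aeval]
    exact ⟨f, rfl⟩
  refine ⟨n, ((aeval g).codRestrict B hmem).comp ε.symm.toAlgHom, rs.map ε, ?_, ?_, ?_⟩
  · rintro ⟨b, hb⟩
    have hb' := hb
    rw [← hB, Algebra.adjoin_range_eq_range_aeval] at hb'
    obtain ⟨f, hf⟩ := hb'
    refine ⟨ε f, Subtype.ext ?_⟩
    change aeval g (ε.symm (ε f)) = b
    rw [AlgEquiv.symm_apply_apply]
    exact hf
  · refine (AddEquiv.isRegular_congr (e := ε.toRingEquiv.toAddEquiv) ?_).1 hreg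
    exact List.forall₂_map_right_iff.2 (List.forall₂_same.2 fun r _ f => map_mul ε r f)
  · have h1 : Ideal.ofList (rs.map ε) = (Ideal.ofList rs).map (ε : MvPolynomial ι k →+* _) :=
      (Ideal.map_ofList _ _).symm
    rw [h1, ← hker]
    ext f
    rw [RingHom.mem_ker]
    constructor
    · intro hf
      have h2 : ε.symm f ∈ RingHom.ker (aeval g : MvPolynomial ι k →ₐ[k] MvPolynomial σ k) :=
        congrArg Subtype.val hf
      have h3 := Ideal.mem_map_of_mem (ε : MvPolynomial ι k →+* MvPolynomial (Fin n) k) h2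
      rwa [RingHom.coe_coe, AlgEquiv.apply_symm_apply] at h3
    · intro hf
      rw [← RingHom.mem_ker]
      refine Ideal.map_le_iff_le_comap.2 (fun f hf => ?_) hf
      rw [Ideal.mem_comap, RingHom.mem_ker]
      refine Subtype.ext ?_
      change aeval g (ε.symm (ε f)) = 0
      rw [AlgEquiv.symm_apply_apply]
      exact hf

end CompleteIntersection

end

end

end OrthHook

theorem theorem5p3 (F : Type*) [Field F] [Fintype F] (hF : Odd (Fintype.card F))
    (m : ℕ) [NeZero m] :
    -- `Q^H = F[x₁, Yᵢ, Xᵢ | 2 ≤ i ≤ m]`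
    OrthHook.QH F m = Algebra.adjoin F ({OrthHook.x F 0} ∪
      {f | ∃ i : Fin m, i ≠ 0 ∧ (f = OrthHook.bigY F m i ∨ f = OrthHook.bigX F m i)}) ∧
    -- `S_m^H = A`
    OrthHook.invariants (OrthHook.hook F m) = OrthHook.A F m ∧
    -- `A` is a complete intersection, with `n - 2` relations on the given generators
    OrthHook.IsCompleteIntersection F (OrthHook.A F m) ∧
    (∃ rs : List (MvPolynomial (OrthHook.Gen m) F), rs.length = 2 * m - 2 ∧
      OrthHook.IsCompleteIntersectionPresentation (OrthHook.A F m) (OrthHook.gen F m) rs) ∧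
    -- `A` is free over `Q^H[N(y₁)]` on the monomial factors of `(ξ₀ ⋯ ξ_{n-3})^(q-1)`
    LinearIndependent (OrthHook.QHN F m) (OrthHook.blockMonomial F m) ∧
    (Submodule.span (OrthHook.QHN F m) (Set.range (OrthHook.blockMonomial F m)) :
      Set (OrthHook.S F m)) = OrthHook.A F m ∧
    -- `x₁` is a prime element of `A`
    ∃ h : OrthHook.x F 0 ∈ OrthHook.A F m,
      Prime (⟨OrthHook.x F 0, h⟩ : OrthHook.A F m) :=
  ⟨OrthHook.QH_eq_adjoin F m, OrthHook.invariants_hook_eq hF,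
    (OrthHook.exists_presentation hF).elim fun _ h => h.2.isCompleteIntersection,
    OrthHook.exists_presentation hF, OrthHook.linearIndependent_blockMonomial hF,
    OrthHook.span_blockMonomial hF, OrthHook.prime_x hF⟩
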